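/- An elementary gate is a Hadamard gate $H$ or one of the classical reversible gates $X$, CNOT, Toffoli, and a quantum circuit on $N$ qubits is a finite sequence of elementary gates acting on these qubits. A circuit on $N\ge 1$ qubits is an HC1Q circuit if it has the form $(H^{\otimes (N-1)}\otimes I)\,C\,(H^{\otimes (N-1)}\otimes I)$, where $C$ is a classical reversible circuit on $N$ bits, given as a sequence of $X$, CNOT and Toffoli gates. Let $p$ be a polynomial with non-negative integer coefficients. PDD-Max (probability distribution distinguishability with maximum norm) with bound $p$, restricted to HC1Q circuits, is the following promise problem. The input is a classical description of two HC1Q circuits $U_1,U_2$ on $N$ qubits with at most $p(N)$ gates each (with $N$ in unary) and of two rational numbers $a,b$ (with numerators and denominators in binary) such that $0\le b<a\le 1$ and $p(N)\,(a-b)\ge 1$. With $p_z=|\langle z|U_1|0^N\rangle|^2$ and $q_z=|\langle z|U_2|0^N\rangle|^2$, decide between - YES: there is $z\in\{0,1\}^N$ with $|p_z-q_z|\ge a$; - NO: $|p_z-q_z|\le b$ for all $z\in\{0,1\}^N$. **Theorem.** For every $p$, this promise problem has a Merlin–Arthur system with a quantum polynomial-time Merlin. That is, there are a classical probabilistic polynomial-time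 verifier (Arthur), who receives the input $w$ and a single message consisting of a bit string whose length is at most a fixed polynomial in $|w|$, and a classical deterministic polynomial-time algorithm $G$, such that 1. for every YES-instance $w$, $G(w)$ is the description of a quantum circuit $Q_w$ made of elementary gates, on a number of qubits that is at most the bound on the message length, and if Merlin applies $Q_w$ to the state $|0\cdots0\rangle$, measures all qubits in the computational basis and sends the outcome, then Arthur accepts with probability at least $2/3$ (over the measurement and Arthur's random bits); 2. for every NO-instance $w$ and every message of admissible length, Arthur accepts with probability at most $1/3$. -/

import Mathlib

namespace HC1Q

/-! ## Classical computation: random access machines with logarithmic cost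

Structured programs over finitely many number registers and finitely many arrays of numbers.
Every elementary operation is charged the bit lengths of the numbers it handles. -/

/-- Contents of the registers `reg i` and of the array cells `arr k j`. -/
structure Store where
  reg : ℕ → ℕ
  arr : ℕ → ℕ → ℕ

/-- The arithmetic and comparison operations of the machine. -/
inductive Op where
  | add | sub | mul | div | lt | eq

/-- Subtraction is truncated, division is rounded down (with `x / 0 = 0`),
comparisons return `1` or `0`. -/
def Op.apply : Op → ℕ → ℕ → ℕ
  | .add, x, y => x + y
  | .sub, x, y => x - y
  | .mul, x, y => x * y
  | .div, x, y => x / y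
  | .lt, x, y => if x < y then 1 else 0
  | .eq, x, y => if x = y then 1 else 0

/-- Expressions: constants, registers, array cells (at a computed address), operations. -/
inductive Exp where
  | const (n : ℕ)
  | reg (i : ℕ)
  | cell (k : ℕ) (address : Exp)
  | op (o : Op) (e₁ e₂ : Exp)

/-- The value of an expression. -/
def Exp.value (s : Store) : Exp → ℕ
  | .const n => n
  | .reg i => s.reg i
  | .cell k a => s.arr k (a.value s)
  | .op o e₁ e₂ => o.apply (e₁.value s) (e₂.value s)

/-- The cost of evaluating an expression: every node costs one plus the bit length of its value
(so that addresses and operands are charged at their own nodes). -/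
def Exp.cost (s : Store) : Exp → ℕ
  | .const n => 1 + Nat.size n
  | .reg i => 1 + Nat.size (s.reg i)
  | .cell k a => a.cost s + (1 + Nat.size (s.arr k (a.value s)))
  | .op o e₁ e₂ =>
      e₁.cost s + e₂.cost s + (1 + Nat.size (o.apply (e₁.value s) (e₂.value s)))

/-- Programs. A test `e` succeeds if its value is not zero. -/
inductive Prog where
  | skip
  | assign (i : ℕ) (e : Exp)
  | store (k : ℕ) (address e : Exp)
  | seq (P Q : Prog)
  | ite (e : Exp) (P Q : Prog)
  | loop (e : Exp) (P : Prog)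

/-- `Run P s s' t`: the program `P`, started with store `s`, halts with store `s'`
after a computation of total cost `t`. -/
inductive Run : Prog → Store → Store → ℕ → Prop
  | skip (s : Store) : Run .skip s s 1
  | assign (i : ℕ) (e : Exp) (s : Store) :
      Run (.assign i e) s ⟨Function.update s.reg i (e.value s), s.arr⟩ (1 + e.cost s)
  | store (k : ℕ) (a e : Exp) (s : Store) :
      Run (.store k a e) s
        ⟨s.reg, Function.update s.arr k (Function.update (s.arr k) (a.value s) (e.value s))⟩
        (1 + a.cost s + e.cost s)
  | seq {P Q : Prog} {s s' s'' : Store} {t t' : ℕ} :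
      Run P s s' t → Run Q s' s'' t' → Run (.seq P Q) s s'' (1 + t + t')
  | ite_true {e : Exp} {P Q : Prog} {s s' : Store} {t : ℕ} :
      e.value s ≠ 0 → Run P s s' t → Run (.ite e P Q) s s' (1 + e.cost s + t)
  | ite_false {e : Exp} {P Q : Prog} {s s' : Store} {t : ℕ} :
      e.value s = 0 → Run Q s s' t → Run (.ite e P Q) s s' (1 + e.cost s + t)
  | loop_stop {e : Exp} {P : Prog} {s : Store} :
      e.value s = 0 → Run (.loop e P) s s (1 + e.cost s)
  | loop_step {e : Exp} {P : Prog} {s s' s'' : Store} {t t' : ℕ} :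
      e.value s ≠ 0 → Run P s s' t → Run (.loop e P) s' s'' t' →
        Run (.loop e P) s s'' (1 + e.cost s + t + t')

/-- The initial store: the `k`-th input word is in array `k`, its length in register `k`,
and everything else is zero. -/
def load (inputs : List (List ℕ)) : Store where
  reg k := (inputs.getD k []).length
  arr k j := (inputs.getD k []).getD j 0

/-- The output of a halted program: the first `reg 0` cells of array `0`. -/
def Store.output (s : Store) : List ℕ :=
  (List.range (s.reg 0)).map (s.arr 0)

/-- The size in bits of a word of numbers. -/
def size (w : List ℕ) : ℕ :=
  (w.map fun n => Nat.size n + 1).sum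

/-- A function on words that is computed by a program in polynomial time. -/
def PolyTime (f : List ℕ → List ℕ) : Prop :=
  ∃ (P : Prog) (q : Polynomial ℕ), ∀ w : List ℕ,
    size (f w) ≤ q.eval (size w) ∧
    ∃ (s : Store) (t : ℕ), Run P (load [w]) s t ∧ s.output = f w ∧ t ≤ q.eval (size w)

/-- A bit string as a word of numbers `0` and `1`. -/
def bits (m : List Bool) : List ℕ :=
  m.map Bool.toNat

/-! ## Quantum circuits -/

/-- The classical reversible gates `X`, `CNOT` and Toffoli on `N` wires (the target comes last). -/
inductive ClassicalGate (N : ℕ) where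
  | x (t : Fin N)
  | cnot (c t : Fin N) (h : c ≠ t)
  | ccx (c d t : Fin N) (hcd : c ≠ d) (hct : c ≠ t) (hdt : d ≠ t)

/-- The action of a classical gate on bit strings. -/
def ClassicalGate.act {N : ℕ} : ClassicalGate N → (Fin N → Bool) → (Fin N → Bool)
  | .x t, w => Function.update w t (!w t)
  | .cnot c t _, w => Function.update w t (Bool.xor (w t) (w c))
  | .ccx c d t _ _ _, w => Function.update w t (Bool.xor (w t) (w c && w d))

/-- The elementary quantum gates: Hadamard gates and classical reversible gates. -/
inductive Gate (N : ℕ) where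
  | had (i : Fin N)
  | classical (g : ClassicalGate N)

/-- The matrix of a gate in the computational basis of `N` qubits. -/
noncomputable def Gate.matrix {N : ℕ} : Gate N → Matrix (Fin N → Bool) (Fin N → Bool) ℂ
  | .had i => Matrix.of fun x y =>
      if ∀ j, j ≠ i → x j = y j then (if x i && y i then -1 else 1) / (Real.sqrt 2 : ℂ) else 0
  | .classical g => Matrix.of fun x y => if x = g.act y then 1 else 0

/-- A circuit is a list of gates, the first gate being applied first. -/
abbrev Circuit (N : ℕ) := List (Gate N)

/-- The unitary matrix of a circuit. -/
noncomputable def Circuit.matrix {N : ℕ} :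
    Circuit N → Matrix (Fin N → Bool) (Fin N → Bool) ℂ
  | [] => 1
  | g :: U => Circuit.matrix U * g.matrix

/-- The probability `|⟨z|U|0^N⟩|²` of the outcome `z` when all qubits of `U|0^N⟩` are measured. -/
noncomputable def prob {N : ℕ} (U : Circuit N) (z : Fin N → Bool) : ℝ :=
  ‖Circuit.matrix U z (fun _ => false)‖ ^ 2

/-- The layer `H^{⊗(N-1)} ⊗ I`: a Hadamard gate on every qubit but the last. -/
def hadLayer (N : ℕ) : Circuit N :=
  ((List.finRange N).filter fun i => i.val + 1 < N).map Gate.had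

/-- Circuits of the form `(H^{⊗(N-1)} ⊗ I) C (H^{⊗(N-1)} ⊗ I)` with `C` a classical reversible
circuit on `N ≥ 1` wires. -/
def IsHC1Q (N : ℕ) (U : Circuit N) : Prop :=
  1 ≤ N ∧ ∃ C : List (ClassicalGate N),
    U = hadLayer N ++ C.map Gate.classical ++ hadLayer N

/-! ## Classical descriptions -/

/-- Description of a gate by four numbers. -/
def Gate.encode {N : ℕ} : Gate N → List ℕ
  | .had i => [0, i, 0, 0]
  | .classical (.x t) => [1, t, 0, 0]
  | .classical (.cnot c t _) => [2, c, t, 0]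
  | .classical (.ccx c d t _ _ _) => [3, c, d, t]

/-- Description of a circuit: the number of qubits in unary, the number of gates, the gates. -/
def Circuit.encode {N : ℕ} (U : Circuit N) : List ℕ :=
  List.replicate N 1 ++ [0, U.length] ++ U.flatMap Gate.encode

/-- Description of a non-negative rational number. -/
def encodeRat (a : ℚ) : List ℕ :=
  [a.num.natAbs, a.den]

/-! ## Probability distribution distinguishability with maximum norm -/

/-- A promise problem on words of numbers. -/
structure PromiseProblem where
  yes : Set (List ℕ)
  no : Set (List ℕ)

/-- Two circuits on the same number of qubits and two thresholds. -/
structure Instance where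
  N : ℕ
  U₁ : Circuit N
  U₂ : Circuit N
  a : ℚ
  b : ℚ

/-- The classical description of an instance. -/
def Instance.encode (I : Instance) : List ℕ :=
  Circuit.encode I.U₁ ++ Circuit.encode I.U₂ ++ encodeRat I.a ++ encodeRat I.b

/-- At most `p(N)` gates in each circuit, `0 ≤ b < a ≤ 1`, and `a - b ≥ 1 / p(N)`. -/
def Instance.Valid (p : Polynomial ℕ) (I : Instance) : Prop :=
  I.U₁.length ≤ p.eval I.N ∧ I.U₂.length ≤ p.eval I.N ∧
    0 ≤ I.b ∧ I.b < I.a ∧ I.a ≤ 1 ∧ 1 ≤ ((p.eval I.N : ℕ) : ℚ) * (I.a - I.b)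

/-- PDD-Max with polynomial bound `p`, restricted to circuits from the class `K`:
do the output distributions differ by at least `a` at some outcome, or by at most `b` at each? -/
def PDDMax (p : Polynomial ℕ) (K : ∀ N : ℕ, Circuit N → Prop) : PromiseProblem where
  yes := {w | ∃ I : Instance, w = I.encode ∧ I.Valid p ∧ K I.N I.U₁ ∧ K I.N I.U₂ ∧
    ∃ z : Fin I.N → Bool, (I.a : ℝ) ≤ |prob I.U₁ z - prob I.U₂ z|}
  no := {w | ∃ I : Instance, w = I.encode ∧ I.Valid p ∧ K I.N I.U₁ ∧ K I.N I.U₂ ∧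
    ∀ z : Fin I.N → Bool, |prob I.U₁ z - prob I.U₂ z| ≤ (I.b : ℝ)}

/-! ## Merlin-Arthur systems with quantum polynomial-time Merlin -/

/-- The program `V` halts in register `0` with `1` on input `w`, message `m`, random bits `r`. -/
def Accepts (V : Prog) (w : List ℕ) (m r : List Bool) : Prop :=
  ∃ (s : Store) (t : ℕ), Run V (load [w, bits m, bits r]) s t ∧ s.reg 0 = 1

/-- The probability that `V` accepts when its `R` random bits are uniform and independent. -/
noncomputable def acceptProb (V : Prog) (R : ℕ) (w : List ℕ) (m : List Bool) : ℝ :=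
  (Nat.card {r : Fin R → Bool // Accepts V w m (List.ofFn r)} : ℝ) / 2 ^ R

/-- There is a classical probabilistic polynomial-time verifier `V` (Arthur), using `ρ(|w|)`
random bits and receiving one message of at most `μ(|w|)` bits, such that:
for every yes-instance `w`, a prover (Merlin) who runs the quantum circuit that is
generated from `w` in polynomial time, measures all its qubits and sends the outcome
makes Arthur accept with probability at least `2/3`; and for every no-instance no message makes
Arthur accept with probability more than `1/3`. -/
def HasMerlinArthurSystemWithQuantumPolyTimeMerlin (A : PromiseProblem) : Prop :=
  ∃ (V : Prog) (μ ρ q : Polynomial ℕ) (merlin : List ℕ → List ℕ),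
    (∀ (w : List ℕ) (m r : List Bool),
      m.length ≤ μ.eval (size w) → r.length = ρ.eval (size w) →
        ∃ (s : Store) (t : ℕ), Run V (load [w, bits m, bits r]) s t ∧ t ≤ q.eval (size w)) ∧
    PolyTime merlin ∧
    (∀ w ∈ A.yes, ∃ (M : ℕ) (Q : Circuit M),
      merlin w = Circuit.encode Q ∧ M ≤ μ.eval (size w) ∧
        2 / 3 ≤ ∑ z : Fin M → Bool,
          prob Q z * acceptProb V (ρ.eval (size w)) w (List.ofFn z)) ∧
    (∀ w ∈ A.no, ∀ m : List Bool, m.length ≤ μ.eval (size w) →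
      acceptProb V (ρ.eval (size w)) w m ≤ 1 / 3)

end HC1Q

/-! Between the two Hadamard layers an HC1Q circuit only permutes bit strings. Summing over paths,
the amplitude of an outcome `z` is, up to a global sign, the average over uniform `x` of a sign
`pathSign U z x` in {-1, 0, 1}, and this sign is found by classical simulation of the reversible
gates (`prob_eq_of_isHC1Q`). The probability of `z` is the square of that average, hence the
expectation of the product of the signs of two independent strings. So for a given `z` the
difference of the two probabilities has an unbiased classical estimator with values in [-2, 2]
(`sum_sampleValue`), and by Chebyshev polynomially many samples tell the thresholds `a` and `b`
apart, because their gap is inverse polynomial (`card_deviation_le`).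

What Arthur cannot do is find `z`. If the two probabilities differ by at least `a`, the larger one
is at least `a`, and `a ≥ a - b ≥ 1 / p(N)`. Running both circuits about `9 p(N)` times therefore
produces `z` with probability at least 9/10 (`prod_missing_le`). Merlin's circuit consists of that
many copies of both circuits on disjoint blocks of qubits, whose outcomes are independent
(`prob_blockCircuit`), and the message is the list of all outcomes. Arthur estimates the difference
for each candidate and accepts if one estimate exceeds the mean of the thresholds. Soundness is a
union bound over the candidates, so it holds for every message (`acceptProb_le_of_no`); completeness
multiplies two probabilities of 9/10 (`le_sum_of_yes`).

The rest is about the machine. Both algorithms are written in a language of bounded loops, `Cmd`. If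
every loop is bounded by a read-only register and every product has a factor from read-only data,
then bit lengths grow additively and not geometrically, and `Cmd.exists_run` gives polynomial time
from a syntactic check that is mostly settled by `decide`. Correctness is shown with loop invariants
(`Cmd.exec_loop`), leading to `verifier_spec` for Arthur and to `generator_encode` and
`polyTime_generator` for Merlin. -/

namespace HC1Q

/-! ## Programs with bounded loops -/

/-- Writing a register. -/
def Store.setReg (s : Store) (i v : ℕ) : Store := ⟨Function.update s.reg i v, s.arr⟩

/-- Writing an array cell. -/
def Store.setArr (s : Store) (k j v : ℕ) : Store :=
  ⟨s.reg, Function.update s.arr k (Function.update (s.arr k) j v)⟩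

@[simp] theorem Store.reg_setReg (s : Store) (i v j : ℕ) :
    (s.setReg i v).reg j = if j = i then v else s.reg j := by
  simp [Store.setReg, Function.update_apply]

@[simp] theorem Store.arr_setReg (s : Store) (i v : ℕ) : (s.setReg i v).arr = s.arr := rfl

@[simp] theorem Store.reg_setArr (s : Store) (k j v : ℕ) : (s.setArr k j v).reg = s.reg := rfl

@[simp] theorem Store.arr_setArr (s : Store) (k j v k' j' : ℕ) :
    (s.setArr k j v).arr k' j' = if k' = k ∧ j' = j then v else s.arr k' j' := by
  by_cases h : k' = k
  · subst h
    simp [Store.setArr, Function.update_apply]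
  · simp [Store.setArr, h]

/-- Commands: like programs, but the only loops are `loop i c b P`, in which the counter `i` runs
through the numbers below both of the registers `c` and `b`. -/
inductive Cmd where
  | skip
  | assign (i : ℕ) (e : Exp)
  | store (k : ℕ) (a e : Exp)
  | seq (P Q : Cmd)
  | ite (e : Exp) (P Q : Cmd)
  | loop (i c b : ℕ) (P : Cmd)

infixr:60 " ;; " => Cmd.seq

/-- `n` rounds of a state change that depends on the number of the round. -/
def rounds (f : ℕ → Store → Store) (s : Store) : ℕ → Store
  | 0 => s
  | n + 1 => f n (rounds f s n)

/-- The effect of a command. -/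
def Cmd.exec : Cmd → Store → Store
  | .skip, s => s
  | .assign i e, s => s.setReg i (e.value s)
  | .store k a e, s => s.setArr k (a.value s) (e.value s)
  | .seq P Q, s => Q.exec (P.exec s)
  | .ite e P Q, s => if e.value s ≠ 0 then P.exec s else Q.exec s
  | .loop i c b P, s =>
      (rounds (fun j t => P.exec (t.setReg i j)) s (min (s.reg c) (s.reg b))).setReg i
        (min (s.reg c) (s.reg b))

/-- The condition of a bounded loop. -/
def loopTest (i c b : ℕ) : Exp := .op .mul (.op .lt (.reg i) (.reg c)) (.op .lt (.reg i) (.reg b))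

/-- The program that carries out a command. -/
def Cmd.compile : Cmd → Prog
  | .skip => .skip
  | .assign i e => .assign i e
  | .store k a e => .store k a e
  | .seq P Q => .seq P.compile Q.compile
  | .ite e P Q => .ite e P.compile Q.compile
  | .loop i c b P => .seq (.assign i (.const 0))
      (.loop (loopTest i c b) (.seq P.compile (.assign i (.op .add (.reg i) (.const 1)))))

/-- The command does not write register `r`. -/
def Cmd.keepsReg (r : ℕ) : Cmd → Bool
  | .skip => true
  | .assign i _ => i != r
  | .store _ _ _ => true
  | .seq P Q => P.keepsReg r && Q.keepsReg r
  | .ite _ P Q => P.keepsReg r && Q.keepsReg r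
  | .loop i _ _ P => i != r && P.keepsReg r

/-- The command does not write array `k`. -/
def Cmd.keepsArr (k : ℕ) : Cmd → Bool
  | .skip => true
  | .assign _ _ => true
  | .store k' _ _ => k' != k
  | .seq P Q => P.keepsArr k && Q.keepsArr k
  | .ite _ P Q => P.keepsArr k && Q.keepsArr k
  | .loop _ _ _ P => P.keepsArr k

theorem rounds_induction {f : ℕ → Store → Store} {s : Store} {n : ℕ} (I : ℕ → Store → Prop)
    (h0 : I 0 s) (hs : ∀ j < n, ∀ t, I j t → I (j + 1) (f j t)) : I n (rounds f s n) := by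
  induction n with
  | zero => exact h0
  | succ n ih => exact hs n (by omega) _ (ih fun j hj => hs j (by omega))

theorem Cmd.exec_reg {r : ℕ} {P : Cmd} (h : P.keepsReg r = true) (s : Store) :
    (P.exec s).reg r = s.reg r := by
  induction P generalizing s with
  | skip => rfl
  | assign i e =>
    simp only [keepsReg, bne_iff_ne] at h
    simp [exec, Ne.symm h]
  | store k a e => rfl
  | seq P Q ihP ihQ =>
    simp only [keepsReg, Bool.and_eq_true] at h
    simp [exec, ihP h.1, ihQ h.2]
  | ite e P Q ihP ihQ =>
    simp only [keepsReg, Bool.and_eq_true] at h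
    simp only [exec]
    split_ifs <;> simp [ihP h.1, ihQ h.2]
  | loop i c b P ih =>
    simp only [keepsReg, bne_iff_ne, Bool.and_eq_true] at h
    simp only [exec, Store.reg_setReg, if_neg (Ne.symm h.1)]
    exact rounds_induction (fun _ t => t.reg r = s.reg r) rfl fun j _ t ht => by
      rw [ih h.2, Store.reg_setReg, if_neg (Ne.symm h.1), ht]

theorem Cmd.exec_arr {k : ℕ} {P : Cmd} (h : P.keepsArr k = true) (s : Store) :
    (P.exec s).arr k = s.arr k := by
  induction P generalizing s with
  | skip => rfl
  | assign i e => rfl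
  | store k' a e =>
    simp only [keepsArr, bne_iff_ne] at h
    funext j
    simp [exec, Ne.symm h]
  | seq P Q ihP ihQ =>
    simp only [keepsArr, Bool.and_eq_true] at h
    simp [exec, ihP h.1, ihQ h.2]
  | ite e P Q ihP ihQ =>
    simp only [keepsArr, Bool.and_eq_true] at h
    simp only [exec]
    split_ifs <;> simp [ihP h.1, ihQ h.2]
  | loop i c b P ih =>
    simp only [keepsArr] at h
    simp only [exec, Store.arr_setReg]
    exact rounds_induction (fun _ t => t.arr k = s.arr k) rfl fun j _ t ht => by
      rw [ih h, Store.arr_setReg, ht]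

/-- The invariant rule for bounded loops. Registers and arrays that the body does not write
keep their values. -/
theorem Cmd.exec_loop {i c b : ℕ} {P : Cmd} {s : Store} (I : ℕ → Store → Prop)
    (n : ℕ) (hn : min (s.reg c) (s.reg b) = n)
    (h0 : I 0 s)
    (hs : ∀ j < n, ∀ t : Store,
      (∀ r, (Cmd.loop i c b P).keepsReg r = true → t.reg r = s.reg r) →
      (∀ k, P.keepsArr k = true → t.arr k = s.arr k) →
      I j t → I (j + 1) (P.exec (t.setReg i j)))
    (hi : ∀ j t v, I j t → I j (t.setReg i v)) :
    I n ((Cmd.loop i c b P).exec s) := by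
  simp only [exec, hn]
  -- A loop leaves the number of rounds in its counter, so the invariant must survive one last write
  -- to register `i`.
  apply hi
  have := rounds_induction (f := fun j t => P.exec (t.setReg i j)) (s := s) (n := n)
    (fun j t => (∀ r, (Cmd.loop i c b P).keepsReg r = true → t.reg r = s.reg r) ∧
      (∀ k, P.keepsArr k = true → t.arr k = s.arr k) ∧ I j t)
    ⟨fun _ _ => rfl, fun _ _ => rfl, h0⟩ (by
      rintro j hj t ⟨h1, h2, h3⟩
      refine ⟨fun r hr => ?_, fun k hk => ?_, hs j hj t h1 h2 h3⟩
      · have hr' := hr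
        simp only [keepsReg, bne_iff_ne, Bool.and_eq_true] at hr'
        rw [exec_reg hr'.2, Store.reg_setReg, if_neg (Ne.symm hr'.1), h1 r hr]
      · rw [exec_arr hk, Store.arr_setReg, h2 k hk])
  exact this.2.2

/-! ## Runs -/

/-- Acceptance only asks for some accepting run. Determinism is what turns the one run that is
constructed into a statement about rejection as well. -/
theorem Run.deterministic {P : Prog} {s s₁ s₂ : Store} {t₁ t₂ : ℕ} (h₁ : Run P s s₁ t₁)
    (h₂ : Run P s s₂ t₂) : s₁ = s₂ := by
  induction h₁ generalizing s₂ t₂ with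
  | skip => cases h₂; rfl
  | assign => cases h₂; rfl
  | store => cases h₂; rfl
  | seq _ _ ih ih' =>
    cases h₂ with
    | seq h h' =>
      obtain rfl := ih h
      exact ih' h'
  | ite_true hne _ ih =>
    cases h₂ with
    | ite_true _ h => exact ih h
    | ite_false h0 _ => exact absurd h0 hne
  | ite_false h0 _ ih =>
    cases h₂ with
    | ite_true hne h => exact absurd h0 hne
    | ite_false _ h => exact ih h
  | loop_stop h0 =>
    cases h₂ with
    | loop_stop => rfl
    | loop_step hne _ _ => exact absurd h0 hne
  | loop_step hne _ _ ih ih' =>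
    cases h₂ with
    | loop_stop h0 => exact absurd h0 hne
    | loop_step _ h h' =>
      obtain rfl := ih h
      exact ih' h'

/-! ### Polynomial running time of commands with bounded loops -/

/-- A factor that may occur on the right of a multiplication: a register from `ro` or
a cell of an array from `ra`. -/
def Exp.small (ro ra : List ℕ) : Exp → Bool
  | .reg i => ro.contains i
  | .cell k _ => ra.contains k
  | _ => false

/-- All multiplications have a right factor that is read from `ro` or `ra`. -/
def Exp.ok (ro ra : List ℕ) : Exp → Bool
  | .const _ => true
  | .reg _ => true
  | .cell _ a => a.ok ro ra
  | .op .mul e₁ e₂ => e₁.ok ro ra && e₂.ok ro ra && e₂.small ro ra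
  | .op _ e₁ e₂ => e₁.ok ro ra && e₂.ok ro ra

/-- The registers `ro` and the arrays `ra` are not written, all loops are bounded by registers from
`ro`, loop counters and bounds are not changed in the body, and multiplications have a factor that
is read from `ro` or `ra`. -/
def Cmd.ok (ro ra : List ℕ) : Cmd → Bool
  | .skip => true
  | .assign i e => !ro.contains i && e.ok ro ra
  | .store k a e => !ra.contains k && a.ok ro ra && e.ok ro ra
  | .seq P Q => P.ok ro ra && Q.ok ro ra
  | .ite e P Q => e.ok ro ra && P.ok ro ra && Q.ok ro ra
  | .loop i c b P => ro.contains c && !ro.contains i && i != b && P.keepsReg i && P.keepsReg b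
      && P.ok ro ra

theorem Cmd.keepsReg_of_ok {ro ra : List ℕ} {P : Cmd} (h : P.ok ro ra = true) {r : ℕ}
    (hr : r ∈ ro) : P.keepsReg r = true := by
  induction P with
  | skip => rfl
  | assign i e =>
    simp only [ok, Bool.and_eq_true, Bool.not_eq_true', List.contains_eq_mem,
      decide_eq_false_iff_not] at h
    simp only [keepsReg, bne_iff_ne]
    rintro rfl
    exact h.1 hr
  | store => rfl
  | seq P Q ihP ihQ =>
    simp only [ok, Bool.and_eq_true] at h
    simp [keepsReg, ihP h.1, ihQ h.2]
  | ite e P Q ihP ihQ =>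
    simp only [ok, Bool.and_eq_true] at h
    simp [keepsReg, ihP h.1.2, ihQ h.2]
  | loop i c b P ih =>
    simp only [ok, Bool.and_eq_true, Bool.not_eq_true', List.contains_eq_mem,
      decide_eq_false_iff_not] at h
    simp only [keepsReg, bne_iff_ne, Bool.and_eq_true]
    refine ⟨?_, ih h.2⟩
    rintro rfl
    exact h.1.1.1.1.2 hr

theorem Cmd.keepsArr_of_ok {ro ra : List ℕ} {P : Cmd} (h : P.ok ro ra = true) {k : ℕ}
    (hk : k ∈ ra) : P.keepsArr k = true := by
  induction P with
  | skip => rfl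
  | assign i e => rfl
  | store =>
    simp only [ok, Bool.and_eq_true, Bool.not_eq_true', List.contains_eq_mem,
      decide_eq_false_iff_not] at h
    simp only [keepsArr, bne_iff_ne]
    rintro rfl
    exact h.1.1 hk
  | seq P Q ihP ihQ =>
    simp only [ok, Bool.and_eq_true] at h
    simp [keepsArr, ihP h.1, ihQ h.2]
  | ite e P Q ihP ihQ =>
    simp only [ok, Bool.and_eq_true] at h
    simp [keepsArr, ihP h.1.2, ihQ h.2]
  | loop i c b P ih =>
    simp only [ok, Bool.and_eq_true] at h
    exact ih h.2

/-- All numbers in the store have at most `B` bits. -/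
def Store.Bounded (s : Store) (B : ℕ) : Prop :=
  (∀ i, Nat.size (s.reg i) ≤ B) ∧ ∀ k j, Nat.size (s.arr k j) ≤ B

/-- The registers `ro` are at most `L`, the cells of the arrays `ra` have at most `L` bits. -/
def Store.Within (ro ra : List ℕ) (s : Store) (L : ℕ) : Prop :=
  (∀ i ∈ ro, s.reg i ≤ L) ∧ ∀ k ∈ ra, ∀ j, Nat.size (s.arr k j) ≤ L

theorem Store.Bounded.mono {s : Store} {B B' : ℕ} (h : s.Bounded B) (hB : B ≤ B') :
    s.Bounded B' :=
  ⟨fun i => (h.1 i).trans hB, fun k j => (h.2 k j).trans hB⟩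

theorem Store.Bounded.setReg {s : Store} {B : ℕ} (h : s.Bounded B) {i v : ℕ}
    (hv : Nat.size v ≤ B) : (s.setReg i v).Bounded B := by
  refine ⟨fun j => ?_, h.2⟩
  rw [Store.reg_setReg]
  split_ifs
  exacts [hv, h.1 j]

theorem Store.Bounded.setArr {s : Store} {B : ℕ} (h : s.Bounded B) {k i v : ℕ}
    (hv : Nat.size v ≤ B) : (s.setArr k i v).Bounded B := by
  refine ⟨h.1, fun k' j => ?_⟩
  rw [Store.arr_setArr]
  split_ifs
  exacts [hv, h.2 k' j]

theorem Cmd.within_exec {ro ra : List ℕ} {P : Cmd} (h : P.ok ro ra = true) {s : Store} {L : ℕ}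
    (hs : s.Within ro ra L) : (P.exec s).Within ro ra L :=
  ⟨fun i hi => by rw [exec_reg (keepsReg_of_ok h hi)]; exact hs.1 i hi,
    fun k hk j => by rw [exec_arr (keepsArr_of_ok h hk)]; exact hs.2 k hk j⟩

theorem size_le_self (n : ℕ) : Nat.size n ≤ n := Nat.size_le.2 n.lt_two_pow_self

theorem size_add_le (x y : ℕ) : Nat.size (x + y) ≤ max (Nat.size x) (Nat.size y) + 1 := by
  rw [Nat.size_le, pow_succ]
  have hx := (Nat.lt_size_self x).trans_le
    (Nat.pow_le_pow_right two_pos (le_max_left (Nat.size x) (Nat.size y)))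
  have hy := (Nat.lt_size_self y).trans_le
    (Nat.pow_le_pow_right two_pos (le_max_right (Nat.size x) (Nat.size y)))
  omega

theorem size_mul_le (x y : ℕ) : Nat.size (x * y) ≤ Nat.size x + Nat.size y := by
  rw [Nat.size_le, pow_add]
  exact Nat.mul_lt_mul'' (Nat.lt_size_self x) (Nat.lt_size_self y)

theorem size_ite_le (c : Prop) [Decidable c] : Nat.size (if c then 1 else 0) ≤ 1 := by
  split_ifs <;> simp

/-- A number that controls the size and the cost of the value of an expression. -/
def Exp.weight : Exp → ℕ
  | .const n => 1 + Nat.size n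
  | .reg _ => 1
  | .cell _ a => 1 + a.weight
  | .op _ e₁ e₂ => 1 + e₁.weight + e₂.weight

/-- Only a product could double the bit length, and there the right factor has at most `L` bits. So
every node adds at most `L + 1` bits to the maximum `B`, except constants, whose own size is part of
the weight. -/
theorem Exp.size_value_le {ro ra : List ℕ} {s : Store} {L B : ℕ} (hL : s.Within ro ra L)
    (hB : s.Bounded B) {e : Exp} (he : e.ok ro ra = true) :
    Nat.size (e.value s) ≤ B + e.weight * (L + 1) := by
  induction e with
  | const n =>
    simp only [value, weight]
    nlinarith
  | reg i => exact (hB.1 i).trans (by omega)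
  | cell k a _ => exact (hB.2 k _).trans (by omega)
  | op o e₁ e₂ ih₁ ih₂ =>
    have h1 : e₁.ok ro ra = true := by cases o <;> simp_all [ok]
    have h2 : e₂.ok ro ra = true := by cases o <;> simp_all [ok]
    specialize ih₁ h1
    specialize ih₂ h2
    have hw : (op o e₁ e₂).weight * (L + 1) =
      e₁.weight * (L + 1) + e₂.weight * (L + 1) + (L + 1) := by simp only [weight]; ring
    rw [hw]
    have small (c : Prop) [Decidable c] : Nat.size (if c then 1 else 0) ≤
      B + (e₁.weight * (L + 1) + e₂.weight * (L + 1) + (L + 1)) := by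
      have := size_ite_le c
      omega
    cases o with
    | add =>
      refine (size_add_le _ _).trans ?_
      omega
    | sub =>
      refine (Nat.size_le_size (Nat.sub_le _ _)).trans ?_
      omega
    | mul =>
      refine (size_mul_le _ _).trans ?_
      simp only [ok, Bool.and_eq_true] at he
      have h : Nat.size (e₂.value s) ≤ L := by
        have hsm := he.2
        cases e₂ with
        | const n => simp [Exp.small] at hsm
        | reg i =>
          simp only [Exp.small, List.contains_eq_mem, decide_eq_true_eq] at hsm
          exact (size_le_self _).trans (hL.1 i hsm)
        | cell k a =>
          simp only [Exp.small, List.contains_eq_mem, decide_eq_true_eq] at hsm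
          exact hL.2 k hsm _
        | op o e e' => simp [Exp.small] at hsm
      omega
    | div =>
      refine (Nat.size_le_size (Nat.div_le_self _ _)).trans ?_
      omega
    | lt => exact small _
    | eq => exact small _

/-- The number of nodes is at most the weight, and the value at each node is controlled by the size
bound with the weight of the whole expression. -/
theorem Exp.cost_le {ro ra : List ℕ} {s : Store} {L B : ℕ} (hL : s.Within ro ra L)
    (hB : s.Bounded B) {e : Exp} (he : e.ok ro ra = true) :
    e.cost s ≤ e.weight * (1 + B + e.weight * (L + 1)) := by
  induction e with
  | const n =>
    exact Nat.le_mul_of_pos_right _ (by positivity)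
  | reg i =>
    have := hB.1 i
    simp only [cost, weight]
    nlinarith
  | cell k a ih =>
    have h := ih he
    have h' := hB.2 k (a.value s)
    simp only [cost, weight]
    nlinarith
  | op o e₁ e₂ ih₁ ih₂ =>
    have h1 := ih₁ (by cases o <;> simp_all [ok])
    have h2 := ih₂ (by cases o <;> simp_all [ok])
    have h3 := size_value_le hL hB he
    simp only [value] at h3
    have hw : (op o e₁ e₂).weight = 1 + e₁.weight + e₂.weight := rfl
    simp only [cost]
    generalize (op o e₁ e₂).weight = w at *
    have h4 : e₁.weight * (1 + B + e₁.weight * (L + 1)) ≤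
        e₁.weight * (1 + B + w * (L + 1)) := by gcongr; omega
    have h5 : e₂.weight * (1 + B + e₂.weight * (L + 1)) ≤
        e₂.weight * (1 + B + w * (L + 1)) := by gcongr; omega
    have h6 : w * (1 + B + w * (L + 1)) = (1 + B + w * (L + 1)) +
      e₁.weight * (1 + B + w * (L + 1)) + e₂.weight * (1 + B + w * (L + 1)) := by
      generalize 1 + B + w * (L + 1) = x
      rw [hw]
      ring
    omega

/-- The bound is put in the form "function of `L`, times `1 + B`": it is linear in the bit length
`B`, which is the shape that is preserved by sequences and loops. -/
theorem Exp.cost_le_mul {ro ra : List ℕ} {s : Store} {L B : ℕ} (hL : s.Within ro ra L)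
    (hB : s.Bounded B) {e : Exp} (he : e.ok ro ra = true) :
    e.cost s ≤ (e.weight * (1 + e.weight)) * (L + 1) * (1 + B) := by
  refine (cost_le hL hB he).trans ?_
  have : 1 + B + e.weight * (L + 1) ≤ (1 + e.weight) * (L + 1) * (1 + B) := by
    nlinarith [Nat.zero_le (L * B), Nat.zero_le (e.weight * B), Nat.zero_le (e.weight * L * B)]
  calc _ ≤ e.weight * ((1 + e.weight) * (L + 1) * (1 + B)) := by gcongr
    _ = _ := by ring

theorem loopTest_value (i c b : ℕ) (s : Store) :
    (loopTest i c b).value s = if s.reg i < min (s.reg c) (s.reg b) then 1 else 0 := by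
  simp only [loopTest, Exp.value, Op.apply, lt_min_iff]
  by_cases h1 : s.reg i < s.reg c <;> by_cases h2 : s.reg i < s.reg b <;> simp [h1, h2]

/-- The product in the loop condition is not of the kind allowed by `Exp.ok`. Its factors are single
bits, so the cost is bounded by hand. -/
theorem loopTest_cost_le (i c b : ℕ) {s : Store} {B : ℕ} (hB : s.Bounded B) :
    (loopTest i c b).cost s ≤ 11 * (1 + B) := by
  have h1 := hB.1 i
  have h2 := hB.1 c
  have h3 := hB.1 b
  have h4 : Nat.size (Op.lt.apply (s.reg i) (s.reg c)) ≤ 1 := size_ite_le _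
  have h5 : Nat.size (Op.lt.apply (s.reg i) (s.reg b)) ≤ 1 := size_ite_le _
  have h6 : Nat.size (Op.mul.apply (Op.lt.apply (s.reg i) (s.reg c))
    (Op.lt.apply (s.reg i) (s.reg b))) ≤ _ := size_mul_le _ _
  simp only [loopTest, Exp.cost, Exp.value]
  omega

/-- There are at most `L` rounds, since the register `c` is read-only. The growth `g` of one round
does not depend on `B`, so after all rounds it has added up to `L * g`; bounding the cost of every
round by this final bit length is then enough. -/
theorem Cmd.run_loop {ro ra : List ℕ} {i c b : ℕ} {P : Cmd}
    (hok : (Cmd.loop i c b P).ok ro ra = true) {g τ L B : ℕ}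
    (ih : ∀ s B, s.Within ro ra L → s.Bounded B →
      ∃ t, Run P.compile s (P.exec s) t ∧ t ≤ τ * (1 + B) ∧ (P.exec s).Bounded (B + g))
    {s : Store} (hL : s.Within ro ra L) (hB : s.Bounded B) :
    ∃ t, Run (Cmd.loop i c b P).compile s ((Cmd.loop i c b P).exec s) t ∧
      t ≤ (L * (20 + τ) + 16) * (1 + (B + L + L * g)) ∧
      ((Cmd.loop i c b P).exec s).Bounded (B + L + L * g) := by
  have hk := hok
  simp only [ok, Bool.and_eq_true, Bool.not_eq_true', List.contains_eq_mem, decide_eq_true_eq,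
    decide_eq_false_iff_not, bne_iff_ne] at hk
  obtain ⟨⟨⟨⟨⟨hc, hi⟩, hib⟩, hPi⟩, hPb⟩, hP⟩ := hk
  have hic : c ≠ i := by
    rintro rfl
    exact hi hc
  set n := min (s.reg c) (s.reg b) with hn
  have hnL : n ≤ L := (min_le_left _ _).trans (hL.1 c hc)
  set u := rounds (fun j t => P.exec (t.setReg i j)) s with hu
  have hset : ∀ (t : Store) (v : ℕ), t.Within ro ra L → (t.setReg i v).Within ro ra L := by
    intro t v ht
    refine ⟨fun r hr => ?_, ht.2⟩
    rw [Store.reg_setReg, if_neg (by rintro rfl; exact hi hr)]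
    exact ht.1 r hr
  -- The extra `L` in the bit bound pays for the counter, whose value and hence whose bit length is
  -- at most `L`.
  have hinv : ∀ j ≤ n, (u j).Within ro ra L ∧ (u j).Bounded (B + L + j * g) ∧
      (u j).reg c = s.reg c ∧ (u j).reg b = s.reg b := by
    intro j
    induction j with
    | zero => exact fun _ => ⟨hL, hB.mono (by omega), rfl, rfl⟩
    | succ j ihj =>
      intro hj
      obtain ⟨h1, h2, h3, h4⟩ := ihj (by omega)
      obtain ⟨-, -, -, hb⟩ := ih ((u j).setReg i j) (B + L + j * g) (hset _ _ h1)
        (h2.setReg ((size_le_self j).trans (by omega)))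
      refine ⟨within_exec hP (hset _ _ h1), hb.mono (by ring_nf; omega), ?_, ?_⟩
      · change (P.exec ((u j).setReg i j)).reg c = _
        rw [exec_reg (keepsReg_of_ok hP hc), Store.reg_setReg, if_neg hic, h3]
      · change (P.exec ((u j).setReg i j)).reg b = _
        rw [exec_reg hPb, Store.reg_setReg, if_neg (Ne.symm hib), h4]
  have hsteps : ∀ j ≤ n, j * g ≤ L * g := fun j hj => by gcongr; omega
  -- Induction on the number `m` of remaining rounds, starting from the state before round `j`. Per
  -- unit of `1 + (B + L + L * g)`, the body costs `τ`, and the test together with the increment of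
  -- the counter at most 20.
  have key : ∀ m j, j + m = n → ∃ t, Run
      (.loop (loopTest i c b) (.seq P.compile (.assign i (.op .add (.reg i) (.const 1)))))
      ((u j).setReg i j) ((u n).setReg i n) t ∧
      t ≤ (m * (20 + τ) + 12) * (1 + (B + L + L * g)) := by
    intro m
    induction m with
    | zero =>
      intro j hj
      obtain rfl : j = n := by omega
      obtain ⟨h1, h2, h3, h4⟩ := hinv n le_rfl
      have hb : ((u n).setReg i n).Bounded (B + L + L * g) :=
        (h2.mono (by have := hsteps n le_rfl; omega)).setReg ((size_le_self n).trans (by omega))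
      refine ⟨_, Run.loop_stop ?_, ?_⟩
      · rw [loopTest_value, Store.reg_setReg, if_pos rfl, Store.reg_setReg, if_neg hic,
          Store.reg_setReg, if_neg (Ne.symm hib), h3, h4, if_neg (by omega)]
      · have := loopTest_cost_le i c b hb
        omega
    | succ m ihm =>
      intro j hj
      obtain ⟨h1, h2, h3, h4⟩ := hinv j (by omega)
      have hs1 := hsteps (j + 1) (by omega)
      have hs2 : (j + 1) * g = j * g + g := by ring
      have hb : ((u j).setReg i j).Bounded (B + L + j * g) :=
        h2.setReg ((size_le_self j).trans (by omega))
      obtain ⟨t₁, hr, ht₁, hb₁⟩ := ih _ _ (hset _ j h1) hb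
      obtain ⟨t₂, hr₂, ht₂⟩ := ihm (j + 1) (by omega)
      have hb₁' : (P.exec ((u j).setReg i j)).Bounded (B + L + L * g) := hb₁.mono (by omega)
      have hreg : (P.exec ((u j).setReg i j)).reg i = j := by
        rw [exec_reg hPi, Store.reg_setReg, if_pos rfl]
      have hassign := Run.assign i (.op .add (.reg i) (.const 1)) (P.exec ((u j).setReg i j))
      have hstore : (⟨Function.update (P.exec ((u j).setReg i j)).reg i
          ((Exp.op .add (.reg i) (.const 1)).value (P.exec ((u j).setReg i j))),
          (P.exec ((u j).setReg i j)).arr⟩ : Store) = (u (j + 1)).setReg i (j + 1) := by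
        simp only [Exp.value, Op.apply, hreg]
        rfl
      rw [hstore] at hassign
      refine ⟨_, Run.loop_step ?_ (hr.seq hassign) hr₂, ?_⟩
      · rw [loopTest_value, Store.reg_setReg, if_pos rfl, Store.reg_setReg, if_neg hic,
          Store.reg_setReg, if_neg (Ne.symm hib), h3, h4, if_pos (by omega)]
        exact one_ne_zero
      · have hb' : ((u j).setReg i j).Bounded (B + L + L * g) := hb.mono (by omega)
        have c1 := loopTest_cost_le i c b hb'
        have c2 : t₁ ≤ τ * (1 + (B + L + L * g)) := ht₁.trans (by gcongr; omega)
        have c3 : Nat.size j ≤ B + L + L * g := (size_le_self j).trans (by omega)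
        have c4 := size_add_le j 1
        simp only [Nat.size_one] at c4
        have c5 : ((m + 1) * (20 + τ) + 12) * (1 + (B + L + L * g)) =
          (m * (20 + τ) + 12) * (1 + (B + L + L * g)) + 20 * (1 + (B + L + L * g)) +
            τ * (1 + (B + L + L * g)) := by ring
        simp only [Exp.cost, Exp.value, Op.apply, hreg, Nat.size_one]
        omega
  obtain ⟨t, hr, ht⟩ := key n 0 (by omega)
  refine ⟨_, Run.seq (Run.assign i (.const 0) s) hr, ?_, ?_⟩
  · have h1 : n * (20 + τ) ≤ L * (20 + τ) := by gcongr
    have h2 : (n * (20 + τ) + 12) * (1 + (B + L + L * g)) ≤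
        (L * (20 + τ) + 12) * (1 + (B + L + L * g)) := by gcongr
    simp only [Exp.cost, Nat.size_zero]
    have h3 : (L * (20 + τ) + 16) * (1 + (B + L + L * g)) =
      (L * (20 + τ) + 12) * (1 + (B + L + L * g)) + 4 * (1 + (B + L + L * g)) := by ring
    omega
  · have := hsteps n le_rfl
    exact ((hinv n le_rfl).2.1.mono (by omega)).setReg ((size_le_self n).trans (by omega))

/-- A command with read-only loop bounds takes time polynomial in these bounds and in the bit
length of the numbers in the store. -/
theorem Cmd.exists_run {ro ra : List ℕ} {P : Cmd} (h : P.ok ro ra = true) :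
    ∃ g τ : Polynomial ℕ, ∀ (s : Store) (L B : ℕ), s.Within ro ra L → s.Bounded B →
      ∃ t, Run P.compile s (P.exec s) t ∧ t ≤ τ.eval L * (1 + B) ∧
        (P.exec s).Bounded (B + g.eval L) := by
  induction P with
  | skip => exact ⟨0, 1, fun s L B _ hB => ⟨1, Run.skip s, by simp, by simpa [exec] using hB⟩⟩
  | assign i e =>
    simp only [ok, Bool.and_eq_true] at h
    refine ⟨Polynomial.C e.weight * (Polynomial.X + 1),
      1 + Polynomial.C (e.weight * (1 + e.weight)) * (Polynomial.X + 1),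
      fun s L B hL hB => ⟨_, Run.assign i e s, ?_, ?_⟩⟩
    · have := Exp.cost_le_mul hL hB h.2
      simp only [Polynomial.eval_add, Polynomial.eval_mul, Polynomial.eval_C, Polynomial.eval_X,
        Polynomial.eval_one]
      linarith
    · have := Exp.size_value_le hL hB h.2
      simp only [Polynomial.eval_add, Polynomial.eval_mul, Polynomial.eval_C, Polynomial.eval_X,
        Polynomial.eval_one]
      exact (hB.mono (by omega)).setReg this
  | store k a e =>
    simp only [ok, Bool.and_eq_true] at h
    refine ⟨Polynomial.C e.weight * (Polynomial.X + 1),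
      1 + Polynomial.C (a.weight * (1 + a.weight)) * (Polynomial.X + 1) +
        Polynomial.C (e.weight * (1 + e.weight)) * (Polynomial.X + 1),
      fun s L B hL hB => ⟨_, Run.store k a e s, ?_, ?_⟩⟩
    · have := Exp.cost_le_mul hL hB h.2
      have := Exp.cost_le_mul hL hB h.1.2
      simp only [Polynomial.eval_add, Polynomial.eval_mul, Polynomial.eval_C, Polynomial.eval_X,
        Polynomial.eval_one]
      linarith
    · have := Exp.size_value_le hL hB h.2
      simp only [Polynomial.eval_add, Polynomial.eval_mul, Polynomial.eval_C, Polynomial.eval_X,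
        Polynomial.eval_one]
      exact (hB.mono (by omega)).setArr this
  | seq P Q ihP ihQ =>
    simp only [ok, Bool.and_eq_true] at h
    obtain ⟨g₁, τ₁, ih₁⟩ := ihP h.1
    obtain ⟨g₂, τ₂, ih₂⟩ := ihQ h.2
    -- The second command starts from numbers with up to `B + g₁` bits, whence the factor `1 + g₁`.
    refine ⟨g₁ + g₂, 1 + τ₁ + τ₂ * (1 + g₁), fun s L B hL hB => ?_⟩
    obtain ⟨t₁, hr₁, ht₁, hb₁⟩ := ih₁ s L B hL hB
    obtain ⟨t₂, hr₂, ht₂, hb₂⟩ := ih₂ _ L _ (within_exec h.1 hL) hb₁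
    refine ⟨_, hr₁.seq hr₂, ?_, ?_⟩
    · simp only [Polynomial.eval_add, Polynomial.eval_mul, Polynomial.eval_one]
      have : τ₂.eval L * (1 + (B + g₁.eval L)) ≤ τ₂.eval L * ((1 + g₁.eval L) * (1 + B)) := by
        gcongr
        nlinarith [Nat.zero_le (g₁.eval L * B)]
      nlinarith
    · exact hb₂.mono (by simp only [Polynomial.eval_add]; omega)
  | ite e P Q ihP ihQ =>
    simp only [ok, Bool.and_eq_true] at h
    obtain ⟨g₁, τ₁, ih₁⟩ := ihP h.1.2
    obtain ⟨g₂, τ₂, ih₂⟩ := ihQ h.2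
    refine ⟨g₁ + g₂, 1 + Polynomial.C (e.weight * (1 + e.weight)) * (Polynomial.X + 1) + τ₁ + τ₂,
      fun s L B hL hB => ?_⟩
    have hc := Exp.cost_le_mul hL hB h.1.1
    simp only [Polynomial.eval_add, Polynomial.eval_mul, Polynomial.eval_C, Polynomial.eval_X,
      Polynomial.eval_one]
    by_cases he : e.value s = 0
    · obtain ⟨t, hr, ht, hb⟩ := ih₂ s L B hL hB
      refine ⟨_, by simpa only [exec, compile, he, ne_eq, not_true_eq_false, if_false] using
        Run.ite_false he hr, ?_, ?_⟩
      · nlinarith [Nat.zero_le (τ₁.eval L * (1 + B))]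
      · simp only [exec, he, ne_eq, not_true_eq_false, if_false]
        exact hb.mono (by omega)
    · obtain ⟨t, hr, ht, hb⟩ := ih₁ s L B hL hB
      refine ⟨_, by simpa only [exec, compile, he, ne_eq, not_false_eq_true, if_true] using
        Run.ite_true he hr, ?_, ?_⟩
      · nlinarith [Nat.zero_le (τ₂.eval L * (1 + B))]
      · simp only [exec, he, ne_eq, not_false_eq_true, if_true]
        exact hb.mono (by omega)
  | loop i c b P ih =>
    have h' := h
    simp only [ok, Bool.and_eq_true] at h'
    obtain ⟨g, τ, ih⟩ := ih h'.2
    refine ⟨Polynomial.X + Polynomial.X * g,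
      (Polynomial.X * (20 + τ) + 16) * (1 + Polynomial.X + Polynomial.X * g), fun s L B hL hB => ?_⟩
    obtain ⟨t, hr, ht, hb⟩ := run_loop h (fun s B hs hB => ih s L B hs hB) hL hB
    refine ⟨t, hr, ht.trans ?_, hb.mono ?_⟩
    · simp only [Polynomial.eval_add, Polynomial.eval_mul, Polynomial.eval_X, Polynomial.eval_one,
        Polynomial.eval_ofNat]
      rw [mul_assoc]
      gcongr
      nlinarith [Nat.zero_le (L * B), Nat.zero_le (L * g.eval L * B)]
    · simp only [Polynomial.eval_add, Polynomial.eval_mul, Polynomial.eval_X]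
      omega

/-- A command that prepares the read-only registers for a second one. -/
theorem Cmd.exists_run_seq {ro₁ ra₁ ro₂ ra₂ : List ℕ} {P Q : Cmd} (hP : P.ok ro₁ ra₁ = true)
    (hQ : Q.ok ro₂ ra₂ = true) (ℓ : Polynomial ℕ) :
    ∃ q : Polynomial ℕ, ∀ (s : Store) (n : ℕ), s.Within ro₁ ra₁ n → s.Bounded n →
      (P.exec s).Within ro₂ ra₂ (ℓ.eval n) →
      ∃ t, Run (Prog.seq P.compile Q.compile) s (Q.exec (P.exec s)) t ∧ t ≤ q.eval n ∧
        (Q.exec (P.exec s)).Bounded (q.eval n) := by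
  obtain ⟨g₁, τ₁, h₁⟩ := exists_run hP
  obtain ⟨g₂, τ₂, h₂⟩ := exists_run hQ
  -- The read-only data of the second command are bounded by `ℓ` at `n` instead of `n`, hence the
  -- compositions with `ℓ`. The last summand bounds the final bit lengths, so that one polynomial
  -- serves for both claims.
  refine ⟨1 + τ₁ * (1 + Polynomial.X) + τ₂.comp ℓ * (1 + (Polynomial.X + g₁)) +
    (Polynomial.X + g₁ + g₂.comp ℓ), fun s n hs hB hs₂ => ?_⟩
  obtain ⟨t₁, hr₁, ht₁, hb₁⟩ := h₁ s n n hs hB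
  obtain ⟨t₂, hr₂, ht₂, hb₂⟩ := h₂ _ _ _ hs₂ hb₁
  refine ⟨_, hr₁.seq hr₂, ?_, ?_⟩
  · simp only [Polynomial.eval_add, Polynomial.eval_mul, Polynomial.eval_X, Polynomial.eval_one,
      Polynomial.eval_comp]
    omega
  · refine hb₂.mono ?_
    simp only [Polynomial.eval_add, Polynomial.eval_mul, Polynomial.eval_X, Polynomial.eval_one,
      Polynomial.eval_comp]
    omega

end HC1Q

namespace HC1Q

/-! ## Expressions -/

instance : Add Exp := ⟨Exp.op .add⟩
instance : Sub Exp := ⟨Exp.op .sub⟩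
instance : Mul Exp := ⟨Exp.op .mul⟩
instance : Div Exp := ⟨Exp.op .div⟩

/-- Comparison of two expressions. -/
def Exp.less (a b : Exp) : Exp := .op .lt a b

/-- Equality test of two expressions. -/
def Exp.same (a b : Exp) : Exp := .op .eq a b

/-- Exclusive or of two bits. -/
def Exp.bxor (a b : Exp) : Exp := .same (.same a b) (.const 0)

/-- Conjunction of two bits. -/
def Exp.band (a b : Exp) : Exp := .less (.const 1) (a + b)

@[simp] theorem Exp.value_const (s : Store) (n : ℕ) : (Exp.const n).value s = n := rfl
@[simp] theorem Exp.value_reg (s : Store) (i : ℕ) : (Exp.reg i).value s = s.reg i := rfl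
@[simp] theorem Exp.value_cell (s : Store) (k : ℕ) (a : Exp) :
    (Exp.cell k a).value s = s.arr k (a.value s) := rfl
@[simp] theorem Exp.value_add (s : Store) (a b : Exp) :
    (a + b).value s = a.value s + b.value s := rfl
@[simp] theorem Exp.value_sub (s : Store) (a b : Exp) :
    (a - b).value s = a.value s - b.value s := rfl
@[simp] theorem Exp.value_mul (s : Store) (a b : Exp) :
    (a * b).value s = a.value s * b.value s := rfl
@[simp] theorem Exp.value_div (s : Store) (a b : Exp) :
    (a / b).value s = a.value s / b.value s := rfl
@[simp] theorem Exp.value_less (s : Store) (a b : Exp) :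
    (a.less b).value s = if a.value s < b.value s then 1 else 0 := rfl
@[simp] theorem Exp.value_same (s : Store) (a b : Exp) :
    (a.same b).value s = if a.value s = b.value s then 1 else 0 := rfl

theorem Exp.value_bxor {s : Store} {a b : Exp} {x y : Bool} (ha : a.value s = x.toNat)
    (hb : b.value s = y.toNat) : (a.bxor b).value s = (x ^^ y).toNat := by
  simp only [bxor, value_same, value_const, ha, hb]
  cases x <;> cases y <;> rfl

theorem Exp.value_band {s : Store} {a b : Exp} {x y : Bool} (ha : a.value s = x.toNat)
    (hb : b.value s = y.toNat) : (a.band b).value s = (x && y).toNat := by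
  simp only [band, value_less, value_add, value_const, ha, hb]
  cases x <;> cases y <;> rfl

@[simp] theorem Cmd.exec_skip (s : Store) : Cmd.skip.exec s = s := rfl
@[simp] theorem Cmd.exec_assign (i : ℕ) (e : Exp) (s : Store) :
    (Cmd.assign i e).exec s = s.setReg i (e.value s) := rfl
@[simp] theorem Cmd.exec_store (k : ℕ) (a e : Exp) (s : Store) :
    (Cmd.store k a e).exec s = s.setArr k (a.value s) (e.value s) := rfl
@[simp] theorem Cmd.exec_seq (P Q : Cmd) (s : Store) : (P ;; Q).exec s = Q.exec (P.exec s) := rfl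
@[simp] theorem Cmd.exec_ite (e : Exp) (P Q : Cmd) (s : Store) :
    (Cmd.ite e P Q).exec s = if e.value s = 0 then Q.exec s else P.exec s := by
  simp [Cmd.exec]

/-! ## Reading an instance -/

theorem Gate.length_encode {N : ℕ} (g : Gate N) : g.encode.length = 4 := by
  rcases g with _ | (_ | _ | _) <;> rfl

/-- From address `o` on, the array `f` holds the word `l`. -/
def Holds (f : ℕ → ℕ) (o : ℕ) (l : List ℕ) : Prop :=
  ∀ j < l.length, f (o + j) = l.getD j 0

theorem holds_getD (l : List ℕ) : Holds (fun j => l.getD j 0) 0 l := fun j _ => by simp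

theorem Holds.append_left {f : ℕ → ℕ} {o : ℕ} {l l' : List ℕ} (h : Holds f o (l ++ l')) :
    Holds f o l := fun j hj => by
  rw [h j (by rw [List.length_append]; omega), List.getD_append _ _ _ _ hj]

theorem Holds.append_right {f : ℕ → ℕ} {o : ℕ} {l l' : List ℕ} (h : Holds f o (l ++ l')) :
    Holds f (o + l.length) l' := fun j hj => by
  rw [add_assoc, h _ (by rw [List.length_append]; omega),
    List.getD_append_right _ _ _ _ (by omega), Nat.add_sub_cancel_left]

theorem Holds.gate {f : ℕ → ℕ} {o N : ℕ} {U : Circuit N} (h : Holds f o (U.flatMap Gate.encode))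
    {i : ℕ} (hi : i < U.length) : Holds f (o + 4 * i) (U[i].encode) := by
  induction U generalizing o i with
  | nil => simp at hi
  | cons g U ih =>
    rw [List.flatMap_cons] at h
    cases i with
    | zero => exact h.append_left
    | succ i =>
      have := ih (g.length_encode ▸ h.append_right) (i := i) (by simpa using hi)
      simpa [mul_add, add_assoc, add_comm, add_left_comm] using this

theorem length_flatMap_encode {N : ℕ} (U : Circuit N) :
    (U.flatMap Gate.encode).length = 4 * U.length := by
  induction U with
  | nil => rfl
  | cons g U ih =>
    rw [List.flatMap_cons, List.length_append, ih, g.length_encode, List.length_cons]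
    ring

/-- Reads the input in array `0`, whose length is in register `9`: the number of qubits goes to
register `20`, the numbers of gates to registers `21` and `24`, the addresses of the gates and of
the thresholds to registers `22`, `23` and `25`. -/
def parse : Cmd :=
  .assign 20 (.const 0) ;;
  .loop 30 9 9 (.assign 20 (.reg 20 + .same (.cell 0 (.reg 20)) (.const 1))) ;;
  .assign 22 (.reg 20 + .const 2) ;;
  .assign 21 (.cell 0 (.reg 20 + .const 1)) ;;
  .assign 23 (.reg 22 + (.reg 21 + .reg 21 + .reg 21 + .reg 21) + .reg 20 + .const 2) ;;
  .assign 24 (.cell 0 (.reg 23 - .const 1)) ;;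
  .assign 25 (.reg 23 + (.reg 24 + .reg 24 + .reg 24 + .reg 24))

/-- The store describes the instance `I`, as found by `parse`. -/
structure Store.Parsed (s : Store) (I : Instance) (f : ℕ → ℕ) : Prop where
  reg20 : s.reg 20 = I.N
  reg21 : s.reg 21 = I.U₁.length
  reg24 : s.reg 24 = I.U₂.length
  N_le : I.N ≤ s.reg 9
  length₁_le : I.U₁.length ≤ s.reg 9
  length₂_le : I.U₂.length ≤ s.reg 9
  gates₁ : Holds f (s.reg 22) (I.U₁.flatMap Gate.encode)
  gates₂ : Holds f (s.reg 23) (I.U₂.flatMap Gate.encode)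
  thresholds : Holds f (s.reg 25) (encodeRat I.a ++ encodeRat I.b)

/-- The addresses of all parts of the description follow from the number of qubits and the two gate
counts. The number of qubits is written in unary, which allows it to be read by a loop bounded by
the length of the input. -/
theorem parsed_of_holds {s : Store} {I : Instance} (hs : Holds (s.arr 0) 0 I.encode)
    (h9 : s.reg 9 = I.encode.length) : (parse.exec s).Parsed I (s.arr 0) := by
  have hw : I.encode = List.replicate I.N 1 ++ ([0, I.U₁.length] ++ (I.U₁.flatMap Gate.encode ++
      (List.replicate I.N 1 ++ ([0, I.U₂.length] ++ (I.U₂.flatMap Gate.encode ++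
        (encodeRat I.a ++ encodeRat I.b)))))) := by
    simp [Instance.encode, Circuit.encode]
  have hlen : I.encode.length = I.N + 2 + 4 * I.U₁.length + I.N + 2 + 4 * I.U₂.length + 4 := by
    rw [hw]
    simp only [List.length_append, List.length_replicate, length_flatMap_encode, encodeRat,
      List.length_cons, List.length_nil]
    ring
  rw [hw] at hs
  have a1 := hs.append_left
  have a2 := hs.append_right.append_left
  have a3 := hs.append_right.append_right.append_left
  have a4 := hs.append_right.append_right.append_right.append_right.append_left
  have a5 := hs.append_right.append_right.append_right.append_right.append_right.append_left
  have a6 := hs.append_right.append_right.append_right.append_right.append_right.append_right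
  simp only [List.length_replicate, length_flatMap_encode, List.length_cons, List.length_nil,
    zero_add, Nat.reduceAdd] at a1 a2 a3 a4 a5 a6
  -- Register 20 advances only while it points at a 1. It comes to rest at the 0 that follows the
  -- unary number and stays there for the remaining rounds.
  have hN : ((Cmd.loop 30 9 9 (.assign 20 (.reg 20 + .same (.cell 0 (.reg 20)) (.const 1)))).exec
      (s.setReg 20 0)).reg 20 = I.N := by
    have := Cmd.exec_loop (i := 30) (c := 9) (b := 9)
      (P := .assign 20 (.reg 20 + .same (.cell 0 (.reg 20)) (.const 1))) (s := s.setReg 20 0)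
      (fun j t => t.reg 20 = min j I.N) I.encode.length (by simp [h9]) (by simp)
      (by
        intro j hj t _ ha ht
        have h0 : t.arr 0 = s.arr 0 := ha 0 rfl
        simp only [Cmd.exec_assign, Exp.value_add, Exp.value_reg, Exp.value_same, Exp.value_cell,
          Exp.value_const, Store.reg_setReg, Store.arr_setReg, if_true, h0,
          show (20 : ℕ) ≠ 30 by decide, if_false, ht]
        rcases lt_or_ge j I.N with h | h
        · have := a1 j (by simpa using h)
          rw [zero_add] at this
          rw [min_eq_left (by omega), min_eq_left (by omega), this]
          simp [h]
        · have := a2 0 (by simp)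
          rw [add_zero] at this
          rw [min_eq_right h, min_eq_right (by omega), this]
          simp)
      (by
        intro j t v h
        simpa using h)
    rw [this]
    omega
  simp only [parse, Cmd.exec_seq]
  rw [show (Cmd.assign 20 (.const 0)).exec s = s.setReg 20 0 from rfl]
  have h9' : ((Cmd.loop 30 9 9 (.assign 20 (.reg 20 + .same (.cell 0 (.reg 20)) (.const 1)))).exec
      (s.setReg 20 0)).reg 9 = I.encode.length := by
    rw [Cmd.exec_reg rfl, ← h9]
    simp
  have h0' : ((Cmd.loop 30 9 9 (.assign 20 (.reg 20 + .same (.cell 0 (.reg 20)) (.const 1)))).exec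
      (s.setReg 20 0)).arr 0 = s.arr 0 := Cmd.exec_arr rfl _
  generalize (Cmd.loop 30 9 9 (.assign 20 (.reg 20 + .same (.cell 0 (.reg 20)) (.const 1)))).exec
      (s.setReg 20 0) = u at *
  have e1 : s.arr 0 (I.N + 1) = I.U₁.length := a2 1 (by simp)
  have e2 : s.arr 0 (I.N + 2 + 4 * I.U₁.length + I.N + 1) = I.U₂.length := a4 1 (by simp)
  have f1 : I.N + 2 + (I.U₁.length + I.U₁.length + I.U₁.length + I.U₁.length) + I.N + 2 =
    I.N + 2 + 4 * I.U₁.length + I.N + 2 := by ring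
  have f2 : I.U₂.length + I.U₂.length + I.U₂.length + I.U₂.length = 4 * I.U₂.length := by ring
  constructor <;> simp [h0', hN, e1, f1, e2, f2, h9'] <;> first | assumption | omega

end HC1Q

namespace HC1Q

/-! ## Simulation of the classical gates of a circuit -/

/-- The action of a gate on bit strings, where Hadamard gates are ignored. -/
def Gate.actBits {N : ℕ} : Gate N → (Fin N → Bool) → (Fin N → Bool)
  | .had _, v => v
  | .classical g, v => g.act v

/-- The action of the classical gates of a circuit on bit strings. -/
def Circuit.actBits {N : ℕ} (U : Circuit N) (v : Fin N → Bool) : Fin N → Bool :=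
  U.foldl (fun v g => g.actBits v) v

/-- The bit string `x` with its last bit replaced by `0`. -/
def clearLast {N : ℕ} (x : Fin N → Bool) : Fin N → Bool := fun i => decide (i.val + 1 < N) && x i

/-- The two bit strings have the same last bit. -/
def SameLast {N : ℕ} (y z : Fin N → Bool) : Prop := ∀ i : Fin N, i.val + 1 = N → y i = z i

instance {N : ℕ} (y z : Fin N → Bool) : Decidable (SameLast y z) :=
  inferInstanceAs (Decidable (∀ i : Fin N, i.val + 1 = N → y i = z i))

/-- The number of common ones of two bit strings. -/
def overlap {N : ℕ} (y z : Fin N → Bool) : ℕ := ∑ i, (y i && z i).toNat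

/-- The sign with which the path through `x` contributes to the amplitude of the outcome `z`
(up to a global sign that depends on `z`). -/
def pathSign {N : ℕ} (U : Circuit N) (z x : Fin N → Bool) : ℤ :=
  if SameLast (U.actBits (clearLast x)) z then (-1) ^ overlap (U.actBits (clearLast x)) z else 0

/-- Array `k` holds the bits `v` from address `o` on. -/
def Store.HoldsBits (s : Store) (k o : ℕ) {N : ℕ} (v : Fin N → Bool) : Prop :=
  ∀ i : Fin N, s.arr k (o + i) = (v i).toNat

/-- One step of the simulation in array `3` of the gate whose description starts at the address in
register `40`. -/
def simulateGate : Cmd :=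
  .ite (.same (.cell 0 (.reg 40)) (.const 1))
    (.store 3 (.cell 0 (.reg 40 + .const 1))
      (.bxor (.cell 3 (.cell 0 (.reg 40 + .const 1))) (.const 1)))
    (.ite (.same (.cell 0 (.reg 40)) (.const 2))
      (.store 3 (.cell 0 (.reg 40 + .const 2))
        (.bxor (.cell 3 (.cell 0 (.reg 40 + .const 2))) (.cell 3 (.cell 0 (.reg 40 + .const 1)))))
      (.ite (.same (.cell 0 (.reg 40)) (.const 3))
        (.store 3 (.cell 0 (.reg 40 + .const 3))
          (.bxor (.cell 3 (.cell 0 (.reg 40 + .const 3)))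
            (.band (.cell 3 (.cell 0 (.reg 40 + .const 1)))
              (.cell 3 (.cell 0 (.reg 40 + .const 2))))))
        .skip))

theorem Store.HoldsBits.setArr {s : Store} {k N : ℕ} {v : Fin N → Bool} (h : s.HoldsBits k 0 v)
    (i : Fin N) (b : Bool) :
    (s.setArr k i b.toNat).HoldsBits k 0 (Function.update v i b) := by
  intro j
  have := h j
  simp only [zero_add] at this
  simp only [Store.arr_setArr, zero_add, true_and, Function.update_apply, this, Fin.ext_iff]
  split_ifs <;> rfl

theorem simulateGate_spec {s : Store} {N : ℕ} {g : Gate N} {v : Fin N → Bool}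
    (hg : Holds (s.arr 0) (s.reg 40) g.encode) (hv : s.HoldsBits 3 0 v) :
    (simulateGate.exec s).HoldsBits 3 0 (g.actBits v) := by
  have hv' : ∀ i : Fin N, (Exp.cell 3 (.const i)).value s = (v i).toNat := fun i => by
    simpa using hv i
  have g0 := hg 0 (by rw [g.length_encode]; norm_num)
  have g1 := hg 1 (by rw [g.length_encode]; norm_num)
  have g2 := hg 2 (by rw [g.length_encode]; norm_num)
  have g3 := hg 3 (by rw [g.length_encode]; norm_num)
  rcases g with i | (t | ⟨c, t, h⟩ | ⟨c, d, t, h₁, h₂, h₃⟩)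
  · simp only [Gate.encode, add_zero, List.getD_cons_zero] at g0
    have e : simulateGate.exec s = s := by simp [simulateGate, g0]
    rw [e]
    exact hv
  · simp only [Gate.encode, add_zero, List.getD_cons_zero, List.getD_cons_succ] at g0 g1
    have hx := Exp.value_bxor (s := s) (a := .cell 3 (.cell 0 (.reg 40 + .const 1)))
      (b := .const 1) (x := v t) (y := true) (by simpa [g1] using hv' t) rfl
    have e : simulateGate.exec s = s.setArr 3 t (!v t).toNat := by
      simp [simulateGate, g0, g1, hx]
    rw [e]
    exact hv.setArr t _
  · simp only [Gate.encode, add_zero, List.getD_cons_zero, List.getD_cons_succ] at g0 g1 g2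
    have hx := Exp.value_bxor (s := s) (a := .cell 3 (.cell 0 (.reg 40 + .const 2)))
      (b := .cell 3 (.cell 0 (.reg 40 + .const 1))) (x := v t) (y := v c)
      (by simpa [g2] using hv' t) (by simpa [g1] using hv' c)
    have e : simulateGate.exec s = s.setArr 3 t (v t ^^ v c).toNat := by
      simp [simulateGate, g0, g2, hx]
    rw [e]
    exact hv.setArr t _
  · simp only [Gate.encode, add_zero, List.getD_cons_zero, List.getD_cons_succ] at g0 g1 g2 g3
    have hx := Exp.value_bxor (s := s) (a := .cell 3 (.cell 0 (.reg 40 + .const 3)))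
      (x := v t) (by simpa [g3] using hv' t)
      (Exp.value_band (a := .cell 3 (.cell 0 (.reg 40 + .const 1)))
        (b := .cell 3 (.cell 0 (.reg 40 + .const 2))) (x := v c) (y := v d)
        (by simpa [g1] using hv' c) (by simpa [g2] using hv' d))
    have e : simulateGate.exec s = s.setArr 3 t (v t ^^ (v c && v d)).toNat := by
      simp [simulateGate, g0, g3, hx]
    rw [e]
    exact hv.setArr t _

/-- Copies the random bits that start at the address in register `42` to array `3`. -/
def loadBits : Cmd :=
  .loop 43 9 20 (.store 3 (.reg 43) (.cell 2 (.reg 42 + .reg 43))) ;;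
  .store 3 (.reg 20 - .const 1) (.const 0)

/-- Simulates the circuit with `reg 41` gates, described from address `reg 40` on. -/
def simulateGates : Cmd :=
  .loop 44 9 41 (simulateGate ;; .assign 40 (.reg 40 + .const 4))

/-- Compares the bits in array `3` with the candidate that starts at the address in
register `32` of array `1`. -/
def compareBits : Cmd :=
  .assign 45 (.const 0) ;;
  .loop 43 9 20
    (.assign 45 (.bxor (.reg 45) (.band (.cell 3 (.reg 43)) (.cell 1 (.reg 32 + .reg 43))))) ;;
  .assign 46 (.same (.cell 3 (.reg 20 - .const 1)) (.cell 1 (.reg 32 + (.reg 20 - .const 1))))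

/-- Computes the sign of one path. -/
def simulate : Cmd := loadBits ;; simulateGates ;; compareBits

/-- All `N` bits are copied, and the last one is then overwritten by 0, the initial state of the
qubit without a Hadamard gate. One random bit is wasted, which keeps the blocks of random bits and
the candidates equally long. -/
theorem loadBits_spec {s : Store} {N : ℕ} {x : Fin N → Bool} (hN : 1 ≤ N) (h20 : s.reg 20 = N)
    (h9 : N ≤ s.reg 9) (hx : s.HoldsBits 2 (s.reg 42) x) :
    (loadBits.exec s).HoldsBits 3 0 (clearLast x) := by
  have := Cmd.exec_loop (i := 43) (c := 9) (b := 20)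
    (P := .store 3 (.reg 43) (.cell 2 (.reg 42 + .reg 43))) (s := s)
    (fun j t => ∀ i : Fin N, i.val < j → t.arr 3 i = (x i).toNat) N (by omega) (by simp)
    (by
      intro j hj t hr ha ht i hi
      have h42 : t.reg 42 = s.reg 42 := hr 42 rfl
      have h2 : t.arr 2 = s.arr 2 := ha 2 rfl
      have hxi := hx i
      rcases eq_or_ne i.val j with h | h
      · simp [h42, h2, ← h, hxi]
      · simpa [h] using ht i (by omega))
    (by
      intro j t v h
      simpa using h)
  intro i
  have h20' : ((Cmd.loop 43 9 20 (.store 3 (.reg 43) (.cell 2 (.reg 42 + .reg 43)))).exec s).reg 20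
    = N := by rw [Cmd.exec_reg rfl, h20]
  simp only [loadBits, Cmd.exec_seq, Cmd.exec_store, Exp.value_sub, Exp.value_reg, Exp.value_const,
    h20', Store.arr_setArr, zero_add, true_and, clearLast]
  have hi := i.isLt
  split_ifs with h
  · simp [show ¬ (i.val + 1 < N) by omega]
  · simp [show i.val + 1 < N by omega, this i hi]

/-- The whole circuit can be processed without cutting out its middle part: a Hadamard gate has code
0, which matches none of the tests, and is skipped. -/
theorem simulateGates_spec {s : Store} {N : ℕ} {U : Circuit N} {v : Fin N → Bool}
    (h9 : U.length ≤ s.reg 9) (h41 : s.reg 41 = U.length)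
    (hU : Holds (s.arr 0) (s.reg 40) (U.flatMap Gate.encode)) (hv : s.HoldsBits 3 0 v) :
    (simulateGates.exec s).HoldsBits 3 0 (U.actBits v) := by
  have := Cmd.exec_loop (i := 44) (c := 9) (b := 41)
    (P := simulateGate ;; .assign 40 (.reg 40 + .const 4)) (s := s)
    (fun j t => t.reg 40 = s.reg 40 + 4 * j ∧ t.HoldsBits 3 0 (Circuit.actBits (U.take j) v))
    U.length (by omega) ⟨rfl, hv⟩
    (by
      intro j hj t hr ha ⟨h1, h2⟩
      have h0 : t.arr 0 = s.arr 0 := ha 0 rfl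
      have h40 : (simulateGate.exec (t.setReg 44 j)).reg 40 = t.reg 40 := by
        rw [Cmd.exec_reg rfl]
        simp
      refine ⟨by simp [h40, h1]; ring, ?_⟩
      have := simulateGate_spec (s := t.setReg 44 j) (g := U[j])
        (by simpa [h0, h1] using hU.gate hj) (v := Circuit.actBits (U.take j) v) h2
      rw [List.take_succ_eq_append_getElem hj, Circuit.actBits, List.foldl_append]
      exact this)
    (by
      intro j t v h
      simpa [Store.HoldsBits] using h)
  simpa [simulateGates] using this.2

/-- Only the parity of the overlap matters for the sign. It is accumulated by exclusive or, and the
invariant is the parity of the sum over the positions below the counter. -/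
theorem compareBits_spec {s : Store} {N : ℕ} {y z : Fin N → Bool} (hN : 1 ≤ N)
    (h20 : s.reg 20 = N) (h9 : N ≤ s.reg 9) (hy : s.HoldsBits 3 0 y)
    (hz : s.HoldsBits 1 (s.reg 32) z) :
    (compareBits.exec s).reg 45 = (decide (overlap y z % 2 = 1)).toNat ∧
      (compareBits.exec s).reg 46 = (decide (SameLast y z)).toNat := by
  set P : Cmd := .assign 45 (.bxor (.reg 45) (.band (.cell 3 (.reg 43))
    (.cell 1 (.reg 32 + .reg 43)))) with hP
  set u := (Cmd.loop 43 9 20 P).exec (s.setReg 45 0) with hu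
  have h45 : u.reg 45 = (decide (overlap y z % 2 = 1)).toNat := by
    have := Cmd.exec_loop (i := 43) (c := 9) (b := 20) (P := P) (s := s.setReg 45 0)
      (fun j t => t.reg 45 =
        (decide ((∑ i : Fin N with i.val < j, (y i && z i).toNat) % 2 = 1)).toNat) N
      (by simp [h20, h9]) (by simp)
      (by
        intro j hj t hr ha ht
        have h32 : t.reg 32 = s.reg 32 := hr 32 rfl
        have h3 : t.arr 3 = s.arr 3 := ha 3 rfl
        have h1 : t.arr 1 = s.arr 1 := ha 1 rfl
        have hy' := hy ⟨j, hj⟩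
        have hz' := hz ⟨j, hj⟩
        simp only [zero_add] at hy'
        simp only [hP, Cmd.exec_assign, Store.reg_setReg, if_true]
        rw [Exp.value_bxor (x := decide
            ((∑ i : Fin N with i.val < j, (y i && z i).toNat) % 2 = 1)) (by simpa using ht)
          (Exp.value_band (x := y ⟨j, hj⟩) (by simpa [h3] using hy') (y := z ⟨j, hj⟩)
            (by simpa [h32, h1] using hz'))]
        have hsum : ∑ i : Fin N with i.val < j + 1, (y i && z i).toNat =
            (∑ i : Fin N with i.val < j, (y i && z i).toNat) +
              (y ⟨j, hj⟩ && z ⟨j, hj⟩).toNat := by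
          have := Finset.sum_insert (s := Finset.univ.filter fun i : Fin N => i.val < j)
            (a := ⟨j, hj⟩) (f := fun i => (y i && z i).toNat) (by simp)
          rw [add_comm _ (Bool.toNat _), ← this]
          congr 1
          ext i
          simp only [Finset.mem_filter, Finset.mem_univ, true_and, Finset.mem_insert, Fin.ext_iff]
          omega
        rw [hsum]
        generalize (∑ i : Fin N with i.val < j, (y i && z i).toNat) = m
        have hm := Nat.mod_two_eq_zero_or_one m
        cases (y ⟨j, hj⟩ && z ⟨j, hj⟩) <;> rcases hm with hm | hm <;>
          simp [hm, Nat.add_mod])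
      (by
        intro j t v h
        simpa using h)
    rw [hu, this, overlap, Finset.filter_true_of_mem fun i _ => i.isLt]
  have e20 : u.reg 20 = N := by rw [hu, Cmd.exec_reg rfl]; simpa using h20
  have e32 : u.reg 32 = s.reg 32 := by rw [hu, Cmd.exec_reg rfl]; simp
  have e3 : u.arr 3 = s.arr 3 := by rw [hu, Cmd.exec_arr rfl]; rfl
  have e1 : u.arr 1 = s.arr 1 := by rw [hu, Cmd.exec_arr rfl]; rfl
  have hexec : compareBits.exec s = (Cmd.assign 46 (.same (.cell 3 (.reg 20 - .const 1))
    (.cell 1 (.reg 32 + (.reg 20 - .const 1))))).exec u := rfl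
  have hy' := hy ⟨N - 1, by omega⟩
  have hz' := hz ⟨N - 1, by omega⟩
  simp only [zero_add] at hy'
  have hsame : SameLast y z ↔ y ⟨N - 1, by omega⟩ = z ⟨N - 1, by omega⟩ := by
    refine ⟨fun h => h _ (by simp; omega), fun h i hi => ?_⟩
    have : i = ⟨N - 1, by omega⟩ := Fin.ext (by simp; omega)
    rw [this, h]
  rw [hexec]
  refine ⟨by simpa using h45, ?_⟩
  simp only [Cmd.exec_assign, Exp.value_same, Exp.value_cell, Exp.value_sub, Exp.value_reg, e20,
    Exp.value_const, Exp.value_add, e32, e3, e1, hy', hz', Store.reg_setReg, if_true, hsame]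
  cases y ⟨N - 1, by omega⟩ <;> cases z ⟨N - 1, by omega⟩ <;> rfl

theorem simulate_spec {s : Store} {N : ℕ} {U : Circuit N} {x z : Fin N → Bool} (hN : 1 ≤ N)
    (h20 : s.reg 20 = N) (h9 : N ≤ s.reg 9) (h9' : U.length ≤ s.reg 9) (h41 : s.reg 41 = U.length)
    (hU : Holds (s.arr 0) (s.reg 40) (U.flatMap Gate.encode))
    (hx : s.HoldsBits 2 (s.reg 42) x) (hz : s.HoldsBits 1 (s.reg 32) z) :
    (simulate.exec s).reg 45 = (decide (overlap (U.actBits (clearLast x)) z % 2 = 1)).toNat ∧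
      (simulate.exec s).reg 46 = (decide (SameLast (U.actBits (clearLast x)) z)).toNat := by
  have h1 := loadBits_spec hN h20 h9 hx
  have h2 := simulateGates_spec (s := loadBits.exec s) (U := U)
    (by rwa [Cmd.exec_reg rfl]) (by rwa [Cmd.exec_reg rfl])
    (by rwa [Cmd.exec_reg rfl, Cmd.exec_arr rfl]) h1
  refine compareBits_spec (s := simulateGates.exec (loadBits.exec s)) hN ?_ ?_ h2 ?_
  · rwa [Cmd.exec_reg rfl, Cmd.exec_reg rfl]
  · rwa [Cmd.exec_reg rfl, Cmd.exec_reg rfl]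
  · intro i
    rw [Cmd.exec_reg rfl, Cmd.exec_reg rfl, Cmd.exec_arr rfl, Cmd.exec_arr rfl]
    exact hz i

end HC1Q

namespace HC1Q

/-! ## The verifier -/

/-- Computes the product of the signs of the paths through two random bit strings, as
the difference of the registers `50` and `51`. -/
def multiplySigns : Cmd :=
  .assign 40 (.reg 47) ;; .assign 42 (.reg 35) ;; simulate ;;
  .assign 48 (.reg 45) ;; .assign 49 (.reg 46) ;;
  .assign 40 (.reg 47) ;; .assign 42 (.reg 35 + .reg 20) ;; simulate ;;
  .assign 50 (.band (.band (.reg 46) (.reg 49)) (.bxor (.bxor (.reg 45) (.reg 48)) (.const 1))) ;;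
  .assign 51 (.band (.band (.reg 46) (.reg 49)) (.bxor (.reg 45) (.reg 48)))

theorem neg_one_pow_eq_ite (n : ℕ) : (-1 : ℤ) ^ n = if n % 2 = 1 then -1 else 1 := by
  rcases Nat.mod_two_eq_zero_or_one n with h | h
  · rw [if_neg (by omega), Even.neg_one_pow (Nat.even_iff.2 h)]
  · rw [if_pos h, Odd.neg_one_pow (Nat.odd_iff.2 h)]

/-- Registers hold natural numbers, so a value in {-1, 0, 1} is kept as a difference of two bits.
Both are 0 unless both paths end in the right last bit; otherwise the exclusive or of the two
parities selects the bit that is set. -/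
theorem multiplySigns_spec {s : Store} {N : ℕ} {U : Circuit N} {x x' z : Fin N → Bool} (hN : 1 ≤ N)
    (h20 : s.reg 20 = N) (h9 : N ≤ s.reg 9) (h9' : U.length ≤ s.reg 9) (h41 : s.reg 41 = U.length)
    (hU : Holds (s.arr 0) (s.reg 47) (U.flatMap Gate.encode))
    (hx : s.HoldsBits 2 (s.reg 35) x) (hx' : s.HoldsBits 2 (s.reg 35 + N) x')
    (hz : s.HoldsBits 1 (s.reg 32) z) :
    ((multiplySigns.exec s).reg 50 : ℤ) - (multiplySigns.exec s).reg 51 =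
      pathSign U z x * pathSign U z x' := by
  set s₁ := (s.setReg 40 (s.reg 47)).setReg 42 (s.reg 35) with hs₁
  obtain ⟨a45, a46⟩ := simulate_spec (s := s₁) (U := U) (x := x) (z := z) hN
    (by simpa [hs₁] using h20) (by simpa [hs₁] using h9) (by simpa [hs₁] using h9')
    (by simpa [hs₁] using h41) (by simpa [hs₁] using hU)
    (by simpa [hs₁, Store.HoldsBits] using hx) (by simpa [hs₁, Store.HoldsBits] using hz)
  have k20 : (simulate.exec s₁).reg 20 = s.reg 20 := by rw [Cmd.exec_reg rfl]; simp [hs₁]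
  have k9 : (simulate.exec s₁).reg 9 = s.reg 9 := by rw [Cmd.exec_reg rfl]; simp [hs₁]
  have k41 : (simulate.exec s₁).reg 41 = s.reg 41 := by rw [Cmd.exec_reg rfl]; simp [hs₁]
  have k47 : (simulate.exec s₁).reg 47 = s.reg 47 := by rw [Cmd.exec_reg rfl]; simp [hs₁]
  have k35 : (simulate.exec s₁).reg 35 = s.reg 35 := by rw [Cmd.exec_reg rfl]; simp [hs₁]
  have k32 : (simulate.exec s₁).reg 32 = s.reg 32 := by rw [Cmd.exec_reg rfl]; simp [hs₁]
  have e0 : (simulate.exec s₁).arr 0 = s.arr 0 := by rw [Cmd.exec_arr rfl]; simp [hs₁]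
  have e1 : (simulate.exec s₁).arr 1 = s.arr 1 := by rw [Cmd.exec_arr rfl]; simp [hs₁]
  have e2 : (simulate.exec s₁).arr 2 = s.arr 2 := by rw [Cmd.exec_arr rfl]; simp [hs₁]
  set u := simulate.exec s₁ with hu
  set s₂ := ((((u.setReg 48 (u.reg 45)).setReg 49 (u.reg 46)).setReg 40 (u.reg 47)).setReg 42
    (u.reg 35 + u.reg 20)) with hs₂
  obtain ⟨b45, b46⟩ := simulate_spec (s := s₂) (U := U) (x := x') (z := z) hN
    (by simpa [hs₂, k20] using h20) (by simpa [hs₂, k9] using h9) (by simpa [hs₂, k9] using h9')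
    (by simpa [hs₂, k41] using h41) (by simpa [hs₂, e0, k47] using hU)
    (by simpa [hs₂, Store.HoldsBits, e2, k35, k20, h20] using hx')
    (by simpa [hs₂, Store.HoldsBits, e1, k32] using hz)
  have b48 : (simulate.exec s₂).reg 48 = u.reg 45 := by rw [Cmd.exec_reg rfl]; simp [hs₂]
  have b49 : (simulate.exec s₂).reg 49 = u.reg 46 := by rw [Cmd.exec_reg rfl]; simp [hs₂]
  set v := simulate.exec s₂ with hv
  have hexec : multiplySigns.exec s =
      (Cmd.assign 50 (.band (.band (.reg 46) (.reg 49))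
          (.bxor (.bxor (.reg 45) (.reg 48)) (.const 1))) ;;
        .assign 51 (.band (.band (.reg 46) (.reg 49)) (.bxor (.reg 45) (.reg 48)))).exec v := by
    simp only [multiplySigns, Cmd.exec_seq, hv, hs₂, hu, hs₁, Cmd.exec_assign, Exp.value_reg,
      Exp.value_add, Store.reg_setReg]
    simp
  rw [a46] at b49
  rw [a45] at b48
  have hm : ((Exp.reg 46).band (.reg 49)).value v = _ := Exp.value_band b46 b49
  have hb : ((Exp.reg 45).bxor (.reg 48)).value v = _ := Exp.value_bxor b45 b48
  have h50 := Exp.value_band hm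
    (Exp.value_bxor hb (show (Exp.const 1).value v = true.toNat from rfl))
  have hm' : ∀ n, ((Exp.reg 46).band (.reg 49)).value (v.setReg 50 n) = _ := fun n =>
    Exp.value_band (by simpa using b46) (by simpa using b49)
  have hb' : ∀ n, ((Exp.reg 45).bxor (.reg 48)).value (v.setReg 50 n) = _ := fun n =>
    Exp.value_bxor (by simpa using b45) (by simpa using b48)
  have h51 := fun n => Exp.value_band (hm' n) (hb' n)
  rw [hexec]
  simp only [Cmd.exec_seq, Cmd.exec_assign, Store.reg_setReg, h50, h51, if_true,
    show (50 : ℕ) ≠ 51 by decide, if_false, pathSign, neg_one_pow_eq_ite]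
  by_cases p1 : SameLast (U.actBits (clearLast x)) z <;>
  by_cases p2 : SameLast (U.actBits (clearLast x')) z <;>
  by_cases q1 : overlap (U.actBits (clearLast x)) z % 2 = 1 <;>
  by_cases q2 : overlap (U.actBits (clearLast x')) z % 2 = 1 <;>
  simp [p1, p2, q1, q2]

/-- An unbiased estimate of the difference of the probabilities of the outcome `z`, from two random
bit strings. -/
def sampleValue (I : Instance) (z x x' : Fin I.N → Bool) : ℤ :=
  pathSign I.U₁ z x * pathSign I.U₁ z x' - pathSign I.U₂ z x * pathSign I.U₂ z x'

/-- Takes one sample and adds its value to the difference of the registers `33` and `34`. -/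
def sample : Cmd :=
  .assign 47 (.reg 22) ;; .assign 41 (.reg 21) ;; multiplySigns ;;
  .assign 33 (.reg 33 + .reg 50) ;; .assign 34 (.reg 34 + .reg 51) ;;
  .assign 47 (.reg 23) ;; .assign 41 (.reg 24) ;; multiplySigns ;;
  .assign 33 (.reg 33 + .reg 51) ;; .assign 34 (.reg 34 + .reg 50) ;;
  .assign 35 (.reg 35 + (.reg 20 + .reg 20))

theorem Store.Parsed.congr {s t : Store} {I : Instance} {f : ℕ → ℕ} (h : s.Parsed I f)
    (h9 : t.reg 9 = s.reg 9) (h20 : t.reg 20 = s.reg 20) (h21 : t.reg 21 = s.reg 21)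
    (h22 : t.reg 22 = s.reg 22) (h23 : t.reg 23 = s.reg 23) (h24 : t.reg 24 = s.reg 24)
    (h25 : t.reg 25 = s.reg 25) : t.Parsed I f where
  reg20 := h20 ▸ h.reg20
  reg21 := h21 ▸ h.reg21
  reg24 := h24 ▸ h.reg24
  N_le := h9 ▸ h.N_le
  length₁_le := h9 ▸ h.length₁_le
  length₂_le := h9 ▸ h.length₂_le
  gates₁ := h22 ▸ h.gates₁
  gates₂ := h23 ▸ h.gates₂
  thresholds := h25 ▸ h.thresholds

/-- For the second circuit the roles of the registers 50 and 51 are exchanged, which subtracts its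
contribution. The random bits that have been read are skipped by advancing register 35. -/
theorem sample_spec {s : Store} {I : Instance} (hN : 1 ≤ I.N) (hI : s.Parsed I (s.arr 0))
    {z x x' : Fin I.N → Bool} (hz : s.HoldsBits 1 (s.reg 32) z)
    (hx : s.HoldsBits 2 (s.reg 35) x) (hx' : s.HoldsBits 2 (s.reg 35 + I.N) x') :
    ((sample.exec s).reg 33 : ℤ) - (sample.exec s).reg 34 =
      (s.reg 33 : ℤ) - s.reg 34 + sampleValue I z x x' ∧
    (sample.exec s).reg 35 = s.reg 35 + 2 * I.N := by
  set s₁ := (s.setReg 47 (s.reg 22)).setReg 41 (s.reg 21) with hs₁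
  have h₁ := multiplySigns_spec (s := s₁) (U := I.U₁) (x := x) (x' := x') (z := z) hN
    (by simpa [hs₁] using hI.reg20) (by simpa [hs₁] using hI.N_le)
    (by simpa [hs₁] using hI.length₁_le) (by simpa [hs₁] using hI.reg21)
    (by simpa [hs₁] using hI.gates₁) (by simpa [hs₁, Store.HoldsBits] using hx)
    (by simpa [hs₁, Store.HoldsBits] using hx') (by simpa [hs₁, Store.HoldsBits] using hz)
  have k33 : (multiplySigns.exec s₁).reg 33 = s.reg 33 := by rw [Cmd.exec_reg rfl]; simp [hs₁]
  have k34 : (multiplySigns.exec s₁).reg 34 = s.reg 34 := by rw [Cmd.exec_reg rfl]; simp [hs₁]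
  have k35 : (multiplySigns.exec s₁).reg 35 = s.reg 35 := by rw [Cmd.exec_reg rfl]; simp [hs₁]
  have k32 : (multiplySigns.exec s₁).reg 32 = s.reg 32 := by rw [Cmd.exec_reg rfl]; simp [hs₁]
  have k20 : (multiplySigns.exec s₁).reg 20 = s.reg 20 := by rw [Cmd.exec_reg rfl]; simp [hs₁]
  have k9 : (multiplySigns.exec s₁).reg 9 = s.reg 9 := by rw [Cmd.exec_reg rfl]; simp [hs₁]
  have k23 : (multiplySigns.exec s₁).reg 23 = s.reg 23 := by rw [Cmd.exec_reg rfl]; simp [hs₁]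
  have k24 : (multiplySigns.exec s₁).reg 24 = s.reg 24 := by rw [Cmd.exec_reg rfl]; simp [hs₁]
  have e0 : (multiplySigns.exec s₁).arr 0 = s.arr 0 := by rw [Cmd.exec_arr rfl]; simp [hs₁]
  have e1 : (multiplySigns.exec s₁).arr 1 = s.arr 1 := by rw [Cmd.exec_arr rfl]; simp [hs₁]
  have e2 : (multiplySigns.exec s₁).arr 2 = s.arr 2 := by rw [Cmd.exec_arr rfl]; simp [hs₁]
  set u := multiplySigns.exec s₁ with hu
  set s₂ := (Cmd.assign 33 (.reg 33 + .reg 50) ;; .assign 34 (.reg 34 + .reg 51) ;;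
    .assign 47 (.reg 23) ;; .assign 41 (.reg 24)).exec u with hs₂
  have h₂ := multiplySigns_spec (s := s₂) (U := I.U₂) (x := x) (x' := x') (z := z) hN
    (by simpa [hs₂, k20] using hI.reg20) (by simpa [hs₂, k9] using hI.N_le)
    (by simpa [hs₂, k9] using hI.length₂_le) (by simpa [hs₂, k24] using hI.reg24)
    (by simpa [hs₂, e0, k23] using hI.gates₂)
    (by simpa [hs₂, e2, k35, Store.HoldsBits] using hx)
    (by simpa [hs₂, e2, k35, Store.HoldsBits] using hx')
    (by simpa [hs₂, e1, k32, Store.HoldsBits] using hz)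
  have l33 : (multiplySigns.exec s₂).reg 33 = u.reg 33 + u.reg 50 := by
    rw [Cmd.exec_reg rfl]; simp [hs₂]
  have l34 : (multiplySigns.exec s₂).reg 34 = u.reg 34 + u.reg 51 := by
    rw [Cmd.exec_reg rfl]; simp [hs₂]
  have l35 : (multiplySigns.exec s₂).reg 35 = s.reg 35 := by
    rw [Cmd.exec_reg rfl]; simp [hs₂, k35]
  have l20 : (multiplySigns.exec s₂).reg 20 = I.N := by
    rw [Cmd.exec_reg rfl]; simp [hs₂, k20, hI.reg20]
  set v := multiplySigns.exec s₂ with hv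
  have hexec : sample.exec s = (Cmd.assign 33 (.reg 33 + .reg 51) ;;
      .assign 34 (.reg 34 + .reg 50) ;; .assign 35 (.reg 35 + (.reg 20 + .reg 20))).exec v := rfl
  rw [hexec]
  clear_value v u
  constructor
  · simp only [Cmd.exec_seq, Cmd.exec_assign, Exp.value_add, Exp.value_reg, Store.reg_setReg,
      Nat.reduceEqDiff, if_true, if_false, l33, l34, k33, k34, sampleValue,
      Nat.cast_add]
    linarith
  · simp [l35, l20]
    ring

/-- The `N` bits of the list `l` from position `o` on. -/
def window (l : List Bool) (o N : ℕ) : Fin N → Bool := fun i => l.getD (o + i) false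

/-- The sum of the values of `T` samples with random bits `r`. -/
def estimate (I : Instance) (z : Fin I.N → Bool) (r : List Bool) (T : ℕ) : ℤ :=
  ∑ t ∈ Finset.range T,
    sampleValue I z (window r (2 * I.N * t) I.N) (window r (2 * I.N * t + I.N) I.N)

/-- The estimate for the outcome `z` is above the mean of the thresholds. -/
def Passes (I : Instance) (r : List Bool) (T : ℕ) (z : Fin I.N → Bool) : Prop :=
  T * I.a.num.natAbs * I.b.den + T * I.b.num.natAbs * I.a.den ≤
    2 * (estimate I z r T).natAbs * I.a.den * I.b.den

/-- Computes the estimate for one candidate. -/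
def estimateCandidate : Cmd :=
  .assign 33 (.const 0) ;; .assign 34 (.const 0) ;; .assign 35 (.const 0) ;; .loop 31 11 26 sample

/-- Compares the estimate with the thresholds. -/
def testExp : Exp :=
  .same (.less
    (((.reg 33 - .reg 34) + (.reg 34 - .reg 33) + ((.reg 33 - .reg 34) + (.reg 34 - .reg 33))) *
      .cell 0 (.reg 25 + .const 1) * .cell 0 (.reg 25 + .const 3))
    (.reg 26 * .cell 0 (.reg 25) * .cell 0 (.reg 25 + .const 3) +
      .reg 26 * .cell 0 (.reg 25 + .const 2) * .cell 0 (.reg 25 + .const 1))) (.const 0)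

/-- Tests all candidates in the message. -/
def verify : Cmd :=
  parse ;;
  .assign 0 (.const 0) ;; .assign 32 (.const 0) ;;
  .assign 26 (.reg 11 / (.reg 20 + .reg 20)) ;;
  .loop 30 10 10 (estimateCandidate ;; .ite testExp (.assign 0 (.const 1)) .skip ;;
    .assign 32 (.reg 32 + .reg 20))

/-- Saves the lengths of the inputs. -/
def saveLengths : Cmd := .assign 9 (.reg 0) ;; .assign 10 (.reg 1) ;; .assign 11 (.reg 2)

/-- Loops need a read-only bound. The number of samples is computed at run time, so the length of
the random string in register 11 takes this role, and `hT` says that it does not cut the loop short.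
-/
theorem estimateCandidate_spec {s : Store} {I : Instance} (hN : 1 ≤ I.N)
    (hI : s.Parsed I (s.arr 0)) {z : Fin I.N → Bool} (hz : s.HoldsBits 1 (s.reg 32) z)
    {r : List Bool} (hr : ∀ j, s.arr 2 j = (r.getD j false).toNat) (hT : s.reg 26 ≤ s.reg 11) :
    ((estimateCandidate.exec s).reg 33 : ℤ) - (estimateCandidate.exec s).reg 34 =
      estimate I z r (s.reg 26) := by
  set s₁ := ((s.setReg 33 0).setReg 34 0).setReg 35 0 with hs₁
  have := Cmd.exec_loop (i := 31) (c := 11) (b := 26) (P := sample) (s := s₁)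
    (fun j t => (t.reg 33 : ℤ) - t.reg 34 = estimate I z r j ∧ t.reg 35 = 2 * I.N * j)
    (s.reg 26) (by simpa [hs₁] using hT) (by simp [hs₁, estimate])
    (by
      rintro j hj t hk ha ⟨h1, h2⟩
      have e0 : t.arr 0 = s.arr 0 := ha 0 rfl
      have e1 : t.arr 1 = s.arr 1 := ha 1 rfl
      have e2 : t.arr 2 = s.arr 2 := ha 2 rfl
      have hI' : (t.setReg 31 j).Parsed I ((t.setReg 31 j).arr 0) := by
        rw [Store.arr_setReg, e0]
        apply hI.congr <;>
        · simp only [Store.reg_setReg, if_neg (show (9 : ℕ) ≠ 31 by decide),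
            if_neg (show (20 : ℕ) ≠ 31 by decide), if_neg (show (21 : ℕ) ≠ 31 by decide),
            if_neg (show (22 : ℕ) ≠ 31 by decide), if_neg (show (23 : ℕ) ≠ 31 by decide),
            if_neg (show (24 : ℕ) ≠ 31 by decide), if_neg (show (25 : ℕ) ≠ 31 by decide)]
          rw [hk _ rfl]
          simp [hs₁]
      have e32 : t.reg 32 = s.reg 32 := by rw [hk 32 rfl]; simp [hs₁]
      have := sample_spec (s := t.setReg 31 j) hN hI' (z := z)
        (x := window r (2 * I.N * j) I.N) (x' := window r (2 * I.N * j + I.N) I.N)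
        (by simpa [Store.HoldsBits, e1, e32] using hz)
        (by simp [Store.HoldsBits, e2, h2, hr, window])
        (by simp [Store.HoldsBits, e2, h2, hr, window])
      refine ⟨?_, ?_⟩
      · rw [this.1, estimate, Finset.sum_range_succ, ← estimate, ← h1]
        simp
      · rw [this.2]
        simp [h2]
        ring)
    (by
      intro j t v h
      simpa using h)
  exact this.1

/-- The sum of the two truncated differences is the absolute value of the estimate. Denominators are
cleared by multiplication with cells of the input, which are admissible right factors because array
0 is read-only. -/
theorem testExp_value {s : Store} {I : Instance} (hI : s.Parsed I (s.arr 0))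
    {z : Fin I.N → Bool} {r : List Bool}
    (h : (s.reg 33 : ℤ) - s.reg 34 = estimate I z r (s.reg 26)) :
    testExp.value s = 0 ↔ ¬ Passes I r (s.reg 26) z := by
  have h0 := hI.thresholds 0 (by simp [encodeRat])
  have h1 := hI.thresholds 1 (by simp [encodeRat])
  have h2 := hI.thresholds 2 (by simp [encodeRat])
  have h3 := hI.thresholds 3 (by simp [encodeRat])
  simp only [encodeRat, List.cons_append, List.nil_append, List.getD_cons_zero,
    List.getD_cons_succ, add_zero] at h0 h1 h2 h3
  have h4 : s.reg 33 - s.reg 34 + (s.reg 34 - s.reg 33) + (s.reg 33 - s.reg 34 +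
      (s.reg 34 - s.reg 33)) = 2 * (estimate I z r (s.reg 26)).natAbs := by
    rw [← h]
    omega
  simp only [testExp, Exp.value_same, Exp.value_less, Exp.value_add, Exp.value_sub, Exp.value_mul,
    Exp.value_cell, Exp.value_reg, Exp.value_const, h0, h1, h2, h3, h4, Passes, not_le]
  simp

/-- The loop tries as many candidates as the message has bits, more than it really contains.
Candidates reaching beyond its end are filled up with zeros. They do no harm, because soundness is a
union bound over all of them. -/
theorem verify_spec {s : Store} {I : Instance} (hN : 1 ≤ I.N) (hw : Holds (s.arr 0) 0 I.encode)
    (h9 : s.reg 9 = I.encode.length) {m r : List Bool}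
    (hm : ∀ j, s.arr 1 j = (m.getD j false).toNat) (hr : ∀ j, s.arr 2 j = (r.getD j false).toNat)
    (h10 : s.reg 10 = m.length) (h11 : s.reg 11 = r.length) :
    (verify.exec s).reg 0 = 1 ↔
      ∃ c < m.length, Passes I r (r.length / (2 * I.N)) (window m (c * I.N) I.N) := by
  classical
  have hI := parsed_of_holds hw h9
  have e0 : (parse.exec s).arr 0 = s.arr 0 := Cmd.exec_arr rfl _
  have e1 : (parse.exec s).arr 1 = s.arr 1 := Cmd.exec_arr rfl _
  have e2 : (parse.exec s).arr 2 = s.arr 2 := Cmd.exec_arr rfl _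
  have e10 : (parse.exec s).reg 10 = m.length := by rw [Cmd.exec_reg rfl, h10]
  have e11 : (parse.exec s).reg 11 = r.length := by rw [Cmd.exec_reg rfl, h11]
  set u := parse.exec s with hu
  set P := estimateCandidate ;; .ite testExp (.assign 0 (.const 1)) .skip ;;
    .assign 32 (.reg 32 + .reg 20) with hP
  set T := r.length / (2 * I.N) with hT
  set s₁ := ((u.setReg 0 0).setReg 32 0).setReg 26 T with hs₁
  have hexec : verify.exec s = (Cmd.loop 30 10 10 P).exec s₁ := by
    simp only [verify, Cmd.exec_seq, ← hu, ← hP]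
    congr 1
    simp [hs₁, e11, hI.reg20, hT, two_mul]
  have := Cmd.exec_loop (i := 30) (c := 10) (b := 10) (P := P) (s := s₁)
    (fun j t => t.reg 0 = (if ∃ c < j, Passes I r T (window m (c * I.N) I.N) then 1 else 0) ∧
      t.reg 32 = j * I.N)
    m.length (by simp [hs₁, e10]) (by simp [hs₁])
    (by
      rintro j hj t hk ha ⟨h1, h2⟩
      have f0 : t.arr 0 = s.arr 0 := (ha 0 rfl).trans e0
      have f1 : t.arr 1 = s.arr 1 := (ha 1 rfl).trans e1
      have f2 : t.arr 2 = s.arr 2 := (ha 2 rfl).trans e2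
      have k26 : t.reg 26 = T := by rw [hk 26 rfl]; simp [hs₁]
      have k11 : t.reg 11 = r.length := by rw [hk 11 rfl]; simp [hs₁, e11]
      have hI₁ : s₁.Parsed I (s.arr 0) := by apply hI.congr <;> simp [hs₁]
      have hI₂ : (t.setReg 30 j).Parsed I (s.arr 0) := by
        apply hI₁.congr
        · rw [Store.reg_setReg, if_neg (by decide), hk 9 rfl]
        · rw [Store.reg_setReg, if_neg (by decide), hk 20 rfl]
        · rw [Store.reg_setReg, if_neg (by decide), hk 21 rfl]
        · rw [Store.reg_setReg, if_neg (by decide), hk 22 rfl]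
        · rw [Store.reg_setReg, if_neg (by decide), hk 23 rfl]
        · rw [Store.reg_setReg, if_neg (by decide), hk 24 rfl]
        · rw [Store.reg_setReg, if_neg (by decide), hk 25 rfl]
      have hest := estimateCandidate_spec (s := t.setReg 30 j) (z := window m (j * I.N) I.N)
        (r := r) hN (by simpa [f0] using hI₂)
        (by simp [Store.HoldsBits, f1, h2, hm, window]) (by simpa [f2] using hr)
        (by simpa [k26, k11] using Nat.div_le_self _ _)
      set v := estimateCandidate.exec (t.setReg 30 j) with hv
      have g0 : v.arr 0 = s.arr 0 := by rw [hv, Cmd.exec_arr rfl, Store.arr_setReg, f0]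
      have gr0 : v.reg 0 = t.reg 0 := by rw [hv, Cmd.exec_reg rfl]; simp
      have gr20 : v.reg 20 = I.N := by rw [hv, Cmd.exec_reg rfl, hI₂.reg20]
      have gr32 : v.reg 32 = j * I.N := by rw [hv, Cmd.exec_reg rfl]; simp [h2]
      have gr26 : v.reg 26 = T := by rw [hv, Cmd.exec_reg rfl]; simp [k26]
      have hI₃ : v.Parsed I (v.arr 0) := by
        rw [g0]
        apply hI₂.congr <;> rw [hv, Cmd.exec_reg rfl]
      have htest := testExp_value hI₃ (z := window m (j * I.N) I.N) (r := r) (by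
        rw [hest, gr26]
        simp [k26])
      rw [gr26] at htest
      have hPexec : P.exec (t.setReg 30 j) = (Cmd.ite testExp (.assign 0 (.const 1)) .skip ;;
        .assign 32 (.reg 32 + .reg 20)).exec v := rfl
      rw [hPexec]
      have hsucc : (∃ c < j + 1, Passes I r T (window m (c * I.N) I.N)) ↔
          (∃ c < j, Passes I r T (window m (c * I.N) I.N)) ∨
            Passes I r T (window m (j * I.N) I.N) := by
        constructor
        · rintro ⟨c, hc, h⟩
          rcases eq_or_ne c j with rfl | hne
          · exact Or.inr h
          · exact Or.inl ⟨c, by omega, h⟩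
        · rintro (⟨c, hc, h⟩ | h)
          · exact ⟨c, by omega, h⟩
          · exact ⟨j, by omega, h⟩
      simp only [hsucc, Cmd.exec_seq, Cmd.exec_ite]
      by_cases hp : Passes I r T (window m (j * I.N) I.N)
      · rw [if_neg (by rw [htest]; exact not_not.2 hp)]
        simp [hp, gr32, gr20, add_mul]
      · rw [if_pos (htest.2 hp)]
        simp [hp, gr32, gr20, add_mul, gr0, h1])
    (by
      intro j t v h
      simpa using h)
  rw [hexec, this.1]
  simp

/-- The lengths move to the registers 9, 10 and 11 because `verify` puts its answer in register 0,
while its loop bounds have to stay read-only. -/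
theorem saveLengths_ok : saveLengths.ok [0, 1, 2] [0] = true := by decide

theorem verify_ok : verify.ok [9, 10, 11] [0] = true := by decide

theorem bits_getD (m : List Bool) (j : ℕ) : (bits m).getD j 0 = (m.getD j false).toNat := by
  exact List.getD_map m false Bool.toNat

/-- The verifier accepts if some candidate in the message passes the test. -/
theorem verifier_spec {I : Instance} (hN : 1 ≤ I.N) (m r : List Bool) :
    (verify.exec (saveLengths.exec (load [I.encode, bits m, bits r]))).reg 0 = 1 ↔
      ∃ c < m.length, Passes I r (r.length / (2 * I.N)) (window m (c * I.N) I.N) := by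
  apply verify_spec hN
  · rw [Cmd.exec_arr rfl]
    exact holds_getD _
  · rfl
  · intro j
    rw [Cmd.exec_arr rfl]
    exact bits_getD m j
  · intro j
    rw [Cmd.exec_arr rfl]
    exact bits_getD r j
  · exact List.length_map _
  · exact List.length_map _

end HC1Q

namespace HC1Q

/-! ## The prover's circuit generator -/

/-- Appends a number to the output. -/
def emit (e : Exp) : Cmd := .store 0 (.reg 0) e ;; .assign 0 (.reg 0 + .const 1)

@[simp] theorem emit_output (e : Exp) (s : Store) :
    ((emit e).exec s).output = s.output ++ [e.value s] := by
  simp only [emit, Cmd.exec_seq, Cmd.exec_store, Cmd.exec_assign, Store.output, Exp.value_add,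
    Exp.value_reg, Exp.value_const, Store.reg_setReg, Store.reg_setArr, if_true, Store.arr_setReg,
    List.range_succ, List.map_append, List.map_cons, List.map_nil, Store.arr_setArr, and_self]
  congr 1
  refine List.map_congr_left fun j hj => ?_
  rw [Store.arr_setArr, if_neg]
  have := List.mem_range.1 hj
  omega

theorem emit_reg (e : Exp) (s : Store) {r : ℕ} (hr : r ≠ 0) :
    ((emit e).exec s).reg r = s.reg r :=
  Cmd.exec_reg (by simp [emit, Cmd.keepsReg, hr.symm]) s

theorem emit_arr (e : Exp) (s : Store) {k : ℕ} (hk : k ≠ 0) :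
    ((emit e).exec s).arr k = s.arr k :=
  Cmd.exec_arr (by simp [emit, Cmd.keepsArr, hk.symm]) s

theorem output_setReg (s : Store) {i : ℕ} (hi : i ≠ 0) (v : ℕ) :
    (s.setReg i v).output = s.output := by
  simp [Store.output, hi.symm]

/-- The description of a gate, from the cells of the array `f` from address `P` on, with all qubits
shifted by `O`. -/
def shiftedGate (f : ℕ → ℕ) (O P : ℕ) : List ℕ :=
  [f P, f (P + 1) + O, if 1 < f P then f (P + 2) + O else f (P + 2),
    if 2 < f P then f (P + 3) + O else f (P + 3)]

/-- Emits the gate that is described in array `5` from the address in register `33` on, with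
all qubits shifted by the contents of register `32`. -/
def emitGate : Cmd :=
  emit (.cell 5 (.reg 33)) ;;
  emit (.cell 5 (.reg 33 + .const 1) + .reg 32) ;;
  .ite (.less (.const 1) (.cell 5 (.reg 33)))
    (emit (.cell 5 (.reg 33 + .const 2) + .reg 32)) (emit (.cell 5 (.reg 33 + .const 2))) ;;
  .ite (.less (.const 2) (.cell 5 (.reg 33)))
    (emit (.cell 5 (.reg 33 + .const 3) + .reg 32)) (emit (.cell 5 (.reg 33 + .const 3)))

theorem emitGate_output (s : Store) :
    (emitGate.exec s).output = s.output ++ shiftedGate (s.arr 5) (s.reg 32) (s.reg 33) := by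
  simp only [emitGate, Cmd.exec_seq, Cmd.exec_ite, Exp.value_less, Exp.value_const, Exp.value_cell,
    Exp.value_reg, shiftedGate]
  by_cases h1 : 1 < s.arr 5 (s.reg 33) <;> by_cases h2 : 2 < s.arr 5 (s.reg 33) <;>
  simp [h1, h2, emit_reg, emit_arr]

/-- Emits the `reg 34` gates that are described in array `5` from the address in
register `33` on. -/
def emitGates : Cmd := .loop 30 9 34 (emitGate ;; .assign 33 (.reg 33 + .const 4))

/-- The descriptions of `n` gates, shifted by `O`. -/
def shiftedGates (f : ℕ → ℕ) (O P n : ℕ) : List ℕ :=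
  (List.range n).flatMap fun g => shiftedGate f O (P + 4 * g)

/-- The minimum is kept because the generator has to run in polynomial time on every word, including
those that describe no instance; on instances it is the number of gates. -/
theorem emitGates_output (s : Store) :
    (emitGates.exec s).output = s.output ++
      shiftedGates (s.arr 5) (s.reg 32) (s.reg 33) (min (s.reg 9) (s.reg 34)) := by
  have := Cmd.exec_loop (i := 30) (c := 9) (b := 34)
    (P := emitGate ;; .assign 33 (.reg 33 + .const 4)) (s := s)
    (fun j t => t.reg 33 = s.reg 33 + 4 * j ∧
      t.output = s.output ++ shiftedGates (s.arr 5) (s.reg 32) (s.reg 33) j)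
    (min (s.reg 9) (s.reg 34)) rfl (by simp [shiftedGates])
    (by
      rintro j hj t hk ha ⟨h1, h2⟩
      have e5 : t.arr 5 = s.arr 5 := ha 5 rfl
      have k32 : t.reg 32 = s.reg 32 := hk 32 rfl
      have k33 : (emitGate.exec (t.setReg 30 j)).reg 33 = t.reg 33 := by
        rw [Cmd.exec_reg rfl]
        simp
      refine ⟨by simp [k33, h1]; ring, ?_⟩
      rw [Cmd.exec_seq, Cmd.exec_assign, output_setReg _ (by decide), emitGate_output,
        output_setReg _ (by decide), h2]
      simp [shiftedGates, List.range_succ, e5, k32, h1])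
    (by
      intro j t v h
      simpa [output_setReg] using h)
  exact this.2

/-- Emits `min (reg 9) (reg 20)` pairs of ones for each copy. -/
def emitOnes : Cmd := .loop 31 8 8 (.loop 30 9 20 (emit (.const 1) ;; emit (.const 1)))

theorem emitOnes_output (s : Store) :
    (emitOnes.exec s).output = s.output ++
      List.replicate (s.reg 8 * (2 * min (s.reg 9) (s.reg 20))) 1 := by
  refine Cmd.exec_loop (i := 31) (c := 8) (b := 8)
    (P := .loop 30 9 20 (emit (.const 1) ;; emit (.const 1))) (s := s)
    (fun k t => t.output = s.output ++
      List.replicate (k * (2 * min (s.reg 9) (s.reg 20))) 1)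
    (s.reg 8) (min_self _) (by simp) ?_ ?_
  · intro k hk t hr ha ht
    have k9 : t.reg 9 = s.reg 9 := hr 9 rfl
    have k20 : t.reg 20 = s.reg 20 := hr 20 rfl
    have := Cmd.exec_loop (i := 30) (c := 9) (b := 20)
      (P := emit (.const 1) ;; emit (.const 1)) (s := t.setReg 31 k)
      (fun j u => u.output = t.output ++ List.replicate (2 * j) 1)
      (min (s.reg 9) (s.reg 20)) (by simp [k9, k20]) (by simp [output_setReg]) (by
        intro j hj u _ _ hu
        simp only [Cmd.exec_seq, emit_output, Exp.value_const]
        rw [output_setReg _ (by decide), hu]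
        rw [show 2 * (j + 1) = 2 * j + 2 by ring, List.replicate_add]
        simp [List.replicate_succ]) (by
        intro j u v h
        simpa [output_setReg] using h)
    rw [this, ht, List.append_assoc, ← List.replicate_add]
    congr 2
    ring
  · intro k t v h
    simpa [output_setReg] using h

/-- Emits the gates of one copy of both circuits. -/
def emitCopy : Cmd :=
  .assign 33 (.reg 22) ;; .assign 34 (.reg 21) ;; emitGates ;; .assign 32 (.reg 32 + .reg 20) ;;
  .assign 33 (.reg 23) ;; .assign 34 (.reg 24) ;; emitGates ;; .assign 32 (.reg 32 + .reg 20)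

theorem emitCopy_spec (s : Store) :
    (emitCopy.exec s).output = s.output ++
      (shiftedGates (s.arr 5) (s.reg 32) (s.reg 22) (min (s.reg 9) (s.reg 21)) ++
      shiftedGates (s.arr 5) (s.reg 32 + s.reg 20) (s.reg 23) (min (s.reg 9) (s.reg 24))) ∧
    (emitCopy.exec s).reg 32 = s.reg 32 + 2 * s.reg 20 := by
  set s₁ := (Cmd.assign 33 (.reg 22) ;; .assign 34 (.reg 21)).exec s with hs₁
  have e5 : (emitGates.exec s₁).arr 5 = s.arr 5 := by rw [Cmd.exec_arr rfl]; simp [hs₁]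
  have k9 : (emitGates.exec s₁).reg 9 = s.reg 9 := by rw [Cmd.exec_reg rfl]; simp [hs₁]
  have k20 : (emitGates.exec s₁).reg 20 = s.reg 20 := by rw [Cmd.exec_reg rfl]; simp [hs₁]
  have k23 : (emitGates.exec s₁).reg 23 = s.reg 23 := by rw [Cmd.exec_reg rfl]; simp [hs₁]
  have k24 : (emitGates.exec s₁).reg 24 = s.reg 24 := by rw [Cmd.exec_reg rfl]; simp [hs₁]
  have k32 : (emitGates.exec s₁).reg 32 = s.reg 32 := by rw [Cmd.exec_reg rfl]; simp [hs₁]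
  have h₁ := emitGates_output s₁
  set u := emitGates.exec s₁ with hu
  set s₂ := (Cmd.assign 32 (.reg 32 + .reg 20) ;; .assign 33 (.reg 23) ;;
    .assign 34 (.reg 24)).exec u with hs₂
  have h₂ := emitGates_output s₂
  have l32 : (emitGates.exec s₂).reg 32 = s.reg 32 + s.reg 20 := by
    rw [Cmd.exec_reg rfl]; simp [hs₂, k32, k20]
  have l20 : (emitGates.exec s₂).reg 20 = s.reg 20 := by
    rw [Cmd.exec_reg rfl]; simp [hs₂, k20]
  set v := emitGates.exec s₂ with hv
  have hexec : emitCopy.exec s = (Cmd.assign 32 (.reg 32 + .reg 20)).exec v := rfl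
  rw [hexec]
  clear_value v u
  constructor
  · rw [Cmd.exec_assign, output_setReg _ (by decide), h₂]
    simp [hs₂, hs₁, output_setReg, h₁, e5, k9, k20, k23, k24, k32]
  · simp [l32, l20]
    ring

/-- Generates copies of the two circuits on disjoint sets of qubits. -/
def generate : Cmd :=
  parse ;;
  .loop 30 9 9 (.store 5 (.reg 30) (.cell 0 (.reg 30))) ;;
  .assign 0 (.const 0) ;; .assign 32 (.const 0) ;;
  emitOnes ;; emit (.const 0) ;; emit ((.reg 21 + .reg 24) * .reg 8) ;;
  .loop 31 8 8 emitCopy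

/-- The gates of `k` copies of both circuits, as emitted after `parse` has led to the store `u`. -/
def copies (u : Store) (f : ℕ → ℕ) (k : ℕ) : List ℕ :=
  (List.range k).flatMap fun k =>
    shiftedGates f (k * (2 * u.reg 20)) (u.reg 22) (min (u.reg 9) (u.reg 21)) ++
    shiftedGates f (k * (2 * u.reg 20) + u.reg 20) (u.reg 23) (min (u.reg 9) (u.reg 24))

/-- The output replaces the input in array 0, so the gates are read from a copy in array 5. Since
the input is 0 beyond its length and array 5 is 0 at the start, the copy agrees with it at all
addresses. Nothing is assumed about the form of the input. -/
theorem generate_output {s : Store} {f : ℕ → ℕ} (hf : s.arr 0 = f) (hf' : ∀ j, s.reg 9 ≤ j → f j = 0)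
    (h5 : ∀ j, s.arr 5 j = 0) :
    (generate.exec s).output =
      List.replicate (s.reg 8 * (2 * min (s.reg 9) ((parse.exec s).reg 20))) 1 ++
        [0, ((parse.exec s).reg 21 + (parse.exec s).reg 24) * s.reg 8] ++
        copies (parse.exec s) f (s.reg 8) := by
  have e0 : (parse.exec s).arr 0 = f := by rw [Cmd.exec_arr rfl, hf]
  have e5 : (parse.exec s).arr 5 = s.arr 5 := Cmd.exec_arr rfl _
  have k9 : (parse.exec s).reg 9 = s.reg 9 := Cmd.exec_reg rfl _
  have k8 : (parse.exec s).reg 8 = s.reg 8 := Cmd.exec_reg rfl _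
  set u := parse.exec s with hu
  have hcopy : ((Cmd.loop 30 9 9 (.store 5 (.reg 30) (.cell 0 (.reg 30)))).exec u).arr 5 = f := by
    have := Cmd.exec_loop (i := 30) (c := 9) (b := 9)
      (P := .store 5 (.reg 30) (.cell 0 (.reg 30))) (s := u)
      (fun j t => ∀ i, t.arr 5 i = if i < j then f i else 0) (s.reg 9) (by simp [k9])
      (by simp [e5, h5])
      (by
        intro j hj t _ ha ht i
        have e0' : t.arr 0 = f := (ha 0 rfl).trans e0
        simp only [Cmd.exec_store, Exp.value_reg, Exp.value_cell, Store.arr_setArr, true_and,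
          Store.reg_setReg, if_true, Store.arr_setReg, e0', ht]
        rcases lt_trichotomy i j with h | h | h
        · simp [h, h.ne, h.trans (Nat.lt_succ_self j)]
        · simp [h]
        · simp [h.ne', h.not_gt, show ¬ (i < j + 1) by omega])
      (by
        intro j t v h
        simpa using h)
    funext i
    rw [this]
    split_ifs with h
    · rfl
    · exact (hf' i (by omega)).symm
  set c := (Cmd.loop 30 9 9 (.store 5 (.reg 30) (.cell 0 (.reg 30)))).exec u with hc
  have hcr : ∀ r, r ≠ 30 → c.reg r = u.reg r := fun r hr =>
    Cmd.exec_reg (by simp [Cmd.keepsReg, hr.symm]) u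
  set s₁ := (Cmd.assign 0 (.const 0) ;; .assign 32 (.const 0)).exec c with hs₁
  have ho : s₁.output = [] := by simp [hs₁, Store.output]
  have hs₁r : ∀ r, r ≠ 30 → r ≠ 0 → r ≠ 32 → s₁.reg r = u.reg r := fun r h1 h2 h3 => by
    simp [hs₁, hcr r h1, h2, h3]
  have hs₁5 : s₁.arr 5 = f := by simpa [hs₁] using hcopy
  have hones := emitOnes_output s₁
  set d := emitOnes.exec s₁ with hd
  have hdr : ∀ r, r ≠ 30 → r ≠ 0 → r ≠ 31 → d.reg r = s₁.reg r := fun r h1 h2 h3 =>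
    Cmd.exec_reg (by simp [emitOnes, emit, Cmd.keepsReg, h1.symm, h2.symm, h3.symm]) s₁
  have hd5 : d.arr 5 = f := by rw [hd, Cmd.exec_arr rfl, hs₁5]
  set s₂ := (emit (.const 0) ;; emit ((.reg 21 + .reg 24) * .reg 8)).exec d with hs₂
  have hs₂r : ∀ r, r ≠ 30 → r ≠ 0 → r ≠ 31 → s₂.reg r = s₁.reg r := fun r h1 h2 h3 => by
    rw [hs₂, Cmd.exec_seq, emit_reg _ _ h2, emit_reg _ _ h2, hdr r h1 h2 h3]
  have hs₂5 : s₂.arr 5 = f := by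
    rw [hs₂, Cmd.exec_seq, emit_arr _ _ (by decide), emit_arr _ _ (by decide), hd5]
  have hexec : generate.exec s = (Cmd.loop 31 8 8 emitCopy).exec s₂ := rfl
  have hs₂r' : ∀ r, r ≠ 30 → r ≠ 0 → r ≠ 31 → r ≠ 32 → s₂.reg r = u.reg r :=
    fun r h1 h2 h3 h4 => (hs₂r r h1 h2 h3).trans (hs₁r r h1 h2 h4)
  have h32 : s₂.reg 32 = 0 := by
    rw [hs₂r 32 (by decide) (by decide) (by decide)]
    simp [hs₁]
  have hs₂o : s₂.output = List.replicate (s.reg 8 * (2 * min (s.reg 9) (u.reg 20))) 1 ++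
      [0, (u.reg 21 + u.reg 24) * s.reg 8] := by
    rw [hs₂, Cmd.exec_seq, emit_output, emit_output, hones, ho]
    simp only [Exp.value_mul, Exp.value_add, Exp.value_reg, Exp.value_const]
    rw [emit_reg _ _ (by decide), emit_reg _ _ (by decide), emit_reg _ _ (by decide),
      hdr 21 (by decide) (by decide) (by decide), hdr 24 (by decide) (by decide) (by decide),
      hdr 8 (by decide) (by decide) (by decide), hs₁r 21 (by decide) (by decide) (by decide),
      hs₁r 24 (by decide) (by decide) (by decide), hs₁r 8 (by decide) (by decide) (by decide),
      hs₁r 9 (by decide) (by decide) (by decide), hs₁r 20 (by decide) (by decide) (by decide),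
      k8, k9]
    simp
  rw [hexec, ← hs₂o]
  have := Cmd.exec_loop (i := 31) (c := 8) (b := 8) (P := emitCopy) (s := s₂)
    (fun k t => t.output = s₂.output ++ copies u f k ∧ t.reg 32 = k * (2 * u.reg 20))
    (s.reg 8) (by rw [hs₂r' 8 (by decide) (by decide) (by decide) (by decide), k8, min_self])
    (by simp [h32, copies])
    (by
      rintro k hk t hr ha ⟨h1, h2⟩
      have hrr : ∀ r, (Cmd.loop 31 8 8 emitCopy).keepsReg r = true → r ≠ 30 → r ≠ 0 → r ≠ 31 →
        r ≠ 32 → (t.setReg 31 k).reg r = u.reg r := fun r h h1 h2 h3 h4 => by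
          rw [Store.reg_setReg, if_neg h3, hr r h, hs₂r' r h1 h2 h3 h4]
      have e5 : t.arr 5 = f := (ha 5 rfl).trans hs₂5
      obtain ⟨o, o'⟩ := emitCopy_spec (t.setReg 31 k)
      rw [hrr 20 rfl (by decide) (by decide) (by decide) (by decide)] at o o'
      rw [hrr 22 rfl (by decide) (by decide) (by decide) (by decide),
        hrr 23 rfl (by decide) (by decide) (by decide) (by decide),
        hrr 9 rfl (by decide) (by decide) (by decide) (by decide),
        hrr 21 rfl (by decide) (by decide) (by decide) (by decide),
        hrr 24 rfl (by decide) (by decide) (by decide) (by decide)] at o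
      rw [Store.reg_setReg, if_neg (by decide), h2] at o o'
      refine ⟨?_, by rw [o']; ring⟩
      rw [o, output_setReg _ (by decide), h1, Store.arr_setReg, e5]
      simp [copies, List.range_succ])
    (by
      intro j t v h
      simpa [output_setReg] using h)
  exact this.1

/-- Multiplies register `8` by the length of the input, `d` times. -/
def powerLoop : ℕ → Cmd
  | 0 => .skip
  | d + 1 => powerLoop d ;; .assign 8 (.reg 8 * .reg 0)

/-- Saves the length of the input and computes its `d`-th power. -/
def prepareGenerate (d : ℕ) : Cmd := .assign 9 (.reg 0) ;; .assign 8 (.const 1) ;; powerLoop d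

/-- The exponent is a constant of the program, so the power is unrolled into `d` assignments. Each
multiplies by register 0, the length of the input, which is still read-only at this stage. -/
theorem powerLoop_ok (d : ℕ) : (powerLoop d).ok [0] [] = true := by
  induction d with
  | zero => rfl
  | succ d ih =>
    simp only [powerLoop, Cmd.ok, ih, Bool.true_and]
    decide

theorem prepareGenerate_ok (d : ℕ) : (prepareGenerate d).ok [0] [] = true := by
  simp only [prepareGenerate, Cmd.ok, powerLoop_ok, Bool.and_true]
  decide

theorem generate_ok : generate.ok [8, 9] [] = true := by decide

theorem powerLoop_exec (d : ℕ) (s : Store) :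
    (powerLoop d).exec s = s.setReg 8 (s.reg 8 * s.reg 0 ^ d) := by
  induction d with
  | zero =>
    rw [pow_zero, mul_one, powerLoop, Cmd.exec_skip]
    cases s
    simp [Store.setReg]
  | succ d ih =>
    simp only [powerLoop, Cmd.exec_seq, ih, Cmd.exec_assign, Exp.value_mul, Exp.value_reg,
      Store.reg_setReg, if_true]
    simp [Store.setReg, pow_succ, mul_assoc]

theorem prepareGenerate_exec (d : ℕ) (s : Store) :
    (prepareGenerate d).exec s = (s.setReg 9 (s.reg 0)).setReg 8 (s.reg 0 ^ d) := by
  simp only [prepareGenerate, Cmd.exec_seq, Cmd.exec_assign, Exp.value_reg, Exp.value_const,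
    powerLoop_exec, Store.reg_setReg]
  simp [Store.setReg]

/-- The generator of the prover's circuit, as a function on words. -/
def generator (d : ℕ) (w : List ℕ) : List ℕ :=
  (generate.exec ((prepareGenerate d).exec (load [w]))).output

/-- The output of the generator on every input. -/
theorem generator_eq (d : ℕ) (w : List ℕ) : ∃ u : Store,
    u = parse.exec ((prepareGenerate d).exec (load [w])) ∧ u.reg 9 = w.length ∧
    generator d w = List.replicate (w.length ^ d * (2 * min w.length (u.reg 20))) 1 ++
        [0, (u.reg 21 + u.reg 24) * w.length ^ d] ++
        copies u (fun j => w.getD j 0) (w.length ^ d) := by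
  refine ⟨_, rfl, ?_, ?_⟩
  · rw [Cmd.exec_reg rfl, prepareGenerate_exec]
    simp [load]
  · have := generate_output (s := (prepareGenerate d).exec (load [w])) (f := fun j => w.getD j 0)
      (by rw [prepareGenerate_exec]; rfl)
      (by
        intro j hj
        rw [prepareGenerate_exec] at hj
        exact List.getD_eq_default _ _ (by simpa [load] using hj))
      (by intro j; rw [prepareGenerate_exec]; simp [load])
    have h8 : ((prepareGenerate d).exec (load [w])).reg 8 = w.length ^ d := by
      rw [prepareGenerate_exec]
      simp [load]
    have h9 : ((prepareGenerate d).exec (load [w])).reg 9 = w.length := by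
      rw [prepareGenerate_exec]
      simp [load]
    rw [h8, h9] at this
    exact this

/-! ### Output length and running time of the generator -/

theorem length_shiftedGates (f : ℕ → ℕ) (O P n : ℕ) : (shiftedGates f O P n).length = 4 * n := by
  simp [shiftedGates, shiftedGate, List.length_flatMap, mul_comm]

theorem length_copies_le (u : Store) (f : ℕ → ℕ) (k : ℕ) :
    (copies u f k).length ≤ k * (8 * u.reg 9) := by
  induction k with
  | zero => simp [copies]
  | succ k ih =>
    rw [copies, List.range_succ, List.flatMap_append, ← copies, List.length_append]
    simp only [List.flatMap_cons, List.flatMap_nil, List.append_nil, List.length_append,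
      length_shiftedGates]
    have h1 := min_le_left (u.reg 9) (u.reg 21)
    have h2 := min_le_left (u.reg 9) (u.reg 24)
    have h3 : (k + 1) * (8 * u.reg 9) = k * (8 * u.reg 9) + 8 * u.reg 9 := by ring
    omega

theorem length_generator_le (d : ℕ) (w : List ℕ) :
    (generator d w).length ≤ w.length ^ d * (10 * w.length) + 2 := by
  obtain ⟨u, -, h9, h⟩ := generator_eq d w
  have h1 := length_copies_le u (fun j => w.getD j 0) (w.length ^ d)
  have h2 : w.length ^ d * (2 * min w.length (u.reg 20)) ≤ w.length ^ d * (2 * w.length) := by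
    gcongr
    exact min_le_left _ _
  rw [h]
  simp only [List.length_append, List.length_replicate, List.length_cons, List.length_nil]
  rw [h9] at h1
  linarith

theorem length_le_size (w : List ℕ) : w.length ≤ size w := by
  induction w with
  | nil => simp
  | cons a w ih =>
    simp only [size, List.map_cons, List.sum_cons, List.length_cons] at *
    omega

theorem size_le_of_forall {w : List ℕ} {B : ℕ} (h : ∀ a ∈ w, Nat.size a ≤ B) :
    size w ≤ w.length * (B + 1) := by
  induction w with
  | nil => simp [size]
  | cons a w ih =>
    have := ih fun a ha => h a (List.mem_cons_of_mem _ ha)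
    have := h a List.mem_cons_self
    simp only [size, List.map_cons, List.sum_cons, List.length_cons] at *
    linarith

theorem size_getD_le (w : List ℕ) (j : ℕ) : Nat.size (w.getD j 0) ≤ size w := by
  induction w generalizing j with
  | nil => simp
  | cons a w ih =>
    simp only [size, List.map_cons, List.sum_cons] at *
    cases j with
    | zero => simp only [List.getD_cons_zero]; omega
    | succ j => simp only [List.getD_cons_succ]; have := ih j; omega

/-- The size of the output is at most its length times the largest bit length. The length is known
from the explicit form of the output, and the bit length from the general bound on the final store.
-/
theorem polyTime_generator (d : ℕ) : PolyTime (generator d) := by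
  obtain ⟨q, hq⟩ := Cmd.exists_run_seq (prepareGenerate_ok d) generate_ok
    (Polynomial.X ^ d + Polynomial.X)
  refine ⟨.seq (prepareGenerate d).compile generate.compile,
    (Polynomial.X ^ d * (10 * Polynomial.X) + 2) * (q + 1) + q, fun w => ?_⟩
  have hlen := length_le_size w
  obtain ⟨t, hr, ht, hb⟩ := hq (load [w]) (size w)
    ⟨by simpa [load] using hlen, by simp⟩
    ⟨fun i => by
      rcases i with _ | i
      · exact (size_le_self _).trans hlen
      · simp [load],
    fun k j => by
      rcases k with _ | k
      · exact size_getD_le w j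
      · simp [load]⟩
    ⟨by
      rw [prepareGenerate_exec]
      simp only [List.mem_cons, List.not_mem_nil, or_false, forall_eq_or_imp, forall_eq]
      have : w.length ^ d ≤ size w ^ d := Nat.pow_le_pow_left hlen d
      simp [load]
      omega, by simp⟩
  refine ⟨?_, _, t, hr, rfl, ?_⟩
  · refine (size_le_of_forall (B := q.eval (size w)) ?_).trans ?_
    · intro a ha
      simp only [generator, Store.output, List.mem_map] at ha
      obtain ⟨j, -, rfl⟩ := ha
      exact hb.2 _ _
    · have h1 := length_generator_le d w
      have h2 : w.length ^ d * (10 * w.length) ≤ size w ^ d * (10 * size w) := by gcongr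
      have h3 : (generator d w).length * (q.eval (size w) + 1) ≤
        (size w ^ d * (10 * size w) + 2) * (q.eval (size w) + 1) := by
          gcongr
          omega
      simp only [Polynomial.eval_add, Polynomial.eval_mul, Polynomial.eval_X, Polynomial.eval_one,
        Polynomial.eval_pow, Polynomial.eval_ofNat]
      omega
  · simp only [Polynomial.eval_add]
    omega

end HC1Q

namespace HC1Q

open Finset

/-! ## Circuits on blocks of qubits -/

variable {N M : ℕ}

/-- A classical gate on a larger set of wires. -/
def ClassicalGate.map (e : Fin N ↪ Fin M) : ClassicalGate N → ClassicalGate M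
  | .x t => .x (e t)
  | .cnot c t h => .cnot (e c) (e t) (e.injective.ne h)
  | .ccx c d t h₁ h₂ h₃ =>
      .ccx (e c) (e d) (e t) (e.injective.ne h₁) (e.injective.ne h₂) (e.injective.ne h₃)

/-- A gate on a larger set of qubits. -/
def Gate.map (e : Fin N ↪ Fin M) : Gate N → Gate M
  | .had i => .had (e i)
  | .classical g => .classical (g.map e)

/-- A circuit on a larger set of qubits. -/
def Circuit.map (e : Fin N ↪ Fin M) (U : Circuit N) : Circuit M := List.map (Gate.map e) U

/-- Two bit strings agree outside the range of `e`. -/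
def AgreeOff (e : Fin N → Fin M) (x y : Fin M → Bool) : Prop :=
  ∀ j, (∀ i, e i ≠ j) → x j = y j

/-- The bit string `y` with the bits at the positions given by `e` replaced by `u`. -/
noncomputable def overwrite (e : Fin N → Fin M) (y : Fin M → Bool) (u : Fin N → Bool) :
    Fin M → Bool := Function.extend e u y

theorem overwrite_comp (e : Fin N ↪ Fin M) (y : Fin M → Bool) (u : Fin N → Bool) :
    overwrite e y u ∘ e = u := funext fun i => e.injective.extend_apply u y i

theorem agreeOff_overwrite (e : Fin N ↪ Fin M) (y : Fin M → Bool) (u : Fin N → Bool) :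
    AgreeOff e (overwrite e y u) y := fun _ hj =>
  Function.extend_apply' _ _ _ fun ⟨i, hi⟩ => hj i hi

theorem agreeOff_comm {e : Fin N → Fin M} {x y : Fin M → Bool} (h : AgreeOff e x y) :
    AgreeOff e y x := fun j hj => (h j hj).symm

theorem agreeOff_trans {e : Fin N → Fin M} {x y z : Fin M → Bool} (h : AgreeOff e x y)
    (h' : AgreeOff e y z) : AgreeOff e x z := fun j hj => (h j hj).trans (h' j hj)

theorem ext_of_agreeOff {e : Fin N → Fin M} {x y : Fin M → Bool} (h : AgreeOff e x y)
    (h' : x ∘ e = y ∘ e) : x = y := by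
  funext j
  by_cases hj : ∃ i, e i = j
  · obtain ⟨i, rfl⟩ := hj
    exact congrFun h' i
  · exact h j fun i hi => hj ⟨i, hi⟩

theorem overwrite_eq {e : Fin N ↪ Fin M} {x y : Fin M → Bool} (h : AgreeOff e x y) :
    overwrite e y (x ∘ e) = x :=
  ext_of_agreeOff (agreeOff_trans (agreeOff_overwrite e y _) (agreeOff_comm h))
    (overwrite_comp e y _)

open Classical in
-- Strings that agree with `y` outside a block are parametrized by their contents on the block. This
-- reduces a matrix product on all qubits to one on the block.
theorem sum_agreeOff {A : Type*} [AddCommMonoid A] (e : Fin N ↪ Fin M) (y : Fin M → Bool)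
    (f : (Fin M → Bool) → A) :
    ∑ x, (if AgreeOff e x y then f x else 0) = ∑ u, f (overwrite e y u) := by
  rw [← sum_filter]
  symm
  refine sum_bij' (fun u _ => overwrite e y u) (fun x _ => x ∘ e) ?_ ?_ ?_ ?_ ?_
  · intro u _
    exact mem_filter.2 ⟨mem_univ _, agreeOff_overwrite e y u⟩
  · intro x _
    exact mem_univ _
  · intro u _
    exact overwrite_comp e y u
  · intro x hx
    exact overwrite_eq (mem_filter.1 hx).2
  · intro u _
    rfl

theorem ClassicalGate.agreeOff_act (e : Fin N ↪ Fin M) (g : ClassicalGate N) (y : Fin M → Bool) :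
    AgreeOff e ((g.map e).act y) y := by
  intro j hj
  rcases g with t | ⟨c, t, h⟩ | ⟨c, d, t, h₁, h₂, h₃⟩ <;>
  exact Function.update_of_ne (hj t).symm _ _

theorem ClassicalGate.act_comp (e : Fin N ↪ Fin M) (g : ClassicalGate N) (y : Fin M → Bool) :
    (g.map e).act y ∘ e = g.act (y ∘ e) := by
  funext i
  rcases g with t | ⟨c, t, h⟩ | ⟨c, d, t, h₁, h₂, h₃⟩ <;>
  simp [ClassicalGate.map, ClassicalGate.act, Function.update_apply, e.injective.eq_iff]

open Classical in
-- This is the tensor product of the gate with the identity on the qubits outside the range of `e`,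
-- written entrywise.
theorem Gate.matrix_map (e : Fin N ↪ Fin M) (g : Gate N) (x y : Fin M → Bool) :
    (g.map e).matrix x y = if AgreeOff e x y then g.matrix (x ∘ e) (y ∘ e) else 0 := by
  rcases g with i | g
  · simp only [Gate.map, Gate.matrix, Matrix.of_apply, Function.comp_apply]
    have : (∀ j, j ≠ e i → x j = y j) ↔ AgreeOff e x y ∧ ∀ j, j ≠ i → x (e j) = y (e j) := by
      constructor
      · exact fun h => ⟨fun j hj => h j (hj i).symm, fun j hj => h _ (e.injective.ne hj)⟩
      · rintro ⟨h, h'⟩ j hj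
        by_cases hj' : ∃ i, e i = j
        · obtain ⟨k, rfl⟩ := hj'
          exact h' k fun hk => hj (by rw [hk])
        · exact h j fun i hi => hj' ⟨i, hi⟩
    by_cases h1 : AgreeOff e x y <;> by_cases h2 : ∀ j, j ≠ i → x (e j) = y (e j)
    · rw [if_pos (this.2 ⟨h1, h2⟩), if_pos h1, if_pos h2]
    · rw [if_neg fun h => h2 (this.1 h).2, if_pos h1, if_neg h2]
    · rw [if_neg fun h => h1 (this.1 h).1, if_neg h1]
    · rw [if_neg fun h => h1 (this.1 h).1, if_neg h1]
  · simp only [Gate.map, Gate.matrix, Matrix.of_apply]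
    by_cases h1 : AgreeOff e x y
    · rw [if_pos h1]
      congr 1
      rw [← ClassicalGate.act_comp, eq_iff_iff]
      exact ⟨fun h => by rw [h], ext_of_agreeOff
        (agreeOff_trans h1 (agreeOff_comm (ClassicalGate.agreeOff_act e g y)))⟩
    · rw [if_neg h1, if_neg]
      rintro rfl
      exact h1 (ClassicalGate.agreeOff_act e g y)

open Classical in
-- The tensor form is inherited by products: all intermediate strings agree with `y` outside the
-- block.
theorem Circuit.matrix_map (e : Fin N ↪ Fin M) (U : Circuit N) (x y : Fin M → Bool) :
    (Circuit.matrix (U.map e)) x y =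
      if AgreeOff e x y then Circuit.matrix U (x ∘ e) (y ∘ e) else 0 := by
  induction U generalizing x y with
  | nil =>
    simp only [Circuit.map, List.map_nil, Circuit.matrix, Matrix.one_apply]
    by_cases h1 : AgreeOff e x y
    · rw [if_pos h1]
      congr 1
      rw [eq_iff_iff]
      exact ⟨fun h => by rw [h], ext_of_agreeOff h1⟩
    · rw [if_neg h1, if_neg]
      rintro rfl
      exact h1 fun _ _ => rfl
  | cons g U ih =>
    have : Circuit.map e (g :: U) = g.map e :: Circuit.map e U := rfl
    rw [this]
    simp only [Circuit.matrix, Matrix.mul_apply, ih, Gate.matrix_map]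
    simp_rw [mul_ite, mul_zero]
    rw [sum_agreeOff e y fun w =>
      (if AgreeOff e x w then Circuit.matrix U (x ∘ e) (w ∘ e) else 0) *
        g.matrix (w ∘ e) (y ∘ e)]
    simp_rw [overwrite_comp]
    have h : ∀ u, AgreeOff e x (overwrite e y u) ↔ AgreeOff e x y := fun u =>
      ⟨fun h => agreeOff_trans h (agreeOff_overwrite e y u),
        fun h => agreeOff_trans h (agreeOff_comm (agreeOff_overwrite e y u))⟩
    simp_rw [h]
    split_ifs
    · rfl
    · simp

theorem Circuit.matrix_append (U V : Circuit N) :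
    Circuit.matrix (U ++ V) = Circuit.matrix V * Circuit.matrix U := by
  induction U with
  | nil => simp [Circuit.matrix]
  | cons g U ih =>
    rw [List.cons_append]
    simp only [Circuit.matrix]
    rw [ih, Matrix.mul_assoc]

/-- The `j`-th block of `N` qubits. -/
def blockEmb (J N : ℕ) (j : Fin J) : Fin N ↪ Fin (J * N) :=
  ⟨fun i => finProdFinEquiv (j, i), fun i i' h => by
    simpa using finProdFinEquiv.injective h⟩

/-- The circuits `V j` on disjoint blocks of qubits. -/
def blockCircuit (J : ℕ) (V : ℕ → Circuit N) : Circuit (J * N) :=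
  (List.finRange J).flatMap fun j => Circuit.map (blockEmb J N j) (V j)

open Classical in
-- For the induction the circuit acts on a sublist of the blocks only; the others must still be 0.
-- Appending a block contributes one more factor to the amplitude.
theorem matrix_blocks {J : ℕ} (V : ℕ → Circuit N) (l : List (Fin J)) (hl : l.Nodup)
    (z : Fin (J * N) → Bool) :
    Circuit.matrix (l.flatMap fun j : Fin J => Circuit.map (blockEmb J N j) (V j)) z (fun _ => false) =
      if ∀ j, j ∉ l → ∀ i, z (blockEmb J N j i) = false then
        (l.map fun j : Fin J => Circuit.matrix (V j) (z ∘ blockEmb J N j) (fun _ => false)).prod else 0 := by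
  induction l using List.reverseRecOn generalizing z with
  | nil =>
    simp only [List.flatMap_nil, Circuit.matrix, Matrix.one_apply, List.not_mem_nil,
      not_false_eq_true, true_imp_iff, List.map_nil, List.prod_nil]
    congr 1
    rw [eq_iff_iff]
    refine ⟨fun h j i => by rw [h], fun h => funext fun k => ?_⟩
    have := h (finProdFinEquiv.symm k).1 (finProdFinEquiv.symm k).2
    rwa [show blockEmb J N (finProdFinEquiv.symm k).1 (finProdFinEquiv.symm k).2 = k from
      finProdFinEquiv.apply_symm_apply k] at this
  | append_singleton l j ih =>
    rw [List.nodup_append] at hl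
    have hj : j ∉ l := fun h => hl.2.2 j h j (by simp) rfl
    rw [List.flatMap_append, Circuit.matrix_append, Matrix.mul_apply]
    simp only [List.flatMap_cons, List.flatMap_nil, List.append_nil, ih hl.1, Circuit.matrix_map]
    set e := blockEmb J N j with he
    have hcomm : ∀ x, AgreeOff e z x ↔ AgreeOff e x z := fun x => ⟨agreeOff_comm, agreeOff_comm⟩
    simp_rw [hcomm, ite_mul, zero_mul]
    rw [sum_agreeOff e z fun x => Circuit.matrix (V j) (z ∘ e) (x ∘ e) *
      (if ∀ j, j ∉ l → ∀ i, x (blockEmb J N j i) = false then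
        (l.map fun j : Fin J => Circuit.matrix (V j) (x ∘ blockEmb J N j) (fun _ => false)).prod else 0)]
    simp_rw [overwrite_comp]
    have hother : ∀ u, ∀ k, k ≠ j → overwrite e z u ∘ blockEmb J N k = z ∘ blockEmb J N k := by
      intro u k hk
      funext i
      refine agreeOff_overwrite e z u _ fun i' h => hk ?_
      have := finProdFinEquiv.injective h
      simp only [Prod.mk.injEq] at this
      exact this.1.symm
    have hprod : ∀ u, (l.map fun k : Fin J => Circuit.matrix (V k) (overwrite e z u ∘ blockEmb J N k)
        (fun _ => false)) = l.map fun k : Fin J => Circuit.matrix (V k) (z ∘ blockEmb J N k)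
        (fun _ => false) := fun u => List.map_congr_left fun k hk => by
      rw [hother u k fun h => hj (h ▸ hk)]
    -- Block `j` is untouched by the circuits in `l`, so of all contents `u` that it could have
    -- before `V j` acts only the zero string contributes.
    have hcond : ∀ u, (∀ k, k ∉ l → ∀ i, overwrite e z u (blockEmb J N k i) = false) ↔
        u = (fun _ => false) ∧ ∀ k, k ∉ l ++ [j] → ∀ i, z (blockEmb J N k i) = false := by
      intro u
      constructor
      · intro h
        refine ⟨funext fun i => ?_, fun k hk i => ?_⟩
        · rw [← h j hj i]
          exact (congrFun (overwrite_comp e z u) i).symm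
        · have hk' : k ∉ l ∧ k ≠ j := by simpa using hk
          rw [← h k hk'.1 i]
          exact (congrFun (hother u k hk'.2) i).symm
      · rintro ⟨rfl, h⟩ k hk i
        by_cases hkj : k = j
        · subst hkj
          exact congrFun (overwrite_comp e z _) i
        · exact (congrFun (hother _ k hkj) i).trans (h k (by simp [hk, hkj]) i)
    simp_rw [hprod, hcond]
    by_cases hz : ∀ k, k ∉ l ++ [j] → ∀ i, z (blockEmb J N k i) = false
    · rw [if_pos hz, sum_eq_single (fun _ => false)]
      · rw [if_pos ⟨rfl, hz⟩, List.map_append, List.prod_append, List.map_singleton,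
          List.prod_singleton, mul_comm]
      · intro u _ hu
        rw [if_neg fun h => hu h.1, mul_zero]
      · exact fun h => absurd (mem_univ _) h
    · rw [if_neg hz]
      exact sum_eq_zero fun u _ => by rw [if_neg fun h => hz h.2, mul_zero]

/-- The outcomes of circuits on disjoint blocks of qubits are independent. -/
theorem prob_blockCircuit {J : ℕ} (V : ℕ → Circuit N) (z : Fin (J * N) → Bool) :
    prob (blockCircuit J V) z = ∏ j : Fin J, prob (V j) (z ∘ blockEmb J N j) := by
  rw [prob, blockCircuit, matrix_blocks V _ (List.nodup_finRange J), if_pos (by simp),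
    ← List.ofFn_eq_map, List.prod_ofFn, norm_prod, ← prod_pow]
  rfl

/-! ## Unitarity -/

theorem ClassicalGate.act_act (g : ClassicalGate N) (v : Fin N → Bool) : g.act (g.act v) = v := by
  rcases g with t | ⟨c, t, h⟩ | ⟨c, d, t, h₁, h₂, h₃⟩
  · simp [ClassicalGate.act]
  · simp [ClassicalGate.act, h]
  · simp [ClassicalGate.act, h₂, h₃]

theorem ClassicalGate.act_bijective (g : ClassicalGate N) : Function.Bijective g.act :=
  (show Function.Involutive g.act from g.act_act).bijective

/-- The bit string `x` with bit `i` flipped. -/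
def flipBit (i : Fin N) (x : Fin N → Bool) : Fin N → Bool := Function.update x i (!x i)

theorem flipBit_involutive (i : Fin N) : Function.Involutive (flipBit i) := fun x => by
  simp [flipBit]

theorem sum_flipBit {A : Type*} [AddCommMonoid A] (i : Fin N) (f : (Fin N → Bool) → A) :
    ∑ x, f (flipBit i x) = ∑ x, f x :=
  (Equiv.ofBijective _ (flipBit_involutive i).bijective).sum_comp f

theorem flipBit_ne (i : Fin N) (x : Fin N → Bool) : flipBit i x ≠ x := fun h => by
  have := congrFun h i
  simp [flipBit] at this

theorem eq_or_eq_flipBit {i : Fin N} {x y : Fin N → Bool} (h : ∀ j, j ≠ i → x j = y j) :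
    y = x ∨ y = flipBit i x := by
  by_cases hi : y i = x i
  · left
    funext j
    by_cases hj : j = i
    · rw [hj, hi]
    · exact (h j hj).symm
  · right
    funext j
    by_cases hj : j = i
    · subst hj
      simpa [flipBit, Bool.eq_not] using hi
    · simp [flipBit, hj, h j hj]

theorem had_mulVec (i : Fin N) (ψ : (Fin N → Bool) → ℂ) (x : Fin N → Bool) :
    ((Gate.had i).matrix.mulVec ψ) x =
      ((if x i then -1 else 1) * ψ x + ψ (flipBit i x)) / (Real.sqrt 2 : ℂ) := by
  have h := sum_subset (subset_univ {x, flipBit i x}) (f := fun y => (Gate.had i).matrix x y * ψ y)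
    (by
      intro y _ hy
      simp only [mem_insert, mem_singleton] at hy
      simp only [Gate.matrix, Matrix.of_apply]
      rw [if_neg fun h => hy (eq_or_eq_flipBit h), zero_mul])
  rw [Matrix.mulVec, dotProduct, ← h, sum_pair (flipBit_ne i x).symm]
  have hflip : ∀ j, j ≠ i → x j = flipBit i x j := fun j hj => by simp [flipBit, hj]
  simp only [Gate.matrix, Matrix.of_apply, implies_true, if_true, if_pos hflip]
  cases hx : x i <;> simp [flipBit, hx] <;> ring

/-- A Hadamard gate mixes only the amplitudes of `x` and of `x` with bit `i` flipped, and for each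
such pair the claim is the parallelogram law. A classical gate permutes the amplitudes. -/
theorem Gate.sum_norm_sq (g : Gate N) (ψ : (Fin N → Bool) → ℂ) :
    ∑ x, ‖(g.matrix.mulVec ψ) x‖ ^ 2 = ∑ x, ‖ψ x‖ ^ 2 := by
  rcases g with i | g
  · have key : ∀ x, ‖((Gate.had i).matrix.mulVec ψ) x‖ ^ 2 +
        ‖((Gate.had i).matrix.mulVec ψ) (flipBit i x)‖ ^ 2 = ‖ψ x‖ ^ 2 + ‖ψ (flipBit i x)‖ ^ 2 := by
      intro x
      have hf : flipBit i x i = !x i := by simp [flipBit]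
      have hs : ‖(Real.sqrt 2 : ℂ)‖ ^ 2 = 2 := by
        rw [Complex.norm_real, Real.norm_eq_abs, sq_abs, Real.sq_sqrt (by norm_num)]
      rw [had_mulVec, had_mulVec, flipBit_involutive, hf, norm_div, norm_div, div_pow, div_pow, hs]
      have hp := parallelogram_law_with_norm ℝ (ψ x) (ψ (flipBit i x))
      cases hx : x i
      · have e1 : (if false = true then (-1 : ℂ) else 1) * ψ x + ψ (flipBit i x) =
          ψ x + ψ (flipBit i x) := by simp
        have e2 : (if (!false) = true then (-1 : ℂ) else 1) * ψ (flipBit i x) + ψ x =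
          ψ x - ψ (flipBit i x) := by simp; ring
        rw [e1, e2]
        linarith
      · have e1 : (if true = true then (-1 : ℂ) else 1) * ψ x + ψ (flipBit i x) =
          -(ψ x - ψ (flipBit i x)) := by simp; ring
        have e2 : (if (!true) = true then (-1 : ℂ) else 1) * ψ (flipBit i x) + ψ x =
          ψ x + ψ (flipBit i x) := by simp; ring
        rw [e1, e2, norm_neg]
        linarith
    have h1 : ∑ x, (‖((Gate.had i).matrix.mulVec ψ) x‖ ^ 2 +
        ‖((Gate.had i).matrix.mulVec ψ) (flipBit i x)‖ ^ 2) =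
        ∑ x, (‖ψ x‖ ^ 2 + ‖ψ (flipBit i x)‖ ^ 2) := sum_congr rfl fun x _ => key x
    rw [sum_add_distrib, sum_add_distrib,
      sum_flipBit i fun x => ‖((Gate.had i).matrix.mulVec ψ) x‖ ^ 2,
      sum_flipBit i fun x => ‖ψ x‖ ^ 2] at h1
    linarith
  · have : ∀ x, ((Gate.classical g).matrix.mulVec ψ) x = ψ (g.act x) := by
      intro x
      simp only [Gate.matrix, Matrix.mulVec, dotProduct, Matrix.of_apply, ite_mul, one_mul,
        zero_mul]
      rw [sum_eq_single (g.act x)]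
      · rw [if_pos (g.act_act x).symm]
      · intro y _ hy
        rw [if_neg]
        rintro rfl
        exact hy (g.act_act y).symm
      · simp
    simp_rw [this]
    exact (Equiv.ofBijective _ g.act_bijective).sum_comp fun x => ‖ψ x‖ ^ 2

theorem Circuit.sum_norm_sq (U : Circuit N) (ψ : (Fin N → Bool) → ℂ) :
    ∑ x, ‖((Circuit.matrix U).mulVec ψ) x‖ ^ 2 = ∑ x, ‖ψ x‖ ^ 2 := by
  induction U generalizing ψ with
  | nil => simp [Circuit.matrix]
  | cons g U ih =>
    rw [Circuit.matrix, ← Matrix.mulVec_mulVec, ih, g.sum_norm_sq]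

theorem sum_prob (U : Circuit N) : ∑ z, prob U z = 1 := by
  have h := U.sum_norm_sq (Pi.single (fun _ => false) 1)
  simp only [Matrix.mulVec_single_one] at h
  rw [show ∑ z, prob U z = ∑ x, ‖(Circuit.matrix U).col (fun _ => false) x‖ ^ 2 from rfl, h,
    sum_eq_single (fun _ => false)]
  · simp
  · intro x _ hx
    simp [hx]
  · simp

theorem prob_nonneg (U : Circuit N) (z : Fin N → Bool) : 0 ≤ prob U z := sq_nonneg _

/-! ## The output probabilities of HC1Q circuits -/

/-- Induction on the list: each further Hadamard gate adds its sign and a factor `1 / √2`, and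
between two gates there is only one possible intermediate string. -/
theorem matrix_had_list (l : List (Fin N)) (hl : l.Nodup) (z x : Fin N → Bool) :
    Circuit.matrix (l.map Gate.had) z x = if ∀ j, j ∉ l → z j = x j then
      (l.map fun i => if z i && x i then (-1 : ℂ) else 1).prod / (Real.sqrt 2 : ℂ) ^ l.length
    else 0 := by
  induction l generalizing x with
  | nil =>
    simp only [List.map_nil, Circuit.matrix, Matrix.one_apply, List.not_mem_nil, not_false_eq_true,
      true_imp_iff, List.prod_nil, List.length_nil, pow_zero, div_one]
    congr 1
    rw [eq_iff_iff]
    exact ⟨fun h j => by rw [h], funext⟩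
  | cons i l ih =>
    rw [List.nodup_cons] at hl
    rw [List.map_cons]
    simp only [Circuit.matrix, Matrix.mul_apply]
    -- The first gate changes only bit `i`, and the later ones do not touch it, so the intermediate
    -- string is `x` with the final bit `z i`.
    rw [sum_eq_single (Function.update x i (z i))]
    · rw [ih hl.2]
      simp only [Gate.matrix, Matrix.of_apply]
      have hup : ∀ j, j ≠ i → Function.update x i (z i) j = x j :=
        fun j hj => Function.update_of_ne hj _ _
      rw [if_pos hup]
      have hcond : (∀ j, j ∉ l → z j = Function.update x i (z i) j) ↔
          ∀ j, j ∉ i :: l → z j = x j := by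
        constructor
        · intro h j hj
          simp only [List.mem_cons, not_or] at hj
          rw [h j hj.2, Function.update_of_ne hj.1]
        · intro h j hj
          by_cases hji : j = i
          · rw [hji, Function.update_self]
          · rw [Function.update_of_ne hji]
            exact h j (by simp [hj, hji])
      simp_rw [hcond]
      by_cases h : ∀ j, j ∉ i :: l → z j = x j
      · have hprod : (l.map fun k => if z k && Function.update x i (z i) k then (-1 : ℂ) else 1) =
            l.map fun k => if z k && x k then (-1 : ℂ) else 1 :=
          List.map_congr_left fun k hk => by
            rw [Function.update_of_ne]
            rintro rfl
            exact hl.1 hk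
        rw [if_pos h, if_pos h, hprod, Function.update_self, List.map_cons, List.prod_cons, List.length_cons, pow_succ]
        ring
      · rw [if_neg h, if_neg h, zero_mul]
    · intro w _ hw
      by_cases h : ∀ j, j ≠ i → w j = x j
      · rw [ih hl.2, if_neg, zero_mul]
        intro h'
        apply hw
        funext j
        by_cases hji : j = i
        · rw [hji, Function.update_self, h' i hl.1]
        · rw [Function.update_of_ne hji, h j hji]
      · simp only [Gate.matrix, Matrix.of_apply]
        rw [if_neg h, mul_zero]
    · simp

/-- The bit string `x` is `0` at the last position. -/
def LastFalse (x : Fin N → Bool) : Prop := ∀ i : Fin N, i.val + 1 = N → x i = false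

instance (x : Fin N → Bool) : Decidable (LastFalse x) :=
  inferInstanceAs (Decidable (∀ i : Fin N, i.val + 1 = N → x i = false))

theorem nodup_filter_finRange :
    ((List.finRange N).filter fun i => i.val + 1 < N).Nodup := (List.nodup_finRange N).filter _

theorem matrix_hadLayer (z x : Fin N → Bool) :
    Circuit.matrix (hadLayer N) z x = if SameLast z x then
      (∏ i : Fin N with i.val + 1 < N, if z i && x i then (-1 : ℂ) else 1) /
        (Real.sqrt 2 : ℂ) ^ (N - 1)
    else 0 := by
  rw [hadLayer, matrix_had_list _ nodup_filter_finRange]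
  have h1 : (∀ j, j ∉ (List.finRange N).filter (fun i => decide (i.val + 1 < N)) → z j = x j) ↔
      SameLast z x := by
    refine forall_congr' fun j => ?_
    have := j.isLt
    simp only [List.mem_filter, List.mem_finRange, true_and, decide_eq_true_eq]
    rw [show ¬ (j.val + 1 < N) ↔ j.val + 1 = N by omega]
  have hfs : ((List.finRange N).filter fun i => decide (i.val + 1 < N)).toFinset =
      univ.filter fun i : Fin N => i.val + 1 < N := by
    ext i
    simp
  have hlen : ((List.finRange N).filter fun i => decide (i.val + 1 < N)).length = N - 1 := by
    rw [← List.toFinset_card_of_nodup nodup_filter_finRange, hfs]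
    rcases N with _ | n
    · rfl
    · have : (univ.filter fun i : Fin (n + 1) => i.val + 1 < n + 1) = univ.erase (Fin.last n) := by
        ext i
        simp only [mem_filter, mem_univ, true_and, mem_erase, and_true, ne_eq, Fin.ext_iff,
          Fin.val_last]
        omega
      rw [this, card_erase_of_mem (mem_univ _), card_univ, Fintype.card_fin]
  simp only [h1, hlen]
  rw [← List.prod_toFinset _ nodup_filter_finRange, hfs]

/-- Each string ending in 0 arises from two strings by clearing the last bit. Thus the sum over
initial strings becomes an average over `N` uniform bits. -/
theorem sum_clearLast (hN : 1 ≤ N) (g : (Fin N → Bool) → ℂ) :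
    ∑ x, g (clearLast x) = 2 * ∑ x, if LastFalse x then g x else 0 := by
  set k : Fin N := ⟨N - 1, by omega⟩ with hk
  have hlast : ∀ i : Fin N, i.val + 1 = N ↔ i = k := fun i => by
    rw [hk, Fin.ext_iff]
    simp only
    omega
  have hlt : ∀ i : Fin N, i.val + 1 < N ↔ i ≠ k := fun i => by
    have := i.isLt
    rw [hk, Ne, Fin.ext_iff]
    simp only
    omega
  have hLF : ∀ x : Fin N → Bool, LastFalse x ↔ x k = false := fun x => by
    simp only [LastFalse, hlast, forall_eq]
  have hcl : ∀ x : Fin N → Bool, clearLast x = Function.update x k false := fun x => by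
    funext i
    by_cases hi : i = k
    · subst hi
      simp [clearLast, hlt]
    · simp [clearLast, hlt, hi]
  have key : ∀ x, g (clearLast x) = (if LastFalse x then g x else 0) +
      (if LastFalse (flipBit k x) then g (flipBit k x) else 0) := by
    intro x
    simp only [hLF, hcl]
    cases hx : x k
    · have : Function.update x k false = x := by rw [← hx, Function.update_eq_self]
      simp [flipBit, hx, this]
    · simp [flipBit, hx]
  rw [sum_congr rfl fun x _ => key x, sum_add_distrib,
    sum_flipBit k fun x => if LastFalse x then g x else 0, two_mul]

theorem matrix_classical (C : List (ClassicalGate N)) (x y : Fin N → Bool) :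
    Circuit.matrix (C.map Gate.classical) x y =
      if x = Circuit.actBits (C.map Gate.classical) y then 1 else 0 := by
  induction C generalizing y with
  | nil => simp [Circuit.matrix, Circuit.actBits, Matrix.one_apply]
  | cons g C ih =>
    rw [List.map_cons]
    simp only [Circuit.matrix, Matrix.mul_apply, ih]
    rw [sum_eq_single (g.act y)]
    · rw [show (Gate.classical g).matrix (g.act y) y = 1 by simp [Gate.matrix], mul_one]
      rfl
    · intro w _ hw
      simp [Gate.matrix, hw]
    · simp

theorem actBits_append (U V : Circuit N) (x : Fin N → Bool) :
    Circuit.actBits (U ++ V) x = V.actBits (U.actBits x) := by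
  simp [Circuit.actBits, List.foldl_append]

theorem actBits_map_had (l : List (Fin N)) (x : Fin N → Bool) :
    Circuit.actBits (l.map Gate.had) x = x := by
  induction l with
  | nil => rfl
  | cons i l ih => exact ih

theorem neg_one_pow_overlap (y z : Fin N → Bool) :
    (-1 : ℂ) ^ overlap y z = ∏ i, if z i && y i then (-1 : ℂ) else 1 := by
  rw [overlap, ← prod_pow_eq_pow_sum]
  refine prod_congr rfl fun i _ => ?_
  cases y i <;> cases z i <;> simp

/-- The amplitude of an outcome of an HC1Q circuit is, up to a sign, an average of path signs. -/
theorem prob_eq_of_isHC1Q {U : Circuit N} (hU : IsHC1Q N U) (z : Fin N → Bool) :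
    prob U z = ((∑ x, (pathSign U z x : ℝ)) / 2 ^ N) ^ 2 := by
  obtain ⟨hN, C, rfl⟩ := hU
  -- The last qubit carries no Hadamard gate, but `overlap` counts its position too. On paths that
  -- contribute, the last bits agree, and the discrepancy is the sign `τ`, which depends only on `z`
  -- and disappears in the modulus.
  set τ : ℂ := ∏ i : Fin N with ¬ (i.val + 1 < N), if z i then (-1 : ℂ) else 1 with hτ
  have hτn : ‖τ‖ = 1 := by
    rw [hτ, norm_prod]
    refine prod_eq_one fun i _ => ?_
    split_ifs <;> simp
  have hact : ∀ x, Circuit.actBits (hadLayer N ++ C.map Gate.classical ++ hadLayer N) x =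
      Circuit.actBits (C.map Gate.classical) x := by
    intro x
    rw [actBits_append, actBits_append, hadLayer, actBits_map_had, actBits_map_had]
  have hsq : (Real.sqrt 2 : ℂ) ^ (N - 1) * (Real.sqrt 2 : ℂ) ^ (N - 1) = 2 ^ (N - 1) := by
    rw [← mul_pow, ← Complex.ofReal_mul, Real.mul_self_sqrt (by norm_num)]
    norm_num
  have hinit : ∀ x : Fin N → Bool, Circuit.matrix (hadLayer N) x (fun _ => false) =
      if LastFalse x then 1 / (Real.sqrt 2 : ℂ) ^ (N - 1) else 0 := by
    intro x
    rw [matrix_hadLayer]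
    simp [SameLast, LastFalse]
  have hsign : ∀ y, Circuit.matrix (hadLayer N) z y =
      τ * (if SameLast y z then (-1 : ℂ) ^ overlap y z else 0) / (Real.sqrt 2 : ℂ) ^ (N - 1) := by
    intro y
    rw [matrix_hadLayer]
    have hcomm : SameLast z y ↔ SameLast y z :=
      ⟨fun h i hi => (h i hi).symm, fun h i hi => (h i hi).symm⟩
    simp only [hcomm]
    by_cases h : SameLast y z
    · rw [if_pos h, if_pos h, neg_one_pow_overlap,
        ← prod_filter_mul_prod_filter_not univ (fun i : Fin N => i.val + 1 < N)]
      have : (∏ i : Fin N with ¬ (i.val + 1 < N), if z i && y i then (-1 : ℂ) else 1) = τ := by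
        refine prod_congr rfl fun i hi => ?_
        have hi' := i.isLt
        rw [h i (by have := (mem_filter.1 hi).2; omega), Bool.and_self]
      have hττ : τ * τ = 1 := by
        rw [hτ, ← prod_mul_distrib]
        refine prod_eq_one fun i _ => ?_
        split_ifs <;> simp
      rw [this]
      congr 1
      linear_combination -(∏ i : Fin N with i.val + 1 < N, if z i && y i then (-1 : ℂ) else 1) * hττ
    · simp [h]
  have hamp : Circuit.matrix (hadLayer N ++ C.map Gate.classical ++ hadLayer N) z
      (fun _ => false) = τ * ((∑ x, (pathSign (hadLayer N ++ C.map Gate.classical ++ hadLayer N)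
        z x : ℂ)) / 2 ^ N) := by
    obtain ⟨G, hG⟩ : ∃ G : (Fin N → Bool) → ℂ, ∀ x, G x =
        if SameLast (Circuit.actBits (C.map Gate.classical) x) z then
          (-1 : ℂ) ^ overlap (Circuit.actBits (C.map Gate.classical) x) z else 0 :=
      ⟨_, fun _ => rfl⟩
    have h1 : Circuit.matrix (hadLayer N ++ C.map Gate.classical ++ hadLayer N) z
        (fun _ => false) = ∑ x, if LastFalse x then
          τ * G x / 2 ^ (N - 1) else 0 := by
      rw [Circuit.matrix_append, Circuit.matrix_append, ← Matrix.mul_assoc, Matrix.mul_apply]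
      refine sum_congr rfl fun x _ => ?_
      rw [hinit, Matrix.mul_apply, sum_eq_single (Circuit.actBits (C.map Gate.classical) x)]
      · rw [matrix_classical, if_pos rfl, mul_one, hsign, ← hG]
        by_cases hx : LastFalse x
        · rw [if_pos hx, if_pos hx, div_mul_div_comm, hsq, mul_one]
        · rw [if_neg hx, if_neg hx, mul_zero]
      · intro w _ hw
        rw [matrix_classical, if_neg hw, mul_zero]
      · exact fun h => absurd (mem_univ _) h
    have h2 : ∑ x, (pathSign (hadLayer N ++ C.map Gate.classical ++ hadLayer N) z x : ℂ) =
        ∑ x, G (clearLast x) := by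
      refine sum_congr rfl fun x _ => ?_
      simp only [pathSign, hact, hG]
      split_ifs <;> push_cast <;> rfl
    -- The two layers together give `1 / 2 ^ (N - 1)`; the missing factor 2 is the multiplicity from
    -- `sum_clearLast`.
    have h3 : (2 : ℂ) ^ N = 2 * 2 ^ (N - 1) := by
      rw [← pow_succ', Nat.sub_add_cancel hN]
    rw [h1, h2, sum_clearLast hN, h3, mul_div_mul_left _ _ two_ne_zero, sum_div, mul_sum]
    refine sum_congr rfl fun x _ => ?_
    split_ifs <;> simp [mul_div_assoc]
  rw [prob, hamp, norm_mul, hτn, one_mul]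
  have : (∑ x, (pathSign (hadLayer N ++ C.map Gate.classical ++ hadLayer N) z x : ℂ)) / 2 ^ N =
      (((∑ x, (pathSign (hadLayer N ++ C.map Gate.classical ++ hadLayer N) z x : ℝ)) / 2 ^ N : ℝ) :
        ℂ) := by
    push_cast
    rfl
  rw [this, Complex.norm_real, Real.norm_eq_abs, sq_abs]

end HC1Q

namespace HC1Q

open Finset

/-! ## Concentration of the estimate -/

/-- The variance of a sum of independent variables is additive. In the induction one coordinate is
split off, and the cross term vanishes because `g` has mean 0. -/
theorem sum_pi_sq_le {Ω : Type*} [Fintype Ω] (g : Ω → ℝ) (hg : ∑ b, g b = 0) {B : ℝ}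
    (hB : ∑ b, g b ^ 2 ≤ B * Fintype.card Ω) (T : ℕ) :
    ∑ ω : Fin T → Ω, (∑ t, g (ω t)) ^ 2 ≤ T * B * (Fintype.card Ω : ℝ) ^ T := by
  induction T with
  | zero => simp
  | succ T ih =>
    have h1 : ∑ ω : Fin (T + 1) → Ω, (∑ t, g (ω t)) ^ 2 =
        ∑ b, ∑ ω : Fin T → Ω, (g b + ∑ t, g (ω t)) ^ 2 := by
      rw [← Fintype.sum_prod_type', ← (Fin.consEquiv fun _ => Ω).sum_comp]
      refine sum_congr rfl fun x _ => ?_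
      rw [Fin.sum_univ_succ]
      simp [Fin.consEquiv]
    have h2 : ∀ b, ∑ ω : Fin T → Ω, (g b + ∑ t, g (ω t)) ^ 2 =
        (Fintype.card Ω : ℝ) ^ T * g b ^ 2 + g b * (2 * ∑ ω : Fin T → Ω, ∑ t, g (ω t)) +
          ∑ ω : Fin T → Ω, (∑ t, g (ω t)) ^ 2 := by
      intro b
      simp_rw [add_sq]
      rw [sum_add_distrib, sum_add_distrib, sum_const, card_univ, Fintype.card_fun,
        Fintype.card_fin, nsmul_eq_mul, mul_sum, mul_sum]
      push_cast
      congr 2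
      exact sum_congr rfl fun ω _ => by ring
    rw [h1, sum_congr rfl fun b _ => h2 b, sum_add_distrib, sum_add_distrib, ← mul_sum, ← sum_mul,
      hg, zero_mul, add_zero, sum_const, card_univ, nsmul_eq_mul]
    have h3 : (Fintype.card Ω : ℝ) ^ T * ∑ b, g b ^ 2 ≤
      (Fintype.card Ω : ℝ) ^ T * (B * Fintype.card Ω) := by gcongr
    have h4 : (Fintype.card Ω : ℝ) * ∑ ω : Fin T → Ω, (∑ t, g (ω t)) ^ 2 ≤
      Fintype.card Ω * (T * B * (Fintype.card Ω : ℝ) ^ T) := by gcongr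
    push_cast
    rw [pow_succ]
    linarith

/-- Restricting uniformly random bits to some positions gives uniformly random bits. -/
theorem sum_comp_embedding {ι κ : Type*} [Fintype ι] [Fintype κ] [DecidableEq ι] [DecidableEq κ]
    (e : ι ↪ κ) (F : (ι → Bool) → ℝ) :
    2 ^ Fintype.card ι * ∑ r : κ → Bool, F (r ∘ e) = 2 ^ Fintype.card κ * ∑ u, F u := by
  -- Adding to `r` modulo 2 the extension of `u` by zeros is a bijection, so the sum does not
  -- change. Averaging over all `u` then makes the restricted string uniform whatever `r` is.
  have h1 : ∀ u : ι → Bool, ∑ r : κ → Bool, F (r ∘ e) =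
      ∑ r : κ → Bool, F fun i => r (e i) ^^ u i := by
    intro u
    have hinv : Function.Involutive fun (r : κ → Bool) k =>
        r k ^^ Function.extend e u (fun _ => false) k := fun r => by
      funext k
      simp
    rw [← (Equiv.ofBijective _ hinv.bijective).sum_comp]
    refine sum_congr rfl fun r _ => ?_
    congr 1
    funext i
    simp [e.injective.extend_apply]
  have h2 : ∀ r : κ → Bool, ∑ u : ι → Bool, F (fun i => r (e i) ^^ u i) = ∑ u, F u := by
    intro r
    have hinv : Function.Involutive fun (u : ι → Bool) i => r (e i) ^^ u i := fun u => by
      funext i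
      simp
    exact (Equiv.ofBijective _ hinv.bijective).sum_comp F
  calc 2 ^ Fintype.card ι * ∑ r : κ → Bool, F (r ∘ e)
      = ∑ u : ι → Bool, ∑ r : κ → Bool, F (r ∘ e) := by
        rw [sum_const, card_univ, Fintype.card_fun, Fintype.card_bool, nsmul_eq_mul]
        push_cast
        rfl
    _ = ∑ r : κ → Bool, ∑ u : ι → Bool, F (fun i => r (e i) ^^ u i) := by
        rw [sum_congr rfl fun u _ => h1 u, sum_comm]
    _ = 2 ^ Fintype.card κ * ∑ u, F u := by
        rw [sum_congr rfl fun r _ => h2 r, sum_const, card_univ, Fintype.card_fun,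
          Fintype.card_bool, nsmul_eq_mul]
        push_cast
        rfl

/-- The positions of the random bits that are used for the samples. -/
def sampleEmb {N T R : ℕ} (h : 2 * N * T ≤ R) : Fin T × (Fin N ⊕ Fin N) ↪ Fin R where
  toFun x := ⟨2 * N * x.1 + Sum.elim (fun i => i.val) (fun i => N + i.val) x.2, by
    obtain ⟨t, i⟩ := x
    have h1 : 2 * N * (t + 1) ≤ 2 * N * T := Nat.mul_le_mul_left _ t.isLt
    have h2 : 2 * N * (t + 1) = 2 * N * t + 2 * N := by ring
    rcases i with i | i <;>
    · have := i.isLt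
      simp only [Sum.elim_inl, Sum.elim_inr]
      omega⟩
  inj' := by
    rintro ⟨t, i⟩ ⟨t', i'⟩ h
    simp only [Fin.mk.injEq] at h
    have hlt : ∀ i : Fin N ⊕ Fin N, Sum.elim (fun i => i.val) (fun i => N + i.val) i < 2 * N := by
      rintro (i | i) <;>
      · have := i.isLt
        simp only [Sum.elim_inl, Sum.elim_inr]
        omega
    have hpos : 0 < 2 * N := (Nat.zero_le _).trans_lt (hlt i)
    have ht : t = t' := by
      have := congrArg (· / (2 * N)) h
      simp only [Nat.mul_add_div hpos, Nat.div_eq_of_lt (hlt _), add_zero] at this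
      exact Fin.ext this
    subst ht
    have hi := Nat.add_left_cancel h
    rcases i with i | i <;> rcases i' with i' | i' <;>
    · have := i.isLt
      have := i'.isLt
      simp only [Sum.elim_inl, Sum.elim_inr] at hi
      first
        | (exfalso; omega)
        | (congr 2; exact Fin.ext (by omega))

theorem abs_pathSign_le {N : ℕ} (U : Circuit N) (z x : Fin N → Bool) : |pathSign U z x| ≤ 1 := by
  rw [pathSign]
  split_ifs <;> simp [abs_pow]

theorem abs_sampleValue_le (I : Instance) (z x x' : Fin I.N → Bool) :
    |sampleValue I z x x'| ≤ 2 := by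
  have h : ∀ U : Circuit I.N, |pathSign U z x * pathSign U z x'| ≤ 1 := fun U => by
    rw [abs_mul]
    exact mul_le_one₀ (abs_pathSign_le _ _ _) (abs_nonneg _) (abs_pathSign_le _ _ _)
  have h1 := abs_le.1 (h I.U₁)
  have h2 := abs_le.1 (h I.U₂)
  rw [sampleValue, abs_le]
  constructor <;> linarith [h1.1, h1.2, h2.1, h2.2]

/-- For independent strings the sum of the products of signs factors into the square of the sum of
signs, which is the probability up to normalization. -/
theorem sum_sampleValue {I : Instance} (h₁ : IsHC1Q I.N I.U₁) (h₂ : IsHC1Q I.N I.U₂)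
    (z : Fin I.N → Bool) :
    ∑ b : (Fin I.N → Bool) × (Fin I.N → Bool), (sampleValue I z b.1 b.2 : ℝ) =
      (2 ^ I.N) ^ 2 * (prob I.U₁ z - prob I.U₂ z) := by
  rw [prob_eq_of_isHC1Q h₁, prob_eq_of_isHC1Q h₂, div_pow, div_pow, ← sub_div,
    mul_div_cancel₀ _ (by positivity), Fintype.sum_prod_type]
  simp only [sampleValue]
  push_cast
  simp_rw [sum_sub_distrib, ← mul_sum, ← sum_mul]
  ring

theorem window_ofFn {R N o : ℕ} (r : Fin R → Bool) (i : Fin N) (h : o + i < R) :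
    window (List.ofFn r) o N i = r ⟨o + i, h⟩ := by
  rw [window, List.getD_eq_getElem _ _ (by simpa using h), List.getElem_ofFn]

/-- The variance of the estimate. -/
theorem sum_estimate_sq_le {I : Instance} (h₁ : IsHC1Q I.N I.U₁) (h₂ : IsHC1Q I.N I.U₂)
    (z : Fin I.N → Bool) {T R : ℕ} (hR : 2 * I.N * T ≤ R) :
    ∑ r : Fin R → Bool,
      ((estimate I z (List.ofFn r) T : ℝ) - T * (prob I.U₁ z - prob I.U₂ z)) ^ 2 ≤
      4 * T * 2 ^ R := by
  set Δ := prob I.U₁ z - prob I.U₂ z with hΔ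
  set g : (Fin I.N → Bool) × (Fin I.N → Bool) → ℝ := fun b => sampleValue I z b.1 b.2 - Δ with hg
  have hcard : (Fintype.card ((Fin I.N → Bool) × (Fin I.N → Bool)) : ℝ) = (2 ^ I.N) ^ 2 := by
    simp [sq]
  have hg0 : ∑ b, g b = 0 := by
    rw [hg, sum_sub_distrib, sum_sampleValue h₁ h₂, sum_const, card_univ, nsmul_eq_mul, hcard]
    ring
  have hg2 : ∑ b, g b ^ 2 ≤
      4 * Fintype.card ((Fin I.N → Bool) × (Fin I.N → Bool)) := by
    -- As `g` is centred, its second moment is that of the sample value minus `Δ ^ 2`. The sample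
    -- value is at most 2 in modulus, hence the bound 4.
    have h : ∀ b, g b ^ 2 = (sampleValue I z b.1 b.2 : ℝ) ^ 2 - 2 * Δ * g b - Δ ^ 2 := fun b => by
      simp only [hg]
      ring
    rw [sum_congr rfl fun b _ => h b, sum_sub_distrib, sum_sub_distrib, ← mul_sum, hg0, sum_const,
      card_univ, nsmul_eq_mul]
    have h4 : ∑ b : (Fin I.N → Bool) × (Fin I.N → Bool), (sampleValue I z b.1 b.2 : ℝ) ^ 2 ≤
        ∑ _b : (Fin I.N → Bool) × (Fin I.N → Bool), 4 := by
      refine sum_le_sum fun b _ => ?_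
      have := abs_sampleValue_le I z b.1 b.2
      have h2 : |(sampleValue I z b.1 b.2 : ℝ)| ≤ 2 := by exact_mod_cast this
      have := abs_le.1 h2
      nlinarith [this.1, this.2]
    rw [sum_const, card_univ, nsmul_eq_mul] at h4
    have h5 : (0 : ℝ) ≤ Fintype.card ((Fin I.N → Bool) × (Fin I.N → Bool)) * Δ ^ 2 := by positivity
    linarith
  set G : (Fin T × (Fin I.N ⊕ Fin I.N) → Bool) → ℝ := fun u =>
    (∑ t, g (fun i => u (t, Sum.inl i), fun i => u (t, Sum.inr i))) ^ 2 with hG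
  have hest : ∀ r : Fin R → Bool,
      ((estimate I z (List.ofFn r) T : ℝ) - T * Δ) ^ 2 = G (r ∘ sampleEmb hR) := by
    intro r
    simp only [hG, hg, estimate]
    rw [sum_sub_distrib, sum_const, card_univ, Fintype.card_fin, nsmul_eq_mul,
      Finset.sum_range]
    push_cast
    congr 2
    refine sum_congr rfl fun t _ => ?_
    congr 2
    · funext i
      exact window_ofFn r i (sampleEmb hR (t, Sum.inl i)).isLt
    · funext i
      have h := (sampleEmb hR (t, Sum.inr i)).isLt
      have e : ((sampleEmb hR (t, Sum.inr i)) : Fin R).val = 2 * I.N * t + I.N + i :=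
        (add_assoc _ _ _).symm
      rw [window_ofFn r i (e ▸ h)]
      exact congrArg r (Fin.ext e.symm)
  -- The bits used by the samples are regrouped as `T` independent pairs of strings.
  have hsum : ∑ u, G u = ∑ ω : Fin T → (Fin I.N → Bool) × (Fin I.N → Bool), (∑ t, g (ω t)) ^ 2 := by
    rw [← ((Equiv.curry (Fin T) (Fin I.N ⊕ Fin I.N) Bool).trans
      (Equiv.piCongrRight fun _ => Equiv.sumArrowEquivProdArrow _ _ _)).sum_comp]
    rfl
  have hmarg := sum_comp_embedding (sampleEmb hR) G
  have hpi := sum_pi_sq_le g hg0 hg2 T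
  rw [sum_congr rfl fun r _ => hest r]
  rw [← hsum, hcard] at hpi
  have hc : (2 : ℝ) ^ Fintype.card (Fin T × (Fin I.N ⊕ Fin I.N)) = ((2 ^ I.N) ^ 2) ^ T := by
    rw [Fintype.card_prod, Fintype.card_sum, Fintype.card_fin, Fintype.card_fin, ← pow_mul,
      ← pow_mul]
    congr 1
    ring
  rw [hc, Fintype.card_fin] at hmarg
  have hpos : (0 : ℝ) < ((2 ^ I.N) ^ 2) ^ T := by positivity
  have h6 : (2 : ℝ) ^ R * ∑ u, G u ≤ 2 ^ R * (T * 4 * ((2 ^ I.N) ^ 2) ^ T) := by gcongr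
  refine le_of_mul_le_mul_left ?_ hpos
  rw [hmarg]
  linarith

/-- Chebyshev's inequality for the estimate. -/
theorem card_deviation_le {I : Instance} (h₁ : IsHC1Q I.N I.U₁) (h₂ : IsHC1Q I.N I.U₂)
    (z : Fin I.N → Bool) {T R : ℕ} (hT : 0 < T) (hR : 2 * I.N * T ≤ R) {P δ : ℝ} (hδ : 0 < δ)
    (hP : 1 ≤ P * δ) (S : Finset (Fin R → Bool))
    (hS : ∀ r ∈ S, T * δ ≤
      2 * |(estimate I z (List.ofFn r) T : ℝ) - T * (prob I.U₁ z - prob I.U₂ z)|) :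
    (S.card : ℝ) * T ≤ 16 * P ^ 2 * 2 ^ R := by
  have hT' : (0 : ℝ) < T := by exact_mod_cast hT
  have h1 := sum_estimate_sq_le h₁ h₂ z hR
  have h2 : ∑ r ∈ S, (T * δ) ^ 2 ≤ ∑ r ∈ S,
      4 * ((estimate I z (List.ofFn r) T : ℝ) - T * (prob I.U₁ z - prob I.U₂ z)) ^ 2 := by
    refine sum_le_sum fun r hr => ?_
    have h3 := pow_le_pow_left₀ (by positivity) (hS r hr) 2
    rw [mul_pow 2, sq_abs] at h3
    linarith
  rw [sum_const, nsmul_eq_mul, ← mul_sum] at h2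
  have h3 : ∑ r ∈ S,
      ((estimate I z (List.ofFn r) T : ℝ) - T * (prob I.U₁ z - prob I.U₂ z)) ^ 2 ≤ 4 * T * 2 ^ R :=
    (sum_le_univ_sum_of_nonneg fun r => sq_nonneg _).trans h1
  -- The deviations give `S.card * (T * δ) ^ 2 ≤ 4 * (4 * T * 2 ^ R)`. After cancelling `T`, the
  -- hypothesis `1 ≤ P * δ` trades `δ` for `P`.
  have h4 : (T : ℝ) * (S.card * T * δ ^ 2) ≤ T * (16 * 2 ^ R) := by nlinarith
  have h5 := le_of_mul_le_mul_left h4 hT'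
  have h6 : (1 : ℝ) ≤ (P * δ) ^ 2 := one_le_pow₀ hP
  calc (S.card : ℝ) * T ≤ S.card * T * (P * δ) ^ 2 := le_mul_of_one_le_right (by positivity) h6
    _ = P ^ 2 * (S.card * T * δ ^ 2) := by ring
    _ ≤ P ^ 2 * (16 * 2 ^ R) := by gcongr
    _ = _ := by ring

theorem cast_natAbs_num {a : ℚ} (ha : 0 ≤ a) : (a.num.natAbs : ℝ) = a * a.den := by
  have h1 : (a.num.natAbs : ℝ) = (a.num : ℝ) := by
    rw [Nat.cast_natAbs, abs_of_nonneg (Rat.num_nonneg.2 ha)]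
  rw [h1]
  have := Rat.mul_den_eq_num a
  exact_mod_cast this.symm

/-- Dividing by the two denominators returns the integer test to its meaning: the modulus of the
mean estimate is at least `(a + b) / 2`. -/
theorem passes_iff {I : Instance} (ha : 0 ≤ I.a) (hb : 0 ≤ I.b) (r : List Bool) (T : ℕ)
    (z : Fin I.N → Bool) :
    Passes I r T z ↔ T * ((I.a : ℝ) + I.b) ≤ 2 * |(estimate I z r T : ℝ)| := by
  have h1 : (0 : ℝ) < I.a.den := by exact_mod_cast I.a.den_pos
  have h2 : (0 : ℝ) < I.b.den := by exact_mod_cast I.b.den_pos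
  rw [Passes, ← Nat.cast_le (α := ℝ)]
  push_cast
  rw [cast_natAbs_num ha, cast_natAbs_num hb, Nat.cast_natAbs, Int.cast_abs]
  refine Iff.trans ?_ (mul_le_mul_iff_of_pos_right (mul_pos h1 h2))
  constructor <;> intro h <;> linarith

end HC1Q

namespace HC1Q

open Finset

/-! ## The output of the generator on instances -/

theorem flatMap_range_two_mul {α : Type*} (F : ℕ → List α) (K : ℕ) :
    (List.range (2 * K)).flatMap F =
      (List.range K).flatMap fun k => F (2 * k) ++ F (2 * k + 1) := by
  induction K with
  | zero => rfl
  | succ K ih =>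
    rw [show 2 * (K + 1) = 2 * K + 1 + 1 by ring, List.range_succ, List.range_succ, List.range_succ]
    simp [ih]

theorem shiftedGate_eq {N M : ℕ} (e : Fin N ↪ Fin M) {O P : ℕ} (he : ∀ i, (e i : ℕ) = i + O)
    {f : ℕ → ℕ} {g : Gate N} (hg : Holds f P g.encode) :
    shiftedGate f O P = (g.map e).encode := by
  have g0 := hg 0 (by rw [g.length_encode]; norm_num)
  have g1 := hg 1 (by rw [g.length_encode]; norm_num)
  have g2 := hg 2 (by rw [g.length_encode]; norm_num)
  have g3 := hg 3 (by rw [g.length_encode]; norm_num)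
  rw [add_zero] at g0
  rcases g with i | (t | ⟨c, t, h⟩ | ⟨c, d, t, h₁, h₂, h₃⟩) <;>
  simp only [Gate.encode, List.getD_cons_zero, List.getD_cons_succ] at g0 g1 g2 g3 <;>
  simp [shiftedGate, g0, g1, g2, g3, Gate.map, ClassicalGate.map, Gate.encode, he]

theorem shiftedGates_eq {N M : ℕ} (e : Fin N ↪ Fin M) {O P : ℕ} (he : ∀ i, (e i : ℕ) = i + O)
    {f : ℕ → ℕ} {U : Circuit N} (hU : Holds f P (U.flatMap Gate.encode)) :
    shiftedGates f O P U.length = (Circuit.map e U).flatMap Gate.encode := by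
  induction U generalizing P with
  | nil => rfl
  | cons g U ih =>
    rw [List.flatMap_cons] at hU
    have h := ih (g.length_encode ▸ hU.append_right)
    rw [Circuit.map, List.map_cons, List.flatMap_cons, ← shiftedGate_eq e he hU.append_left]
    rw [Circuit.map] at h
    rw [← h, List.length_cons, shiftedGates, List.range_succ_eq_map, List.flatMap_cons,
      List.flatMap_map, shiftedGates]
    simp only [mul_zero, add_zero, mul_add, mul_one, add_assoc, add_comm 4, Nat.succ_eq_add_one]

theorem blockEmb_val {J N : ℕ} (j : Fin J) (i : Fin N) : (blockEmb J N j i : ℕ) = i + N * j := rfl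

/-- Alternately the two circuits of an instance. -/
def Instance.circuits (I : Instance) (j : ℕ) : Circuit I.N := if j % 2 = 0 then I.U₁ else I.U₂

/-- Copy `k` in the program writes the first circuit to block `2 * k` and the second to block `2 * k
+ 1`, and block `j` starts at qubit `j * N`. On a genuine instance the minima in the output formula
are the true counts. -/
theorem generator_encode (d : ℕ) (I : Instance) :
    generator d I.encode =
      Circuit.encode (blockCircuit (2 * I.encode.length ^ d) I.circuits) := by
  obtain ⟨u, hu, h9, hgen⟩ := generator_eq d I.encode
  set K := I.encode.length ^ d with hK
  have hI : u.Parsed I fun j => I.encode.getD j 0 := by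
    rw [hu]
    have e0 : ((prepareGenerate d).exec (load [I.encode])).arr 0 = fun j => I.encode.getD j 0 := by
      rw [prepareGenerate_exec]
      rfl
    rw [← e0]
    refine parsed_of_holds ?_ ?_
    · rw [prepareGenerate_exec]
      exact holds_getD _
    · rw [prepareGenerate_exec]
      simp [load]
  set f := fun j => I.encode.getD j 0 with hf
  have hcopies : copies u f K =
      (blockCircuit (2 * K) I.circuits).flatMap Gate.encode := by
    obtain ⟨F, hF⟩ : ∃ F : ℕ → List ℕ, ∀ j, F j = shiftedGates f (j * I.N)
      (if j % 2 = 0 then u.reg 22 else u.reg 23) (I.circuits j).length := ⟨_, fun _ => rfl⟩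
    have h1 : ∀ j : Fin (2 * K), (Circuit.map (blockEmb (2 * K) I.N j) (I.circuits j)).flatMap
        Gate.encode = F j := by
      intro j
      rw [hF, ← shiftedGates_eq (f := f) (O := j * I.N) (P := if j.val % 2 = 0 then u.reg 22
        else u.reg 23) (blockEmb (2 * K) I.N j) ?_ ?_]
      · intro i
        rw [blockEmb_val, mul_comm]
      · rw [Instance.circuits]
        split_ifs
        exacts [hI.gates₁, hI.gates₂]
    rw [blockCircuit, List.flatMap_assoc]
    simp_rw [h1]
    rw [← List.flatMap_map (fun j : Fin (2 * K) => j.val) F, List.map_coe_finRange_eq_range,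
      flatMap_range_two_mul, copies]
    refine List.flatMap_congr fun k _ => ?_
    have e1 : 2 * k % 2 = 0 := by omega
    have e2 : (2 * k + 1) % 2 = 1 := by omega
    simp only [hF, e1, e2, Instance.circuits, if_true, one_ne_zero, if_false, hI.reg20, hI.reg21,
      hI.reg24, min_eq_right hI.length₁_le, min_eq_right hI.length₂_le]
    rw [show 2 * k * I.N = k * (2 * I.N) by ring,
      show (2 * k + 1) * I.N = k * (2 * I.N) + I.N by ring]
  have hlen : (blockCircuit (2 * K) I.circuits).length = (u.reg 21 + u.reg 24) * K := by
    have h1 : (copies u f K).length = K * (4 * u.reg 21 + 4 * u.reg 24) := by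
      have m1 : min (u.reg 9) (u.reg 21) = u.reg 21 :=
        min_eq_right (by rw [hI.reg21]; exact hI.length₁_le)
      have m2 : min (u.reg 9) (u.reg 24) = u.reg 24 :=
        min_eq_right (by rw [hI.reg24]; exact hI.length₂_le)
      rw [copies, List.length_flatMap]
      simp [length_shiftedGates, m1, m2]
    have h2 := length_flatMap_encode (blockCircuit (2 * K) I.circuits)
    rw [← hcopies, h1] at h2
    linarith
  have hmin : min I.encode.length (u.reg 20) = I.N := by
    rw [hI.reg20, min_eq_right]
    rw [← h9]
    exact hI.N_le
  rw [hgen, hcopies, Circuit.encode, hlen, hmin, show K * (2 * I.N) = 2 * K * I.N by ring]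

/-! ## Measuring independent copies -/

/-- Multiply by `(1 + a) ^ K`, which is at least 10 by Bernoulli's inequality, and use `(1 - a) * (1
+ a) ≤ 1`. -/
theorem one_sub_pow_le {a : ℝ} (ha : 0 ≤ a) (ha' : a ≤ 1) {K : ℕ} (hK : 9 ≤ K * a) :
    (1 - a) ^ K ≤ 1 / 10 := by
  have h1 : (1 - a) ^ K * (1 + a) ^ K ≤ 1 := by
    rw [← mul_pow]
    exact pow_le_one₀ (by nlinarith) (by nlinarith)
  have h2 : 1 + K * a ≤ (1 + a) ^ K := one_add_mul_le_pow (by linarith) K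
  have h3 : 0 ≤ (1 - a) ^ K := pow_nonneg (by linarith) K
  nlinarith

open Classical in
/-- The probability that no block yields the outcome `z₀`. -/
theorem sum_prob_missing {N J : ℕ} (V : ℕ → Circuit N) (z₀ : Fin N → Bool) :
    ∑ z : Fin (J * N) → Bool, (if ∃ j, z ∘ blockEmb J N j = z₀ then 0
      else prob (blockCircuit J V) z) = ∏ j : Fin J, (1 - prob (V j) z₀) := by
  have h1 : ∀ j : Fin J, 1 - prob (V j) z₀ = ∑ u, if u = z₀ then 0 else prob (V j) u := by
    intro j
    rw [← sum_prob (V j), sub_eq_iff_eq_add, ← Fintype.sum_ite_eq' z₀ (prob (V j)),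
      ← sum_add_distrib]
    refine sum_congr rfl fun u _ => ?_
    split_ifs <;> simp
  rw [prod_congr rfl fun j _ => h1 j, Fintype.prod_sum]
  rw [← ((Equiv.arrowCongr finProdFinEquiv.symm (Equiv.refl Bool)).trans
    (Equiv.curry (Fin J) (Fin N) Bool)).sum_comp]
  refine sum_congr rfl fun z _ => ?_
  have hz : ∀ j, ((Equiv.arrowCongr finProdFinEquiv.symm (Equiv.refl Bool)).trans
    (Equiv.curry (Fin J) (Fin N) Bool)) z j = z ∘ blockEmb J N j := fun j => rfl
  simp only [hz]
  split_ifs with h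
  · obtain ⟨j, hj⟩ := h
    symm
    exact prod_eq_zero (mem_univ j) (if_pos hj)
  · rw [prob_blockCircuit]
    refine prod_congr rfl fun j _ => (if_neg fun hj => h ⟨j, hj⟩).symm

theorem prob_le_one {N : ℕ} (U : Circuit N) (z : Fin N → Bool) : prob U z ≤ 1 := by
  rw [← sum_prob U]
  exact single_le_sum (fun z _ => prob_nonneg U z) (mem_univ z)

theorem prod_range_two_mul (F : ℕ → ℝ) (K : ℕ) :
    ∏ j ∈ range (2 * K), F j = (∏ k ∈ range K, F (2 * k)) * ∏ k ∈ range K, F (2 * k + 1) := by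
  induction K with
  | zero => simp
  | succ K ih =>
    rw [show 2 * (K + 1) = 2 * K + 1 + 1 by ring, prod_range_succ, prod_range_succ, ih,
      prod_range_succ, prod_range_succ]
    ring

/-- An outcome that one of the circuits has with probability at least `a` is found in one of
sufficiently many copies. -/
theorem prod_missing_le {I : Instance} {K : ℕ} {z₀ : Fin I.N → Bool} {a : ℝ}
    (hz : a ≤ |prob I.U₁ z₀ - prob I.U₂ z₀|) (hK : 9 ≤ K * a) :
    ∏ j : Fin (2 * K), (1 - prob (I.circuits j) z₀) ≤ 1 / 10 := by
  rw [← Finset.prod_range fun j => 1 - prob (I.circuits j) z₀,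
    prod_range_two_mul fun j => 1 - prob (I.circuits j) z₀]
  have e1 : ∀ k, I.circuits (2 * k) = I.U₁ := fun k => if_pos (by omega)
  have e2 : ∀ k, I.circuits (2 * k + 1) = I.U₂ := fun k => if_neg (by omega)
  simp only [e1, e2, prod_const, card_range]
  have p1 := prob_nonneg I.U₁ z₀
  have p2 := prob_nonneg I.U₂ z₀
  have q1 := prob_le_one I.U₁ z₀
  have q2 := prob_le_one I.U₂ z₀
  have r1 : (1 - prob I.U₁ z₀) ^ K ≤ 1 := pow_le_one₀ (by linarith) (by linarith)
  have r2 : (1 - prob I.U₂ z₀) ^ K ≤ 1 := pow_le_one₀ (by linarith) (by linarith)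
  have s1 : 0 ≤ (1 - prob I.U₁ z₀) ^ K := pow_nonneg (by linarith) _
  have s2 : 0 ≤ (1 - prob I.U₂ z₀) ^ K := pow_nonneg (by linarith) _
  -- Probabilities are nonnegative, so the larger of the two is at least `a`. Its copies alone
  -- suffice, and those of the other circuit contribute a factor at most 1.
  rcases le_abs.1 hz with h | h
  · have := one_sub_pow_le p1 q1 (K := K) (hK.trans (by gcongr; linarith))
    nlinarith
  · have := one_sub_pow_le p2 q2 (K := K) (hK.trans (by gcongr; linarith))
    nlinarith

/-! ## The Merlin-Arthur system -/

theorem eval_mono (p : Polynomial ℕ) {m n : ℕ} (h : m ≤ n) : p.eval m ≤ p.eval n := by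
  rw [Polynomial.eval_eq_sum_range, Polynomial.eval_eq_sum_range]
  gcongr

/-- The generator makes a pure power of the input length many copies, so the polynomial is dominated
by a power. From 2 on, a coefficient `c` is absorbed by `c ≤ 2 ^ c ≤ n ^ c`. -/
theorem exists_eval_le_pow (p : Polynomial ℕ) : ∃ d : ℕ, ∀ n, 2 ≤ n → p.eval n ≤ n ^ d := by
  induction p using Polynomial.induction_on' with
  | add p q hp hq =>
    obtain ⟨d, hd⟩ := hp
    obtain ⟨e, he⟩ := hq
    refine ⟨d + e + 1, fun n hn => ?_⟩
    have h1 : n ^ d ≤ n ^ (d + e) := Nat.pow_le_pow_right (by omega) (by omega)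
    have h2 : n ^ e ≤ n ^ (d + e) := Nat.pow_le_pow_right (by omega) (by omega)
    have h3 : n ^ (d + e) * 2 ≤ n ^ (d + e + 1) := by
      rw [pow_succ]
      gcongr
    have := hd n hn
    have := he n hn
    rw [Polynomial.eval_add]
    omega
  | monomial k c =>
    refine ⟨c + k, fun n hn => ?_⟩
    rw [Polynomial.eval_monomial, pow_add]
    gcongr
    exact c.lt_two_pow_self.le.trans (Nat.pow_le_pow_left hn c)

/-- Arthur's program. -/
def verifier : Prog := .seq saveLengths.compile verify.compile

theorem exists_run_verifier : ∃ q : Polynomial ℕ, ∀ (w : List ℕ) (m r : List Bool),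
    ∃ t, Run verifier (load [w, bits m, bits r])
      (verify.exec (saveLengths.exec (load [w, bits m, bits r]))) t ∧
      t ≤ q.eval (size w + m.length + r.length + 1) := by
  obtain ⟨q, hq⟩ := Cmd.exists_run_seq saveLengths_ok verify_ok Polynomial.X
  refine ⟨q, fun w m r => ?_⟩
  have hw := length_le_size w
  -- The summand 1 lets `n` bound the bit length of single message and random bits.
  set n := size w + m.length + r.length + 1 with hn
  have hm : (bits m).length = m.length := List.length_map _
  have hr : (bits r).length = r.length := List.length_map _
  have h0 : (load [w, bits m, bits r]).reg 0 = w.length := rfl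
  have h1 : (load [w, bits m, bits r]).reg 1 = m.length := hm
  have h2 : (load [w, bits m, bits r]).reg 2 = r.length := hr
  have hbit : ∀ b : Bool, Nat.size b.toNat ≤ 1 := by decide
  obtain ⟨t, ht, ht', -⟩ := hq (load [w, bits m, bits r]) n
    ⟨by
      simp only [List.mem_cons, List.not_mem_nil, or_false, forall_eq_or_imp, forall_eq, h0, h1, h2]
      omega,
    by
      simp only [List.mem_cons, List.not_mem_nil, or_false, forall_eq]
      exact fun j => (size_getD_le w j).trans (by omega)⟩
    ⟨fun i => by
      refine (size_le_self _).trans ?_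
      rcases i with _ | _ | _ | i
      · rw [h0]; omega
      · rw [h1]; omega
      · rw [h2]; omega
      · simp [load],
    fun k j => by
      rcases k with _ | _ | _ | k
      · exact (size_getD_le w j).trans (by omega)
      · change Nat.size ((bits m).getD j 0) ≤ n
        rw [bits_getD]
        exact (hbit _).trans (by omega)
      · change Nat.size ((bits r).getD j 0) ≤ n
        rw [bits_getD]
        exact (hbit _).trans (by omega)
      · simp [load]⟩
    ⟨by
      simp only [List.mem_cons, List.not_mem_nil, or_false, forall_eq_or_imp, forall_eq,
        Polynomial.eval_X]
      refine ⟨?_, ?_, ?_⟩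
      · change w.length ≤ n
        omega
      · change (bits m).length ≤ n
        omega
      · change (bits r).length ≤ n
        omega,
    by
      simp only [List.mem_cons, List.not_mem_nil, or_false, forall_eq]
      intro j
      rw [Cmd.exec_arr rfl]
      simp only [Polynomial.eval_X]
      exact (size_getD_le w j).trans (by omega)⟩
  exact ⟨t, ht, ht'⟩

theorem accepts_iff {I : Instance} (hN : 1 ≤ I.N) (m r : List Bool) :
    Accepts verifier I.encode m r ↔
      ∃ c < m.length, Passes I r (r.length / (2 * I.N)) (window m (c * I.N) I.N) := by
  rw [← verifier_spec hN]
  obtain ⟨q, hq⟩ := exists_run_verifier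
  obtain ⟨t, ht, -⟩ := hq I.encode m r
  constructor
  · rintro ⟨s, t', hr, h⟩
    rwa [hr.deterministic ht] at h
  · exact fun h => ⟨_, t, ht, h⟩

theorem two_le_length_encode {I : Instance} : 2 ≤ I.encode.length ∧ I.N ≤ I.encode.length := by
  simp only [Instance.encode, Circuit.encode, List.length_append, List.length_replicate,
    List.length_cons, List.length_nil]
  omega

open Classical in
theorem acceptProb_eq {I : Instance} (hN : 1 ≤ I.N) (R : ℕ) (m : List Bool) :
    acceptProb verifier R I.encode m = ((univ.filter fun r : Fin R → Bool =>
      ∃ c < m.length, Passes I (List.ofFn r) (R / (2 * I.N)) (window m (c * I.N) I.N)).card : ℝ) /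
        2 ^ R := by
  rw [acceptProb]
  congr 2
  rw [Nat.card_eq_fintype_card, Fintype.card_subtype]
  congr 1
  ext r
  simp [accepts_iff hN]

/-- The data of a valid instance that are used in the analysis of the verifier. -/
structure Instance.Good (I : Instance) (P : ℕ) : Prop where
  hc₁ : IsHC1Q I.N I.U₁
  hc₂ : IsHC1Q I.N I.U₂
  b_nonneg : 0 ≤ I.b
  b_lt : I.b < I.a
  gap : 1 ≤ (P : ℝ) * ((I.a : ℝ) - I.b)

/-- Union bound: by Chebyshev a candidate passes with probability at most `16 * P ^ 2 / T`, and
there are `m.length` candidates. The constant 48 is three times 16. -/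
theorem acceptProb_le_of_no {I : Instance} {P : ℕ} (hI : I.Good P)
    (hno : ∀ z : Fin I.N → Bool, |prob I.U₁ z - prob I.U₂ z| ≤ (I.b : ℝ)) {R T : ℕ} (hT0 : 0 < T)
    (hT : T = R / (2 * I.N)) (m : List Bool) (hTm : 48 * m.length * P ^ 2 ≤ T) :
    acceptProb verifier R I.encode m ≤ 1 / 3 := by
  classical
  have hba : (I.b : ℝ) < I.a := by exact_mod_cast hI.b_lt
  have hR : 2 * I.N * T ≤ R := hT ▸ Nat.mul_div_le _ _
  have hT' : (0 : ℝ) < T := by exact_mod_cast hT0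
  rw [acceptProb_eq hI.hc₁.1, ← hT, div_le_iff₀ (by positivity)]
  set S : ℕ → Finset (Fin R → Bool) := fun c => univ.filter fun r =>
    Passes I (List.ofFn r) T (window m (c * I.N) I.N) with hS
  have hsub : (univ.filter fun r : Fin R → Bool =>
      ∃ c < m.length, Passes I (List.ofFn r) T (window m (c * I.N) I.N)) ⊆
      (range m.length).biUnion S := by
    intro r hr
    obtain ⟨c, hc, h⟩ := (mem_filter.1 hr).2
    exact mem_biUnion.2 ⟨c, mem_range.2 hc, mem_filter.2 ⟨mem_univ _, h⟩⟩
  have hc : ∀ c, ((S c).card : ℝ) * T ≤ 16 * (P : ℝ) ^ 2 * 2 ^ R := by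
    intro c
    refine card_deviation_le hI.hc₁ hI.hc₂ (window m (c * I.N) I.N) hT0 hR (sub_pos.2 hba) hI.gap _
      fun r hr => ?_
    have h1 := (passes_iff (hI.b_nonneg.trans hI.b_lt.le) hI.b_nonneg _ _ _).1 (mem_filter.1 hr).2
    have h2 := hno (window m (c * I.N) I.N)
    set E : ℝ := (estimate I (window m (c * I.N) I.N) (List.ofFn r) T : ℝ)
    set Δ := prob I.U₁ (window m (c * I.N) I.N) - prob I.U₂ (window m (c * I.N) I.N)
    -- A passing estimate has `2 * |E| ≥ T * (a + b)` although `|Δ| ≤ b`, so it is off by at least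
    -- `T * (a - b) / 2`.
    have h3 : |E| ≤ |E - T * Δ| + T * |Δ| := by
      have := abs_add_le (E - T * Δ) (T * Δ)
      rwa [sub_add_cancel, abs_mul, abs_of_pos hT'] at this
    have h4 : T * |Δ| ≤ T * I.b := by gcongr
    linarith
  have hcard : ((univ.filter fun r : Fin R → Bool =>
      ∃ c < m.length, Passes I (List.ofFn r) T (window m (c * I.N) I.N)).card : ℝ) ≤
      ∑ c ∈ range m.length, ((S c).card : ℝ) := by
    exact_mod_cast (card_le_card hsub).trans card_biUnion_le
  have h5 : (∑ c ∈ range m.length, ((S c).card : ℝ)) * T ≤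
      m.length * (16 * (P : ℝ) ^ 2 * 2 ^ R) := by
    rw [sum_mul]
    refine (sum_le_sum fun c _ => hc c).trans ?_
    rw [sum_const, card_range, nsmul_eq_mul]
  have h6 : (48 : ℝ) * m.length * (P : ℝ) ^ 2 ≤ T := by exact_mod_cast hTm
  refine hcard.trans (le_of_mul_le_mul_right ?_ hT')
  have h7 : (48 : ℝ) * m.length * (P : ℝ) ^ 2 * 2 ^ R ≤ T * 2 ^ R := by gcongr
  linarith

/-- It suffices that the candidate `z₀` passes; the others can only help. Failing is a deviation of
at least `T * (a - b) / 2`, and `T ≥ 160 * P ^ 2` makes its probability at most 16/160. -/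
theorem le_acceptProb_of_candidate {I : Instance} {P : ℕ} (hI : I.Good P) {z₀ : Fin I.N → Bool}
    (hz₀ : (I.a : ℝ) ≤ |prob I.U₁ z₀ - prob I.U₂ z₀|) {R T : ℕ} (hT0 : 0 < T)
    (hT : T = R / (2 * I.N)) (hTP : 160 * P ^ 2 ≤ T) (m : List Bool) {c : ℕ} (hc : c < m.length)
    (hmc : window m (c * I.N) I.N = z₀) :
    9 / 10 ≤ acceptProb verifier R I.encode m := by
  classical
  have hba : (I.b : ℝ) < I.a := by exact_mod_cast hI.b_lt
  have hR : 2 * I.N * T ≤ R := hT ▸ Nat.mul_div_le _ _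
  have hT' : (0 : ℝ) < T := by exact_mod_cast hT0
  rw [acceptProb_eq hI.hc₁.1, ← hT, le_div_iff₀ (by positivity)]
  set A := univ.filter fun r : Fin R → Bool =>
      ∃ c < m.length, Passes I (List.ofFn r) T (window m (c * I.N) I.N) with hA
  have hdev : ((Aᶜ).card : ℝ) * T ≤ 16 * (P : ℝ) ^ 2 * 2 ^ R := by
    refine card_deviation_le hI.hc₁ hI.hc₂ z₀ hT0 hR (sub_pos.2 hba) hI.gap _ fun r hr => ?_
    have h1 : ¬ Passes I (List.ofFn r) T z₀ := fun h => by
      rw [mem_compl, hA, mem_filter] at hr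
      exact hr ⟨mem_univ _, c, hc, hmc ▸ h⟩
    rw [passes_iff (hI.b_nonneg.trans hI.b_lt.le) hI.b_nonneg, not_le] at h1
    set E : ℝ := (estimate I z₀ (List.ofFn r) T : ℝ)
    set Δ := prob I.U₁ z₀ - prob I.U₂ z₀
    have h3 : T * |Δ| ≤ |E - T * Δ| + |E| := by
      have := abs_sub_le (T * Δ) E 0
      rwa [sub_zero, sub_zero, abs_mul, abs_of_pos hT', abs_sub_comm (T * Δ) E] at this
    have h4 : T * (I.a : ℝ) ≤ T * |Δ| := by gcongr
    linarith
  have hsum : (A.card : ℝ) + (Aᶜ).card = 2 ^ R := by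
    have := card_add_card_compl A
    rw [Fintype.card_fun, Fintype.card_bool, Fintype.card_fin] at this
    exact_mod_cast this
  have h6 : (160 : ℝ) * (P : ℝ) ^ 2 ≤ T := by exact_mod_cast hTP
  have h7 : ((Aᶜ).card : ℝ) ≤ 1 / 10 * 2 ^ R := by
    refine le_of_mul_le_mul_right ?_ hT'
    have : (160 : ℝ) * (P : ℝ) ^ 2 * 2 ^ R ≤ T * 2 ^ R := by gcongr
    linarith
  linarith

theorem acceptProb_nonneg (V : Prog) (R : ℕ) (w : List ℕ) (m : List Bool) :
    0 ≤ acceptProb V R w m := by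
  rw [acceptProb]
  positivity

/-- The outcomes in which some block shows `z₀` have total probability at least 9/10, and each of
them is accepted with probability at least 9/10. The product 81/100 exceeds 2/3. -/
theorem le_sum_of_yes {I : Instance} {P K : ℕ} (hI : I.Good P) {z₀ : Fin I.N → Bool}
    (hz₀ : (I.a : ℝ) ≤ |prob I.U₁ z₀ - prob I.U₂ z₀|) {R T : ℕ} (hT0 : 0 < T)
    (hT : T = R / (2 * I.N)) (hTP : 160 * P ^ 2 ≤ T) (hK : 9 * P ≤ K) :
    2 / 3 ≤ ∑ z : Fin (2 * K * I.N) → Bool, prob (blockCircuit (2 * K) I.circuits) z *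
      acceptProb verifier R I.encode (List.ofFn z) := by
  classical
  have hN := hI.hc₁.1
  have hb : (0 : ℝ) ≤ I.b := by exact_mod_cast hI.b_nonneg
  have hba : (I.b : ℝ) < I.a := by exact_mod_cast hI.b_lt
  have hKa : (9 : ℝ) ≤ K * I.a := by
    have h1 : (9 : ℝ) * P ≤ K := by exact_mod_cast hK
    have h2 : (9 : ℝ) * P * I.a ≤ K * I.a := by
      gcongr
      linarith
    have h3 : (P : ℝ) * (I.a - I.b) ≤ P * I.a := by
      gcongr
      linarith
    linarith [hI.gap]
  have hmiss := prod_missing_le hz₀ hKa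
  rw [← sum_prob_missing] at hmiss
  have hterm : ∀ z : Fin (2 * K * I.N) → Bool,
      9 / 10 * (prob (blockCircuit (2 * K) I.circuits) z -
        if ∃ j, z ∘ blockEmb (2 * K) I.N j = z₀ then 0
          else prob (blockCircuit (2 * K) I.circuits) z) ≤
      prob (blockCircuit (2 * K) I.circuits) z *
        acceptProb verifier R I.encode (List.ofFn z) := by
    intro z
    have hp := prob_nonneg (blockCircuit (2 * K) I.circuits) z
    split_ifs with h
    · obtain ⟨j, hj⟩ := h
      have hacc := le_acceptProb_of_candidate hI hz₀ hT0 hT hTP (List.ofFn z) (c := j)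
        (by
          rw [List.length_ofFn]
          exact j.isLt.trans_le (Nat.le_mul_of_pos_right _ hN))
        (by
          rw [← hj]
          funext i
          have e : (blockEmb (2 * K) I.N j i).val = j * I.N + i := by
            rw [blockEmb_val, mul_comm, add_comm]
          rw [window_ofFn z i (e ▸ (blockEmb (2 * K) I.N j i).isLt)]
          exact congrArg z (Fin.ext e.symm))
      nlinarith
    · rw [sub_self, mul_zero]
      exact mul_nonneg hp (acceptProb_nonneg _ _ _ _)
  refine le_trans ?_ (sum_le_sum fun z _ => hterm z)
  rw [← mul_sum, sum_sub_distrib, sum_prob]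
  linarith

theorem Instance.Valid.good {p : Polynomial ℕ} {I : Instance} (h : I.Valid p)
    (h₁ : IsHC1Q I.N I.U₁) (h₂ : IsHC1Q I.N I.U₂) {P : ℕ} (hP : p.eval I.N ≤ P) : I.Good P where
  hc₁ := h₁
  hc₂ := h₂
  b_nonneg := h.2.2.1
  b_lt := h.2.2.2.1
  gap := by
    have h3 : (1 : ℝ) ≤ ((p.eval I.N : ℕ) : ℝ) * ((I.a : ℝ) - I.b) := by
      exact_mod_cast h.2.2.2.2.2
    have h4 : (0 : ℝ) ≤ (I.a : ℝ) - I.b := by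
      have : (I.b : ℝ) < I.a := by exact_mod_cast h.2.2.2.1
      linarith
    refine h3.trans ?_
    gcongr

theorem hasMerlinArthurSystem_pddMax (p : Polynomial ℕ) :
    HasMerlinArthurSystemWithQuantumPolyTimeMerlin (PDDMax p IsHC1Q) := by
  -- The factor 9 is the number of expected hits that makes missing `z₀` have probability at most
  -- 1/10.
  obtain ⟨d, hd⟩ := exists_eval_le_pow (9 * p)
  obtain ⟨q, hq⟩ := exists_run_verifier
  -- Merlin's circuit has `2 * length ^ d` blocks of `N` qubits, and both the length and `N` are at
  -- most the size of the input.
  set μ : Polynomial ℕ := 2 * Polynomial.X ^ d * Polynomial.X with hμ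
  -- The number of samples covers both demands, `48 * m.length * P ^ 2` for soundness and `160 * P ^
  -- 2` for completeness, and the final 1 makes it positive.
  set τ : Polynomial ℕ := 160 * (μ + 1) * p ^ 2 + 1 with hτ
  -- A sample uses `2 * N` random bits. As `N` is at most the size of the input, `ρ` bits are enough
  -- for `τ` samples; Arthur uses as many as fit.
  set ρ : Polynomial ℕ := 2 * Polynomial.X * τ with hρ
  have hsamples : ∀ (I : Instance) (P : ℕ), 1 ≤ I.N → p.eval (size I.encode) = P →
      0 < ρ.eval (size I.encode) / (2 * I.N) ∧
      160 * (μ.eval (size I.encode) + 1) * P ^ 2 ≤ ρ.eval (size I.encode) / (2 * I.N) := by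
    rintro I P hN rfl
    have hn : I.N ≤ size I.encode := two_le_length_encode.2.trans (length_le_size _)
    have h : τ.eval (size I.encode) ≤ ρ.eval (size I.encode) / (2 * I.N) := by
      rw [Nat.le_div_iff_mul_le (by omega), hρ, Polynomial.eval_mul, Polynomial.eval_mul,
        Polynomial.eval_X, Polynomial.eval_ofNat, mul_comm]
      gcongr
    have hτe : τ.eval (size I.encode) =
        160 * (μ.eval (size I.encode) + 1) * p.eval (size I.encode) ^ 2 + 1 := by
      simp [hτ]
    constructor <;> omega
  refine ⟨verifier, μ, ρ, q.comp (Polynomial.X + μ + ρ + 1), generator d, ?_,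
    polyTime_generator d, ?_, ?_⟩
  · intro w m r hm hr
    obtain ⟨t, ht, ht'⟩ := hq w m r
    refine ⟨_, t, ht, ht'.trans ?_⟩
    rw [Polynomial.eval_comp]
    refine eval_mono q ?_
    simp only [Polynomial.eval_add, Polynomial.eval_X, Polynomial.eval_one]
    omega
  · rintro w ⟨I, rfl, hV, h₁, h₂, z₀, hz₀⟩
    have hn : I.N ≤ size I.encode := two_le_length_encode.2.trans (length_le_size _)
    obtain ⟨hT0, hT⟩ := hsamples I _ h₁.1 rfl
    have hgood := hV.good h₁ h₂ (eval_mono p hn)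
    -- The number of copies is a power of the length of the word, not of its bit size, so here the
    -- gap is expressed with `p` at the length.
    have hgood' := hV.good h₁ h₂ (eval_mono p two_le_length_encode.2)
    refine ⟨_, blockCircuit (2 * I.encode.length ^ d) I.circuits, generator_encode d I, ?_, ?_⟩
    · have h1 := length_le_size I.encode
      have h2 := two_le_length_encode (I := I).2
      simp only [hμ, Polynomial.eval_mul, Polynomial.eval_pow, Polynomial.eval_X,
        Polynomial.eval_ofNat]
      gcongr
    · refine le_sum_of_yes hgood' hz₀ hT0 rfl ?_ ?_
      · refine le_trans ?_ hT
        have h1 := eval_mono p (length_le_size I.encode)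
        calc 160 * p.eval I.encode.length ^ 2
            ≤ 160 * p.eval (size I.encode) ^ 2 := by gcongr
          _ ≤ 160 * (μ.eval (size I.encode) + 1) * p.eval (size I.encode) ^ 2 := by
              gcongr
              omega
      · have := hd _ (two_le_length_encode (I := I)).1
        simpa using this
  · rintro w ⟨I, rfl, hV, h₁, h₂, hno⟩ m hm
    have hn : I.N ≤ size I.encode := two_le_length_encode.2.trans (length_le_size _)
    obtain ⟨hT0, hT⟩ := hsamples I _ h₁.1 rfl
    refine acceptProb_le_of_no (hV.good h₁ h₂ (eval_mono p hn)) hno hT0 rfl m (le_trans ?_ hT)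
    gcongr
    · norm_num
    · omega

end HC1Q

theorem theorem6 (p : Polynomial ℕ) :
    HC1Q.HasMerlinArthurSystemWithQuantumPolyTimeMerlin (HC1Q.PDDMax p HC1Q.IsHC1Q) :=
  HC1Q.hasMerlinArthurSystem_pddMax p
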